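/- Let $d\ge 2$, $c,C>0$. Call $A\subset\mathbb R^d$ *well-distributed* with constants $c,C$ if $\|a-a'\|\ge c$ for all distinct $a,a'\in A$ and every axis-parallel closed cube of side length $C$ meets $A$. Put $A_q=A\cap \overline{B}(0,q)$. Let $\phi:\mathbb R^d\to\mathbb R$ be smooth and radial, supported in the closed unit ball, positive in the interior of its support, with $\int\phi=1$ and $\widehat\phi\ge 0$. Let $p\in(1,2]$, $s=d/p$, $\phi_{r}(x)=r^{d}\phi(rx)$, and let $\mu_s$ be the measure with density $$\rho_s(x)=C_A\,q^{-d}\sum_{a\in q^{-1}A_q}\phi_{q^p}(x-a),$$ where $C_A$ is chosen so that $\int\rho_s=1$. Write $\widehat\mu(\xi)=\int e^{-2\pi i x\cdot\xi}\,d\mu(x)$ and $\sigma_\mu(t)=\int_{S^{d-1}}|\widehat\mu(t\omega)|^2\,d\omega$, with $d\omega$ the surface measure. *The sum $\Sigma_{d/2}$.* Fix $c_1>0$, $C_2\ge 4$ and a sequence $K=(K_k)_{k\ge0}$. For $t>0$ let $P$ be a maximal $c_1/\sqrt t$-separated subset of $S^{d-1}$. For each $w\in P$ choose an orthonormal basis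 of $\mathbb R^d$ whose first vector is $w$, let $x=X\cdot w$ be the first coordinate of $X\in\mathbb R^d$ and $y\in\mathbb R^{d-1}$ the remaining ones, and put $u_w(X)=(x,\sqrt t\,y)$. For $j\in\mathbb Z^d$ let $$R_{w,j}=\{X:\ u_w(X)-C_2 j\in[-C_2/2,C_2/2)^d\};$$ these are rectangles of size $C_2(1\times t^{-1/2}\times\dots\times t^{-1/2})$ tiling $\mathbb R^d$, of volume $|R_w|=C_2^d\,t^{-(d-1)/2}$. Let $\mathcal F$ be the set of smooth functions $\Psi:\mathbb R^d\to\mathbb C$ which vanish outside $[-C_2,C_2]^d$ and whose $k$-th derivative is bounded in norm by $K_k$, for every $k\ge 0$. Define $$\Sigma_{d/2}(t)=\sum_{w\in P}\frac1{|R_w|}\sum_{j\in\mathbb Z^d}\ \sup_{\Psi\in\mathcal F}\left|\int_{R_{w,j}}\Psi\big(u_w(X)-C_2j\big)\,e^{-2\pi i t\,w\cdot X}\,d\mu_{d/2}(X)\right|^2 .$$ **Theorem 1.1.** Let $d,\phi,p,c,C$ be as above. There is $q_0\ge 1$, depending only on $d,\phi,p,c,C$, such that the following holds. 1. There is a constant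 $C'$, depending only on $d,\phi,p,c,C$, such that for every $A$ well-distributed with constants $c,C$ and every $q\ge q_0$, $\mu_s$ is a compactly supported Borel probability measure with $\mu_s(\overline B(x,\delta))\le C'\delta^s$ for all $x\in\mathbb R^d$ and $0<\delta\le 1$, and $\iint\|x-y\|^{-s}\,d\mu_s(x)\,d\mu_s(y)\le C'$. 2. For all $c_0,c_1>0$ and $C_2\ge4$ there are a function $\eta:\mathbb R\to[0,\infty)$ with $\eta(\tau)\le C_n(1+|\tau|)^{-n}$ for all $\tau$ and every $n$, a sequence $K$ and a constant $C''>0$, depending only on $d,\phi,p,c,C,c_0,c_1,C_2$, such that for every $A$ well-distributed with constants $c,C$, every $q\ge q_0$ and every $t\ge c_0q$, $$\sigma_{\mu_s}(t)\le C''\,q^{-d+1}\,\eta\!\left(\frac t{q^p}\right),$$ and, if $p=2$ (that is, $s=d/2$), then for every choice of $P$ and of the orthonormal bases in the definition of $\Sigma_{d/2}(t)$, $$\sigma_{\mu_{d/2}}(t)\le C''\,t^{1-d}\,\Sigma_{d/2}(t),\qquad \Sigma_{d/2}(t)\le C''\,t^{\frac{d-1}2}\,\eta\!\left(\frac t{q^2}\right).$$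 -/

import Mathlib

open MeasureTheory
open scoped ENNReal FourierTransform ContDiff

/-- Euclidean space `ℝ^d`. -/
abbrev Euc (d : ℕ) : Type := EuclideanSpace ℝ (Fin d)

/-- `A` is a well-distributed (Delone) set with constants `c`, `C`: distinct points are at distance
at least `c`, and every closed axis-parallel cube of side length `C` meets `A`.  Such a set is
automatically infinite when `d ≥ 1`. -/
structure WellDistributed {d : ℕ} (c C : ℝ) (A : Set (Euc d)) : Prop where
  separated : ∀ a ∈ A, ∀ a' ∈ A, a ≠ a' → c ≤ ‖a - a'‖
  meets_cube : ∀ y : Euc d, ∃ a ∈ A, ∀ i, y i ≤ a i ∧ a i ≤ y i + C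

/-- The truncation `A_q = A ∩ B(0, q)`. -/
def truncation {d : ℕ} (A : Set (Euc d)) (q : ℝ) : Set (Euc d) :=
  A ∩ Metric.closedBall 0 q

/-- The radial test functions used for thickening: smooth, radial, supported in the unit ball,
positive in the interior of the support, of integral one, with non-negative Fourier transform. -/
structure IsThickener {d : ℕ} (φ : Euc d → ℝ) : Prop where
  smooth : ContDiff ℝ ∞ φ
  radial : ∀ x y : Euc d, ‖x‖ = ‖y‖ → φ x = φ y
  support_subset : tsupport φ ⊆ Metric.closedBall 0 1
  pos : ∀ x ∈ interior (tsupport φ), 0 < φ x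
  integral_eq_one : ∫ x, φ x = 1
  fourier_nonneg : ∀ ξ : Euc d,
    0 ≤ (𝓕 (fun x : Euc d => (φ x : ℂ)) ξ).re ∧ (𝓕 (fun x : Euc d => (φ x : ℂ)) ξ).im = 0

noncomputable section

/-- The `L¹`-normalised dilate `φ_r(x) = r^d φ(r x)`. -/
def dilate {d : ℕ} (φ : Euc d → ℝ) (r : ℝ) (x : Euc d) : ℝ :=
  r ^ d * φ (r • x)

/-- The density before normalisation, `q^{-d} ∑_{a ∈ q⁻¹ A_q} φ_{q^p}(x - a)`.  The sum is finite
when `A` is well-distributed. -/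
def rawDensity {d : ℕ} (φ : Euc d → ℝ) (p : ℝ) (A : Set (Euc d)) (q : ℝ) (x : Euc d) : ℝ :=
  (q ^ d)⁻¹ * ∑ᶠ a ∈ truncation A q, dilate φ (q ^ p) (x - q⁻¹ • a)

/-- The density `ρ_s`, `s = d / p`, normalised to have integral one. -/
def thickDensity {d : ℕ} (φ : Euc d → ℝ) (p : ℝ) (A : Set (Euc d)) (q : ℝ) (x : Euc d) : ℝ :=
  (∫ y, rawDensity φ p A q y)⁻¹ * rawDensity φ p A q x

/-- The measure `μ_s`, `dμ_s = ρ_s dx`, `s = d / p`. -/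
def thickMeasure {d : ℕ} (φ : Euc d → ℝ) (p : ℝ) (A : Set (Euc d)) (q : ℝ) : Measure (Euc d) :=
  volume.withDensity fun x => ENNReal.ofReal (thickDensity φ p A q x)

/-- The `s`-energy `∬ ‖x - y‖^{-s} dμ(x) dμ(y)`; the kernel is `∞` on the diagonal. -/
def rieszEnergy {d : ℕ} (s : ℝ) (μ : Measure (Euc d)) : ℝ≥0∞ :=
  ∫⁻ x, ∫⁻ y, edist x y ^ (-s) ∂μ ∂μ

/-- Membership in the class `𝓜_s`, with constant `C`: a compactly supported Borel probability
measure with `μ(B(x, δ)) ≤ C δ^s` for all `x` and `0 < δ ≤ 1` and with `s`-energy at most `C`. -/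
structure IsFrostman {d : ℕ} (s C : ℝ) (μ : Measure (Euc d)) : Prop where
  isProbability : IsProbabilityMeasure μ
  compact_support : ∃ E : Set (Euc d), IsCompact E ∧ μ Eᶜ = 0
  ball_le : ∀ (x : Euc d) (δ : ℝ), 0 < δ → δ ≤ 1 →
    μ (Metric.closedBall x δ) ≤ ENNReal.ofReal (C * δ ^ s)
  energy_le : rieszEnergy s μ ≤ ENNReal.ofReal C

/-- The Fourier transform of a measure, `∫ e^{-2πi x·ξ} dμ(x)`. -/
def measureFourier {d : ℕ} (μ : Measure (Euc d)) (ξ : Euc d) : ℂ :=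
  ∫ x, Complex.exp (-(2 * Real.pi * inner ℝ x ξ : ℝ) * Complex.I) ∂μ

/-- The spherical average `σ_μ(t) = ∫_{S^{d-1}} |μ̂(t θ)|² dθ`, with respect to the surface
measure of the unit sphere. -/
def sphericalAverage {d : ℕ} (μ : Measure (Euc d)) (t : ℝ) : ℝ :=
  ∫ θ : Metric.sphere (0 : Euc d) 1, ‖measureFourier μ (t • (θ : Euc d))‖ ^ 2
    ∂(volume : Measure (Euc d)).toSphere

/-- `η` is non-negative and decays faster than any power. -/
def RapidlyDecaying (η : ℝ → ℝ) : Prop :=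
  (∀ τ, 0 ≤ η τ) ∧ ∀ n : ℕ, ∃ C : ℝ, ∀ τ, η τ ≤ C * (1 + |τ|) ^ (-(n : ℝ))

/-- `P` is a maximal `δ`-separated set of directions on the unit sphere. -/
structure IsMaximalSeparated {d : ℕ} (δ : ℝ) (P : Finset (Euc d)) : Prop where
  on_sphere : ∀ w ∈ P, ‖w‖ = 1
  separated : ∀ w ∈ P, ∀ w' ∈ P, w ≠ w' → δ ≤ ‖w - w'‖
  maximal : ∀ θ : Euc d, ‖θ‖ = 1 → ∃ w ∈ P, ‖θ - w‖ < δ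

/-- Coordinates of `X` in the frame `b`, in which the first coordinate is kept and the other ones
are multiplied by `√t`.  They turn a rectangle of dimensions
`C₂ (1 × t^{-1/2} × ⋯ × t^{-1/2})` into a cube of side `C₂`. -/
def scaledCoord {d : ℕ} (t : ℝ) (b : OrthonormalBasis (Fin d) ℝ (Euc d)) (X : Euc d) : Euc d :=
  WithLp.toLp 2 fun i => (if i.val = 0 then 1 else √t) * inner ℝ (b i) X

/-- The centre `C₂ j` of the `j`-th cube in scaled coordinates. -/
def tileCentre {d : ℕ} (C₂ : ℝ) (j : Fin d → ℤ) : Euc d :=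
  WithLp.toLp 2 fun i => C₂ * (j i : ℝ)

/-- The rectangles `R_{w,j}`, of dimensions `C₂ (1 × t^{-1/2} × ⋯ × t^{-1/2})` with the first side
along the first vector of the frame `b`; they tile the space as `j` varies. -/
def tile {d : ℕ} (t C₂ : ℝ) (b : OrthonormalBasis (Fin d) ℝ (Euc d)) (j : Fin d → ℤ) :
    Set (Euc d) :=
  {X | ∀ i, -(C₂ / 2) ≤ (scaledCoord t b X - tileCentre C₂ j) i ∧
    (scaledCoord t b X - tileCentre C₂ j) i < C₂ / 2}

/-- Admissible amplitudes, in scaled coordinates centred at a tile: smooth functions which vanish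
outside the doubled tile and whose derivatives of order `k` are bounded by `K k`.  In the original
coordinates `(x, y)` each derivative in `x` costs `O(1)`, and each derivative in `y` costs
`O(√t)`. -/
structure IsAmplitude {d : ℕ} (K : ℕ → ℝ) (C₂ : ℝ) (Ψ : Euc d → ℂ) : Prop where
  smooth : ContDiff ℝ ∞ Ψ
  support_subset : ∀ u : Euc d, Ψ u ≠ 0 → ∀ i, |u i| ≤ C₂
  deriv_le : ∀ (k : ℕ) (u : Euc d), ‖iteratedFDeriv ℝ k Ψ u‖ ≤ K k

/-- The Fourier transform at frequency `t` of the one-dimensional measure obtained by restricting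
`μ` to the tile `R_{w,j}`, multiplying it by the amplitude `ψ`, and integrating out the variables
orthogonal to `w`. -/
def localFourier {d : ℕ} (μ : Measure (Euc d)) (t C₂ : ℝ) (w : Euc d)
    (b : OrthonormalBasis (Fin d) ℝ (Euc d)) (j : Fin d → ℤ) (Ψ : Euc d → ℂ) : ℂ :=
  ∫ X in tile t C₂ b j, Ψ (scaledCoord t b X - tileCentre C₂ j) *
    Complex.exp (-(2 * Real.pi * (t * inner ℝ w X) : ℝ) * Complex.I) ∂μ

/-- The volume `C₂^d t^{-(d-1)/2}` of a tile. -/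
def tileVolume (d : ℕ) (t C₂ : ℝ) : ℝ :=
  C₂ ^ d * t ^ (-((d : ℝ) - 1) / 2)

/-- The sum `Σ_{d/2}(t) = ∑_w |R_w|⁻¹ ∑_j sup_ψ |(ψ μ)_{w,j}^(t)|²` over the directions `w ∈ P`
and all tiles `R_{w,j}`, the supremum being over the admissible amplitudes. -/
def directionSum {d : ℕ} (μ : Measure (Euc d)) (K : ℕ → ℝ) (t C₂ : ℝ) (P : Finset (Euc d))
    (b : Euc d → OrthonormalBasis (Fin d) ℝ (Euc d)) : ℝ≥0∞ :=
  ∑ w ∈ P, ENNReal.ofReal (tileVolume d t C₂)⁻¹ *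
    ∑' j : Fin d → ℤ, ⨆ Ψ : {Ψ : Euc d → ℂ // IsAmplitude K C₂ Ψ},
      ‖localFourier μ t C₂ w (b w) j Ψ.1‖ₑ ^ 2

end

/-! ### Packing of separated points and volumes of shells. -/

section Packing

variable {d : ℕ}

/-! Put `R = q ^ p` and let `N` be the number of points of `A_q`. Separation and density give `N ≈ q
^ d`, so the normalised measure consists of `N` bumps of equal mass and radius `R⁻¹`, centred at
points that are `c / q`-separated. The function `envelope` is a model of this density; it dominates
the density and, with a factor `R ^ k`, its derivatives of order `k`.

Frostman bounds. Packing shows that the density is at most a constant times `R ^ d / q ^ d`, and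
that balls of radius `δ ≥ q⁻¹` have mass `O(δ ^ d)`. The exponent `s = d / p` is the one for which
`R ^ s = q ^ d`, that is, for which one bump has mass of order its radius to the power `s`.
Splitting the radii at `R⁻¹`, `q⁻¹` and `1` then gives both the ball condition and bounded energy
(`isFrostman_of_ball_bounds`).

Spherical averages. The transform of the measure at `ξ` is `N⁻¹ φ̂(ξ / R)` times the exponential sum
over `A_q` at `ξ / q` (`measureFourier_thickMeasure`). The first factor supplies the rapid decay in
`t / R`. By a large sieve with Gaussian weights (`exists_lintegral_expSum_gaussian_le`) the sum has
mean square `O(N)` on unit scale. A radial Sobolev inequality (`lintegral_sphere_le`) transfers this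
to spheres with the loss of a factor `q`, the size of the frequencies. The total is `N⁻² · q · N ≈ q
^ (1 - d)`.

Comparison with the direction sum. The sphere is covered by caps of radius `c₁ / √t` about the `w ∈
P`. By curvature, a cap departs from its tangent plane by `O(1 / t)`, so on each tile `e^{-2πi
tθ·X}` is `e^{-2πi t w·X}` times a phase depending only on the tile and `θ`, times the exponential
of a bounded quantity. The last factor is expanded into monomials; each of them, cut off and divided
by `(L + 1) ^ m`, is an admissible amplitude, with derivative bounds independent of the degree `m`
(`exists_monomial_amplitudes`). What remains is an exponential sum over the tiles, with lattice
frequencies, and the large sieve at scale `t ^ (-1/2)` decouples the tiles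
(`exists_lintegral_cap_expSum_le`).

Decay of the direction sum. On the support of the measure a tile coincides with a strip invariant in
the direction `w`, so one can integrate by parts along `w` without boundary terms
(`setIntegral_mul_exp_eq`), gaining `(1 + √t + R) / t` each time. Of the two factors of each squared
coefficient, one is bounded by the largest mass of a tile and the other is summed to the bounded
total mass (`exists_directionSum_thickMeasure_le`). For `p = 2` no integration is needed when `t ≤
q²`; when `t ≥ q²`, enough integrations absorb the growth of the tile masses relative to `t ^ (-(d -
1) / 2)` and yield any power of `q² / t`. -/

lemma volume_ball_euc (hd : 0 < d) (x : Euc d) {r : ℝ} (hr : 0 ≤ r) :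
    volume (Metric.ball x r) = ENNReal.ofReal (r ^ d) * volume (Metric.ball (0 : Euc d) 1) := by
  have : Nonempty (Fin d) := ⟨⟨0, hd⟩⟩
  have : Nontrivial (Euc d) := inferInstance
  rw [Measure.addHaar_ball _ _ hr, finrank_euclideanSpace_fin]

lemma volume_closedBall_euc (x : Euc d) {r : ℝ} (hr : 0 ≤ r) :
    volume (Metric.closedBall x r)
      = ENNReal.ofReal (r ^ d) * volume (Metric.ball (0 : Euc d) 1) := by
  rw [Measure.addHaar_closedBall _ _ hr, finrank_euclideanSpace_fin]

lemma volume_unitBall_ne_zero : volume (Metric.ball (0 : Euc d) 1) ≠ 0 :=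
  (Metric.measure_ball_pos volume 0 one_pos).ne'

lemma volume_unitBall_ne_top : volume (Metric.ball (0 : Euc d) 1) ≠ ⊤ :=
  measure_ball_lt_top.ne

lemma pairwiseDisjoint_ball {ι : Type*} {I : Finset ι} {x : ι → Euc d} {δ : ℝ}
    (hsep : ∀ i ∈ I, ∀ j ∈ I, i ≠ j → δ ≤ ‖x i - x j‖) :
    (I : Set ι).PairwiseDisjoint fun i => Metric.ball (x i) (δ / 2) := by
  intro i hi j hj hij
  apply Metric.ball_disjoint_ball
  rw [dist_eq_norm]
  linarith [hsep i hi j hj hij]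

/-- Packing: disjoint balls around separated points fit into the set which contains them. -/
lemma card_mul_volume_ball_le (hd : 0 < d) {ι : Type*} {I : Finset ι} {x : ι → Euc d} {δ : ℝ}
    (hδ : 0 ≤ δ) (hsep : ∀ i ∈ I, ∀ j ∈ I, i ≠ j → δ ≤ ‖x i - x j‖) {E : Set (Euc d)}
    (hE : ∀ i ∈ I, Metric.ball (x i) (δ / 2) ⊆ E) :
    (I.card : ℝ≥0∞) * (ENNReal.ofReal ((δ / 2) ^ d) * volume (Metric.ball (0 : Euc d) 1))
      ≤ volume E := by
  calc _ = ∑ i ∈ I, volume (Metric.ball (x i) (δ / 2)) := by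
        rw [Finset.sum_congr rfl fun i _ => volume_ball_euc hd (x i) (by positivity : 0 ≤ δ / 2)]
        simp
    _ = volume (⋃ i ∈ I, Metric.ball (x i) (δ / 2)) :=
        (measure_biUnion_finset (pairwiseDisjoint_ball hsep) fun _ _ => measurableSet_ball).symm
    _ ≤ volume E := measure_mono (Set.iUnion₂_subset hE)

/-- A bound for the number of separated points in a ball. -/
lemma card_le_of_subset_ball (hd : 0 < d) {ι : Type*} {I : Finset ι} {x : ι → Euc d} {δ : ℝ}
    (hδ : 0 < δ) (hsep : ∀ i ∈ I, ∀ j ∈ I, i ≠ j → δ ≤ ‖x i - x j‖) {y : Euc d} {r : ℝ}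
    (hr : 0 ≤ r) (hx : ∀ i ∈ I, ‖x i - y‖ ≤ r) :
    (I.card : ℝ) ≤ (2 * r / δ + 1) ^ d := by
  have h := card_mul_volume_ball_le hd hδ.le hsep (E := Metric.ball y (r + δ / 2)) fun i hi =>
    Metric.ball_subset_ball' (by rw [dist_eq_norm]; linarith [hx i hi])
  rw [volume_ball_euc hd y (by positivity), ← mul_assoc,
    ENNReal.mul_le_mul_iff_left volume_unitBall_ne_zero volume_unitBall_ne_top,
    ← ENNReal.ofReal_natCast, ← ENNReal.ofReal_mul (by positivity),
    ENNReal.ofReal_le_ofReal_iff (by positivity)] at h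
  calc (I.card : ℝ) = I.card * (δ / 2) ^ d / (δ / 2) ^ d := by field_simp
    _ ≤ (r + δ / 2) ^ d / (δ / 2) ^ d := by gcongr
    _ = _ := by rw [← div_pow]; congr 1; field_simp

/-- The volume of a spherical shell is at most proportional to its thickness. -/
lemma exists_volume_shell_le (hd : 0 < d) (M : ℝ) : ∃ C : ℝ, 0 < C ∧ ∀ δ : ℝ, 0 < δ → δ ≤ M →
    volume {x : Euc d | 1 - δ ≤ ‖x‖ ∧ ‖x‖ ≤ 1 + δ} ≤ ENNReal.ofReal (C * δ) := by
  set v := volume (Metric.ball (0 : Euc d) 1) with hv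
  have hv' : v ≠ ⊤ := volume_unitBall_ne_top
  set V := v.toReal
  have hV : v = ENNReal.ofReal V := (ENNReal.ofReal_toReal hv').symm
  refine ⟨(d + 2 ^ d * d + (1 + |M|) ^ d) * (V + 1), by positivity, fun δ hδ hM => ?_⟩
  have hsub : {x : Euc d | 1 - δ ≤ ‖x‖ ∧ ‖x‖ ≤ 1 + δ} ⊆
      Metric.closedBall 0 (1 + δ) \ Metric.ball 0 (1 - δ) := by
    intro x hx
    simpa using And.comm.1 hx
  have hVn : 0 ≤ V := ENNReal.toReal_nonneg
  -- For `δ ≥ 1` the shell is replaced by a ball of radius at most `1 + |M|`. Only for `δ < 1` is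
  -- the inner ball removed, and `(1 + δ) ^ d - (1 - δ) ^ d` compared with `δ`.
  rcases le_or_gt 1 δ with h1 | h1
  · calc _ ≤ volume (Metric.closedBall (0 : Euc d) (1 + δ)) :=
          measure_mono (hsub.trans Set.sdiff_subset)
      _ = ENNReal.ofReal ((1 + δ) ^ d * V) := by
          rw [volume_closedBall_euc _ (by positivity), ← hv, hV, ← ENNReal.ofReal_mul (by positivity)]
      _ ≤ _ := by
          apply ENNReal.ofReal_le_ofReal
          calc (1 + δ) ^ d * V ≤ (1 + |M|) ^ d * V := by gcongr; exact hM.trans (le_abs_self M)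
            _ ≤ (d + 2 ^ d * d + (1 + |M|) ^ d) * (V + 1) * 1 := by
              rw [mul_one]; gcongr
              · have : (0 : ℝ) ≤ d + 2 ^ d * d := by positivity
                linarith
              · linarith
            _ ≤ _ := by gcongr
  · calc _ ≤ volume (Metric.closedBall (0 : Euc d) (1 + δ) \ Metric.ball 0 (1 - δ)) :=
          measure_mono hsub
      _ = ENNReal.ofReal ((1 + δ) ^ d * V) - ENNReal.ofReal ((1 - δ) ^ d * V) := by
          rw [measure_sdiff (Metric.ball_subset_closedBall.trans
            (Metric.closedBall_subset_closedBall (by linarith)))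
            measurableSet_ball.nullMeasurableSet measure_ball_lt_top.ne,
            volume_closedBall_euc _ (by positivity),
            volume_ball_euc hd (0 : Euc d) (by linarith : 0 ≤ 1 - δ), ← hv, hV,
            ← ENNReal.ofReal_mul (by positivity),
            ← ENNReal.ofReal_mul (pow_nonneg (by linarith) _)]
      _ = ENNReal.ofReal ((1 + δ) ^ d * V - (1 - δ) ^ d * V) :=
          (ENNReal.ofReal_sub _ (mul_nonneg (pow_nonneg (by linarith) _) hVn)).symm
      _ ≤ _ := by
          apply ENNReal.ofReal_le_ofReal
          have hb : 1 - d * δ ≤ (1 - δ) ^ d := by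
            have := one_add_mul_le_pow (a := -δ) (by linarith) d
            simpa [sub_eq_add_neg] using this
          have hc : (1 + δ) ^ d ≤ 1 + 2 ^ d * d * δ := by
            clear * - hδ h1
            induction d with
            | zero => simp
            | succ n ih =>
              have h2 : (1 + δ) ^ n ≤ 2 ^ n := pow_le_pow_left₀ (by linarith) (by linarith) n
              have h3 : (2 : ℝ) ^ n * n * δ ≤ 2 ^ (n + 1) * n * δ := by gcongr <;> simp
              have h4 : (2 : ℝ) ^ n * δ ≤ 2 ^ (n + 1) * δ := by gcongr <;> simp
              have h5 : δ * (1 + δ) ^ n ≤ δ * 2 ^ n := by gcongr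
              calc (1 + δ) ^ (n + 1) = (1 + δ) ^ n + δ * (1 + δ) ^ n := by ring
                _ ≤ (1 + 2 ^ n * n * δ) + δ * 2 ^ n := add_le_add ih h5
                _ ≤ _ := by push_cast; linarith
          calc (1 + δ) ^ d * V - (1 - δ) ^ d * V = ((1 + δ) ^ d - (1 - δ) ^ d) * V := by ring
            _ ≤ ((d + 2 ^ d * d) * δ) * V := by gcongr; linarith
            _ ≤ ((d + 2 ^ d * d + (1 + |M|) ^ d) * δ) * (V + 1) := by
              have h6 : 0 ≤ (1 + |M|) ^ d := by positivity
              refine mul_le_mul ?_ (by linarith) hVn (by positivity)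
              exact mul_le_mul_of_nonneg_right (by linarith) hδ.le
            _ = _ := by ring

end Packing

/-! ### Counting the points of a well-distributed set. -/

section Delone

variable {d : ℕ} {c C : ℝ} {A : Set (Euc d)}

lemma truncation_finite (hd : 0 < d) (hc : 0 < c) (hA : WellDistributed c C A) (q : ℝ) :
    (truncation A q).Finite := by
  by_contra h
  rcases lt_or_ge q 0 with hq | hq
  · apply h
    rw [truncation, Metric.closedBall_eq_empty.2 hq, Set.inter_empty]
    exact Set.finite_empty
  obtain ⟨n, hn⟩ := exists_nat_gt ((2 * q / c + 1) ^ d)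
  obtain ⟨I, hI, hcard⟩ := Set.Infinite.exists_subset_card_eq h n
  have := card_le_of_subset_ball hd hc (I := I) (x := id) (y := 0)
    (fun i hi j hj hij => hA.separated i (hI hi).1 j (hI hj).1 hij) hq
    (fun i hi => by simpa using (hI hi).2)
  rw [hcard] at this
  linarith

/-- The truncation as a finset (empty in the degenerate case that it is infinite). -/
noncomputable def truncFinset (A : Set (Euc d)) (q : ℝ) : Finset (Euc d) :=
  open Classical in if h : (truncation A q).Finite then h.toFinset else ∅

lemma mem_truncFinset (hd : 0 < d) (hc : 0 < c) (hA : WellDistributed c C A) {q : ℝ} {a : Euc d} :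
    a ∈ truncFinset A q ↔ a ∈ A ∧ ‖a‖ ≤ q := by
  rw [truncFinset, dif_pos (truncation_finite hd hc hA q), Set.Finite.mem_toFinset, truncation]
  simp

lemma truncFinset_separated (hd : 0 < d) (hc : 0 < c) (hA : WellDistributed c C A) (q : ℝ) :
    ∀ a ∈ truncFinset A q, ∀ a' ∈ truncFinset A q, a ≠ a' → c ≤ ‖a - a'‖ := fun a ha a' ha' h =>
  hA.separated a ((mem_truncFinset hd hc hA).1 ha).1 a' ((mem_truncFinset hd hc hA).1 ha').1 h

/-- Each `y` has a point of `A` within `C √d`, the diagonal of its cube. For `‖y‖ < q / 2` that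
point still lies in the ball of radius `q`, so balls of radius `C √d` about `A_q` cover the ball of
radius `q / 2`; comparing volumes bounds their number from below. -/
lemma le_card_truncFinset (hd : 0 < d) (hc : 0 < c) (hC : 0 < C) (hA : WellDistributed c C A)
    {q : ℝ} (hq : 2 * (C * √d) ≤ q) :
    (2 * (C * √d))⁻¹ ^ d * q ^ d ≤ ((truncFinset A q).card : ℝ) := by
  have hd' : (0 : ℝ) < √d := Real.sqrt_pos.2 (by exact_mod_cast hd)
  set r := C * √d with hr
  have hr0 : 0 < r := by positivity
  have hq0 : 0 < q := by linarith
  have hcover : Metric.ball (0 : Euc d) (q / 2) ⊆ ⋃ a ∈ truncFinset A q, Metric.closedBall a r := by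
    intro y hy
    obtain ⟨a, ha, hay⟩ := hA.meets_cube y
    have hn : ‖y - a‖ ≤ r := by
      rw [EuclideanSpace.norm_eq]
      calc √(∑ i, ‖(y - a) i‖ ^ 2) ≤ √(∑ _i : Fin d, C ^ 2) := by
            apply Real.sqrt_le_sqrt
            apply Finset.sum_le_sum
            intro i _
            gcongr
            rw [PiLp.sub_apply, Real.norm_eq_abs, abs_le]
            constructor <;> linarith [hay i]
        _ = r := by simp [Real.sqrt_mul, hr, Real.sqrt_sq hC.le, mul_comm]
    have hy' : ‖y‖ < q / 2 := by simpa using hy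
    simp only [Set.mem_iUnion]
    refine ⟨a, (mem_truncFinset hd hc hA).2 ⟨ha, ?_⟩, by rwa [Metric.mem_closedBall, dist_eq_norm]⟩
    calc ‖a‖ = ‖y - (y - a)‖ := by simp
      _ ≤ ‖y‖ + ‖y - a‖ := norm_sub_le _ _
      _ ≤ q := by linarith
  have h := (measure_mono hcover (μ := volume)).trans (measure_biUnion_finset_le _ _)
  rw [Finset.sum_congr rfl fun a _ => volume_closedBall_euc a hr0.le,
    volume_ball_euc hd 0 (by positivity), Finset.sum_const, nsmul_eq_mul, ← mul_assoc,
    ENNReal.mul_le_mul_iff_left volume_unitBall_ne_zero volume_unitBall_ne_top,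
    ← ENNReal.ofReal_natCast, ← ENNReal.ofReal_mul (by positivity),
    ENNReal.ofReal_le_ofReal_iff (by positivity)] at h
  calc (2 * r)⁻¹ ^ d * q ^ d = (q / 2) ^ d / r ^ d := by
        rw [← mul_pow, ← div_pow]; congr 1; field_simp
    _ ≤ _ := by rw [div_le_iff₀ (by positivity)]; exact h

end Delone

/-! ### The envelope that dominates the density. -/

section Envelope

variable {d : ℕ}

/-- The normalised sum of the indicator functions of the balls of radius `R⁻¹` around the points
of `q⁻¹ S`. -/
noncomputable def envelope (S : Finset (Euc d)) (q R : ℝ) (X : Euc d) : ℝ≥0∞ :=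
  ENNReal.ofReal (R ^ d / q ^ d) *
    ∑ a ∈ S, (Metric.closedBall (q⁻¹ • a) R⁻¹).indicator (fun _ => (1 : ℝ≥0∞)) X

@[fun_prop]
lemma measurable_envelope (S : Finset (Euc d)) (q R : ℝ) : Measurable (envelope S q R) := by
  unfold envelope
  refine Measurable.const_mul (Finset.measurable_fun_sum _ fun a _ => ?_) _
  exact measurable_const.indicator Metric.isClosed_closedBall.measurableSet

lemma separated_smul {S : Finset (Euc d)} {c q : ℝ} (hq : 0 < q)
    (hS : ∀ a ∈ S, ∀ a' ∈ S, a ≠ a' → c ≤ ‖a - a'‖) :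
    ∀ a ∈ S, ∀ a' ∈ S, a ≠ a' → c / q ≤ ‖q⁻¹ • a - q⁻¹ • a'‖ := by
  intro a ha a' ha' h
  rw [← smul_sub, norm_smul, norm_inv, Real.norm_of_nonneg hq.le, div_eq_inv_mul]
  gcongr
  exact hS a ha a' ha' h

/-- After normalisation each ball has mass of order `q ^ (-d)`, whatever `R` is. Up to the factor
`(2 / c) ^ d` this is the volume of the ball of radius `c / (2q)` with the same centre. These balls
are disjoint, and those belonging to balls of radius `R⁻¹ ≤ q⁻¹` that meet `E` lie in `F`. -/
lemma setLIntegral_envelope_le (hd : 0 < d) {S : Finset (Euc d)} {c q R : ℝ} (hc : 0 < c)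
    (hS : ∀ a ∈ S, ∀ a' ∈ S, a ≠ a' → c ≤ ‖a - a'‖) (hq : 0 < q) (hR : q ≤ R)
    {E F : Set (Euc d)}
    (hF : ∀ x ∈ E, ∀ y, ‖y - x‖ ≤ (1 + c) / q → y ∈ F) :
    ∫⁻ X in E, envelope S q R X ≤ ENNReal.ofReal ((2 / c) ^ d) * volume F := by
  classical
  have hR0 : 0 < R := hq.trans_le hR
  set I := S.filter fun a => (Metric.closedBall (q⁻¹ • a) R⁻¹ ∩ E).Nonempty with hI
  set v := volume (Metric.ball (0 : Euc d) 1) with hv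
  have hsep : ∀ a ∈ I, ∀ a' ∈ I, a ≠ a' → c / q ≤ ‖q⁻¹ • a - q⁻¹ • a'‖ := fun a ha a' ha' =>
    separated_smul hq hS a (Finset.mem_filter.1 ha).1 a' (Finset.mem_filter.1 ha').1
  have hpack := card_mul_volume_ball_le hd (by positivity : 0 ≤ c / q) hsep (E := F) (by
    intro a ha y hy
    obtain ⟨x, hx, hxE⟩ := (Finset.mem_filter.1 ha).2
    refine hF x hxE y ?_
    rw [Metric.mem_closedBall, dist_eq_norm] at hx
    rw [Metric.mem_ball, dist_eq_norm] at hy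
    have : R⁻¹ ≤ q⁻¹ := inv_anti₀ hq hR
    calc ‖y - x‖ = ‖(y - q⁻¹ • a) - (x - q⁻¹ • a)‖ := by congr 1; abel
      _ ≤ ‖y - q⁻¹ • a‖ + ‖x - q⁻¹ • a‖ := norm_sub_le _ _
      _ ≤ c / q / 2 + q⁻¹ := by linarith
      _ ≤ (1 + c) / q := by
        have : 0 ≤ c / q := by positivity
        rw [add_div, one_div]; linarith)
  calc ∫⁻ X in E, envelope S q R X
      = ENNReal.ofReal (R ^ d / q ^ d) * ∑ a ∈ S, volume (Metric.closedBall (q⁻¹ • a) R⁻¹ ∩ E) := by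
        unfold envelope
        rw [lintegral_const_mul _ (Finset.measurable_fun_sum _ fun a _ =>
          measurable_const.indicator Metric.isClosed_closedBall.measurableSet),
          lintegral_finsetSum _ fun a _ =>
            measurable_const.indicator Metric.isClosed_closedBall.measurableSet]
        congr 1
        refine Finset.sum_congr rfl fun a _ => ?_
        rw [lintegral_indicator Metric.isClosed_closedBall.measurableSet]
        simp [Measure.restrict_apply Metric.isClosed_closedBall.measurableSet]
    _ = ENNReal.ofReal (R ^ d / q ^ d) *
          ∑ a ∈ I, volume (Metric.closedBall (q⁻¹ • a) R⁻¹ ∩ E) := by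
        congr 1
        rw [hI, Finset.sum_filter]
        refine Finset.sum_congr rfl fun a _ => ?_
        split_ifs with h
        · rfl
        · rw [Set.not_nonempty_iff_eq_empty.1 h, measure_empty]
    _ ≤ ENNReal.ofReal (R ^ d / q ^ d) * ∑ a ∈ I, ENNReal.ofReal (R⁻¹ ^ d) * v := by
        gcongr with a
        rw [hv, ← volume_closedBall_euc (q⁻¹ • a) (by positivity)]
        exact measure_mono Set.inter_subset_left
    _ = I.card * (ENNReal.ofReal ((q ^ d)⁻¹) * v) := by
        have : ENNReal.ofReal ((q ^ d)⁻¹)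
            = ENNReal.ofReal (R ^ d / q ^ d) * ENNReal.ofReal (R⁻¹ ^ d) := by
          rw [← ENNReal.ofReal_mul (by positivity)]
          congr 1
          rw [inv_pow]
          field_simp
        rw [this, Finset.sum_const, nsmul_eq_mul]
        ring
    _ = ENNReal.ofReal ((2 / c) ^ d) * (I.card * (ENNReal.ofReal ((c / q / 2) ^ d) * v)) := by
        have : ENNReal.ofReal ((q ^ d)⁻¹)
            = ENNReal.ofReal ((2 / c) ^ d) * ENNReal.ofReal ((c / q / 2) ^ d) := by
          rw [← ENNReal.ofReal_mul (by positivity), ← mul_pow, ← inv_pow]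
          congr 2
          field_simp
        rw [this]
        ring
    _ ≤ _ := by gcongr

/-- Since `R⁻¹ ≤ q⁻¹` and the centres are `c / q`-separated, at most `(2 / c + 1) ^ d` of the balls
overlap at a point. -/
lemma envelope_le (hd : 0 < d) {S : Finset (Euc d)} {c q R : ℝ} (hc : 0 < c)
    (hS : ∀ a ∈ S, ∀ a' ∈ S, a ≠ a' → c ≤ ‖a - a'‖) (hq : 0 < q) (hR : q ≤ R) (X : Euc d) :
    envelope S q R X ≤ ENNReal.ofReal ((2 / c + 1) ^ d * (R ^ d / q ^ d)) := by
  classical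
  have hR0 : 0 < R := hq.trans_le hR
  set I := S.filter fun a => X ∈ Metric.closedBall (q⁻¹ • a) R⁻¹ with hI
  have hcard : (I.card : ℝ) ≤ (2 * q⁻¹ / (c / q) + 1) ^ d := by
    refine card_le_of_subset_ball hd (by positivity : 0 < c / q) (x := fun a => q⁻¹ • a) (y := X)
      (fun a ha a' ha' => separated_smul hq hS a (Finset.mem_filter.1 ha).1 a'
        (Finset.mem_filter.1 ha').1) (by positivity) fun a ha => ?_
    have := (Finset.mem_filter.1 ha).2
    rw [Metric.mem_closedBall', dist_eq_norm] at this
    exact this.trans (inv_anti₀ hq hR)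
  have : ∑ a ∈ S, (Metric.closedBall (q⁻¹ • a) R⁻¹).indicator (fun _ => (1 : ℝ≥0∞)) X
      = (I.card : ℝ≥0∞) := by
    simp [hI, Set.indicator_apply]
  rw [envelope, this, mul_comm, ENNReal.ofReal_mul (by positivity), ← ENNReal.ofReal_natCast]
  gcongr
  calc _ ≤ _ := hcard
    _ = _ := by congr 2; field_simp

lemma envelope_eq_zero {S : Finset (Euc d)} {q R : ℝ} (hq : 0 < q) (hS : ∀ a ∈ S, ‖a‖ ≤ q)
    {X : Euc d} (hX : 1 + R⁻¹ < ‖X‖) : envelope S q R X = 0 := by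
  rw [envelope, Finset.sum_eq_zero, mul_zero]
  intro a ha
  rw [Set.indicator_of_notMem]
  intro h
  rw [Metric.mem_closedBall, dist_eq_norm] at h
  have h1 : ‖q⁻¹ • a‖ ≤ 1 := by
    rw [norm_smul, norm_inv, Real.norm_of_nonneg hq.le, inv_mul_le_iff₀ hq, mul_one]
    exact hS a ha
  have := norm_sub_norm_le X (q⁻¹ • a)
  linarith

/-- A sum of dilates of a function supported in the unit ball is dominated by the envelope. -/
lemma ofReal_sum_dilate_le_envelope {S : Finset (Euc d)} {q R Φ κ m : ℝ} (hq : 0 < q) (hR : 0 < R)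
    (hκ : 0 < κ) (hm : κ * q ^ d ≤ m) {f : Euc d → ℝ} (hΦ : 0 ≤ Φ) (hf : ∀ x, f x ≤ Φ)
    (hf0 : ∀ x, 1 < ‖x‖ → f x = 0) (X : Euc d) :
    ENNReal.ofReal (m⁻¹ * ∑ a ∈ S, R ^ d * f (R • (X - q⁻¹ • a)))
      ≤ ENNReal.ofReal (Φ / κ) * envelope S q R X := by
  have hsum : ∑ a ∈ S, R ^ d * f (R • (X - q⁻¹ • a))
      ≤ ∑ a ∈ S, R ^ d * (Φ * (Metric.closedBall (q⁻¹ • a) R⁻¹).indicator (fun _ => (1 : ℝ)) X) := by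
    gcongr with a
    by_cases h : X ∈ Metric.closedBall (q⁻¹ • a) R⁻¹
    · simpa [h] using hf _
    · rw [Set.indicator_of_notMem h, mul_zero]
      apply (hf0 _ _).le
      rw [Metric.mem_closedBall, dist_eq_norm, not_le] at h
      rw [norm_smul, Real.norm_of_nonneg hR.le]
      calc 1 = R * R⁻¹ := by field_simp
        _ < _ := by gcongr
  have hind : ∀ a, (0 : ℝ) ≤ (Metric.closedBall (q⁻¹ • a) R⁻¹).indicator (fun _ => (1 : ℝ)) X :=
    fun a => Set.indicator_nonneg (fun _ _ => zero_le_one) X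
  have hm0 : 0 < m := lt_of_lt_of_le (by positivity) hm
  calc _ ≤ ENNReal.ofReal ((κ * q ^ d)⁻¹ * ∑ a ∈ S, R ^ d *
            (Φ * (Metric.closedBall (q⁻¹ • a) R⁻¹).indicator (fun _ => (1 : ℝ)) X)) := by
        apply ENNReal.ofReal_le_ofReal
        refine (mul_le_mul_of_nonneg_left hsum (by positivity)).trans ?_
        gcongr
        exact Finset.sum_nonneg fun a _ => by have := hind a; positivity
    _ = ENNReal.ofReal (Φ / κ * (R ^ d / q ^ d *
          ∑ a ∈ S, (Metric.closedBall (q⁻¹ • a) R⁻¹).indicator (fun _ => (1 : ℝ)) X)) := by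
        congr 1
        simp only [Finset.mul_sum]
        refine Finset.sum_congr rfl fun a _ => ?_
        field_simp
    _ = _ := by
        rw [ENNReal.ofReal_mul (by positivity), ENNReal.ofReal_mul (by positivity),
          ENNReal.ofReal_sum_of_nonneg fun a _ => hind a, envelope]
        refine congrArg _ (congrArg _ (Finset.sum_congr rfl fun a _ => ?_))
        by_cases h : X ∈ Metric.closedBall (q⁻¹ • a) R⁻¹ <;> simp [h]

end Envelope

/-! ### Riesz potentials and the Frostman condition. -/

section Energy

variable {d : ℕ}

/-- The constant of the geometric series which bounds Riesz potentials. -/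
noncomputable def potentialConst (d : ℕ) (s : ℝ) : ℝ := 2 ^ s * (1 - 2 ^ (-((d : ℝ) - s)))⁻¹

lemma potentialConst_nonneg {s : ℝ} (hs : s < d) : 0 ≤ potentialConst d s := by
  have : (2 : ℝ) ^ (-((d : ℝ) - s)) ≤ 1 :=
    Real.rpow_le_one_of_one_le_of_nonpos (by norm_num) (by linarith)
  exact mul_nonneg (by positivity) (inv_nonneg.2 (by linarith))

lemma edist_rpow_neg_le {x y : Euc d} {r s : ℝ} (hr : 0 < r) (hs : 0 < s) (h : r ≤ dist x y) :
    edist x y ^ (-s) ≤ ENNReal.ofReal (r ^ (-s)) := by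
  rw [edist_dist, ENNReal.ofReal_rpow_of_pos (hr.trans_le h)]
  exact ENNReal.ofReal_le_ofReal (Real.rpow_le_rpow_of_nonpos hr h (by linarith))

/-- The Riesz potential over a ball of a measure whose balls have `d`-dimensional growth. -/
lemma setLIntegral_edist_rpow_neg_le (hd : 0 < d) {μ : Measure (Euc d)} {x : Euc d} {M r s : ℝ}
    (hM : 0 ≤ M) (hr : 0 < r) (hs : 0 < s) (hsd : s < d)
    (hμ : ∀ δ, 0 < δ → δ ≤ r → μ (Metric.closedBall x δ) ≤ ENNReal.ofReal (M * δ ^ d)) :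
    ∫⁻ y in Metric.closedBall x r, edist x y ^ (-s) ∂μ
      ≤ ENNReal.ofReal (M * potentialConst d s * r ^ ((d : ℝ) - s)) := by
  set ρ : ℕ → ℝ := fun k => (1 / 2) ^ k * r with hρ
  have hρ0 : ∀ k, 0 < ρ k := fun k => by positivity
  have hρr : ∀ k, ρ k ≤ r := fun k =>
    mul_le_of_le_one_left hr.le (pow_le_one₀ (by norm_num) (by norm_num))
  have hρs : ∀ k, ρ (k + 1) = ρ k / 2 := fun k => by simp only [hρ, pow_succ]; ring
  have hlim : Filter.Tendsto ρ Filter.atTop (nhds 0) := by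
    have := (tendsto_pow_atTop_nhds_zero_of_lt_one (r := (1 / 2 : ℝ)) (by norm_num)
      (by norm_num)).mul_const r
    rwa [zero_mul] at this
  set D : ℕ → Set (Euc d) := fun k => Metric.closedBall x (ρ k) \ Metric.closedBall x (ρ (k + 1))
  have hcover : Metric.closedBall x r ⊆ {x} ∪ ⋃ k, D k := by
    intro y hy
    rcases eq_or_ne y x with rfl | hne
    · simp
    right
    have hpos : 0 < dist y x := dist_pos.2 hne
    have hex : ∃ k, ρ k < dist y x := (hlim.eventually (gt_mem_nhds hpos)).exists
    classical
    have hk0 : Nat.find hex ≠ 0 := by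
      intro h0
      have := Nat.find_spec hex
      rw [h0] at this
      simp only [hρ, pow_zero, one_mul] at this
      exact absurd (Metric.mem_closedBall.1 hy) (not_le.2 this)
    obtain ⟨k, hk⟩ := Nat.exists_eq_succ_of_ne_zero hk0
    refine Set.mem_iUnion.2 ⟨k, ?_, ?_⟩
    · have := Nat.find_min hex (m := k) (by omega)
      simpa using this
    · have := Nat.find_spec hex
      rw [hk] at this
      simpa using this
  -- The kernel is infinite at the centre and the dyadic shells miss it, so the centre must be null.
  have hpoint : μ {x} = 0 := by
    have h0 : Filter.Tendsto (fun k => ENNReal.ofReal (M * ρ k ^ d)) Filter.atTop (nhds 0) := by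
      rw [← ENNReal.ofReal_zero]
      apply ENNReal.tendsto_ofReal
      simpa [hd.ne'] using (hlim.pow d).const_mul M
    refine le_antisymm (ge_of_tendsto' h0 fun k => ?_) bot_le
    exact (measure_mono (by simpa using (hρ0 k).le)).trans (hμ _ (hρ0 k) (hρr k))
  set b : ℝ := 2 ^ (-((d : ℝ) - s)) with hb
  have hb0 : 0 ≤ b := by positivity
  have hb1 : b < 1 := Real.rpow_lt_one_of_one_lt_of_neg (by norm_num) (by linarith)
  have hterm : ∀ k, ∫⁻ y in D k, edist x y ^ (-s) ∂μ
      ≤ ENNReal.ofReal (M * 2 ^ s * r ^ ((d : ℝ) - s) * b ^ k) := by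
    intro k
    calc ∫⁻ y in D k, edist x y ^ (-s) ∂μ
        ≤ ∫⁻ _y in D k, ENNReal.ofReal (ρ (k + 1) ^ (-s)) ∂μ := by
          refine setLIntegral_mono measurable_const fun y hy => edist_rpow_neg_le (hρ0 _) hs ?_
          have := hy.2
          rw [Metric.mem_closedBall', not_le] at this
          exact this.le
      _ ≤ ENNReal.ofReal (ρ (k + 1) ^ (-s)) * ENNReal.ofReal (M * ρ k ^ d) := by
          rw [setLIntegral_const]
          gcongr
          exact (measure_mono Set.sdiff_subset).trans (hμ _ (hρ0 k) (hρr k))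
      _ = _ := by
          rw [← ENNReal.ofReal_mul (by have := hρ0 (k + 1); positivity)]
          congr 1
          rw [hρs, Real.div_rpow (hρ0 k).le (by norm_num), ← Real.rpow_natCast (ρ k) d,
            Real.rpow_neg (by norm_num : (0 : ℝ) ≤ 2), div_inv_eq_mul]
          have h1 : ρ k ^ (-s) * ρ k ^ (d : ℝ) = ρ k ^ ((d : ℝ) - s) := by
            rw [← Real.rpow_add (hρ0 k)]; ring_nf
          have h2 : ρ k ^ ((d : ℝ) - s) = r ^ ((d : ℝ) - s) * b ^ k := by
            simp only [hρ]
            rw [Real.mul_rpow (by positivity) hr.le, mul_comm, hb, ← Real.rpow_natCast,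
              ← Real.rpow_natCast, ← Real.rpow_mul (by norm_num), ← Real.rpow_mul (by norm_num),
              one_div, Real.inv_rpow (by norm_num), ← Real.rpow_neg (by norm_num)]
            ring_nf
          calc _ = M * 2 ^ s * (ρ k ^ (-s) * ρ k ^ (d : ℝ)) := by ring
            _ = _ := by rw [h1, h2]; ring
  calc ∫⁻ y in Metric.closedBall x r, edist x y ^ (-s) ∂μ
      ≤ ∫⁻ y in {x} ∪ ⋃ k, D k, edist x y ^ (-s) ∂μ := lintegral_mono_set hcover
    _ ≤ ∫⁻ y in {x}, edist x y ^ (-s) ∂μ + ∫⁻ y in ⋃ k, D k, edist x y ^ (-s) ∂μ :=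
        lintegral_union_le _ _ _
    _ = ∫⁻ y in ⋃ k, D k, edist x y ^ (-s) ∂μ := by
        rw [setLIntegral_measure_zero _ _ hpoint, zero_add]
    _ ≤ ∑' k, ∫⁻ y in D k, edist x y ^ (-s) ∂μ := lintegral_iUnion_le _ _
    _ ≤ ∑' k, ENNReal.ofReal (M * 2 ^ s * r ^ ((d : ℝ) - s) * b ^ k) := ENNReal.tsum_le_tsum hterm
    _ = ENNReal.ofReal (∑' k, M * 2 ^ s * r ^ ((d : ℝ) - s) * b ^ k) :=
        (ENNReal.ofReal_tsum_of_nonneg (fun k => by positivity)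
          ((summable_geometric_of_lt_one hb0 hb1).mul_left _)).symm
    _ = _ := by
        rw [tsum_mul_left, tsum_geometric_of_lt_one hb0 hb1, potentialConst]
        congr 1
        ring

/-- A measure with the ball growth of a union of balls of radius `q ^ (-p)` which are spaced like
`q⁻¹ ℤ^d` is a Frostman measure, with finite energy at the critical exponent. -/
lemma isFrostman_of_ball_bounds (hd : 0 < d) {p q K : ℝ} (hp : 1 < p) (hq : 1 ≤ q) (hK : 0 ≤ K)
    {μ : Measure (Euc d)} [IsProbabilityMeasure μ] (hμc : ∃ E, IsCompact E ∧ μ Eᶜ = 0)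
    (h1 : ∀ (x : Euc d) (δ : ℝ), 0 < δ → μ (Metric.closedBall x δ)
      ≤ ENNReal.ofReal (K * ((q ^ p) ^ d / q ^ d) * δ ^ d))
    (h2 : ∀ (x : Euc d) (δ : ℝ), q⁻¹ ≤ δ → μ (Metric.closedBall x δ)
      ≤ ENNReal.ofReal (K * δ ^ d)) :
    IsFrostman ((d : ℝ) / p) (2 * (K * potentialConst d (d / p)) + K + 1) μ := by
  have hq0 : 0 < q := by linarith
  have hd' : (0 : ℝ) < d := by exact_mod_cast hd
  set s : ℝ := d / p with hs
  have hs0 : 0 < s := by positivity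
  have hsd : s < d := div_lt_self hd' hp
  have hG := potentialConst_nonneg hsd
  set G := potentialConst d s
  set R : ℝ := q ^ p with hR
  have hR0 : 0 < R := by positivity
  have hqR : q ≤ R := by simpa using Real.rpow_le_rpow_of_exponent_le hq hp.le
  -- The relation that singles out `s = d / p`: all the matching of scales below rests on it.
  have hRs : R ^ s = q ^ d := by
    rw [hR, ← Real.rpow_mul hq0.le, hs, mul_div_cancel₀ _ (by linarith : p ≠ 0), Real.rpow_natCast]
  have hC : K ≤ 2 * (K * G) + K + 1 := by
    have : 0 ≤ K * G := by positivity
    linarith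
  refine ⟨inferInstance, hμc, fun x δ hδ hδ1 => ?_, ?_⟩
  -- Three ranges. For `δ ≥ q⁻¹` the growth is like volume. For `R⁻¹ ≤ δ < q⁻¹` the ball lies in one
  -- of radius `q⁻¹`, whose mass is at most `K q ^ (-d) = K R ^ (-s)`. For `δ < R⁻¹` the bound on
  -- the density is used with `δ ^ (d - s) ≤ R ^ (-(d - s))`.
  · rcases le_or_gt q⁻¹ δ with hc | hc
    · refine (h2 x δ hc).trans (ENNReal.ofReal_le_ofReal ?_)
      rw [← Real.rpow_natCast]
      gcongr ?_ * ?_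
      exact Real.rpow_le_rpow_of_exponent_ge hδ hδ1 hsd.le
    rcases le_or_gt R⁻¹ δ with hc' | hc'
    · refine ((measure_mono (Metric.closedBall_subset_closedBall hc.le)).trans
        (h2 x q⁻¹ le_rfl)).trans (ENNReal.ofReal_le_ofReal ?_)
      gcongr ?_ * ?_
      calc q⁻¹ ^ d = R⁻¹ ^ s := by rw [Real.inv_rpow hR0.le, hRs, inv_pow]
        _ ≤ δ ^ s := by gcongr
    · refine (h1 x δ hδ).trans (ENNReal.ofReal_le_ofReal ?_)
      rw [mul_assoc]
      gcongr ?_ * ?_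
      have e1 : δ ^ ((d : ℝ) - s) ≤ R⁻¹ ^ ((d : ℝ) - s) :=
        Real.rpow_le_rpow hδ.le hc'.le (by linarith)
      calc R ^ d / q ^ d * δ ^ d = R ^ d / q ^ d * (δ ^ ((d : ℝ) - s) * δ ^ s) := by
            rw [← Real.rpow_add hδ, sub_add_cancel, Real.rpow_natCast]
        _ ≤ R ^ d / q ^ d * (R⁻¹ ^ ((d : ℝ) - s) * δ ^ s) := by gcongr
        _ = δ ^ s := by
            rw [Real.inv_rpow hR0.le, Real.rpow_sub hR0, hRs, Real.rpow_natCast]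
            field_simp
  -- The potential is bounded uniformly in `x`. The balls of radius `R⁻¹`, `q⁻¹` and `1` separate
  -- four regions, each of which contributes `O(1)`.
  · have hinner : ∀ x, ∫⁻ y, edist x y ^ (-s) ∂μ
        ≤ ENNReal.ofReal (2 * (K * G) + K + 1) := by
      intro x
      set B1 := Metric.closedBall x R⁻¹ with hB1
      set B2 := Metric.closedBall x q⁻¹ with hB2
      set B3 := Metric.closedBall x 1 with hB3
      have e1 : ∫⁻ y in B1, edist x y ^ (-s) ∂μ ≤ ENNReal.ofReal (K * G) := by
        refine (setLIntegral_edist_rpow_neg_le hd (by positivity) (by positivity) hs0 hsd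
          fun δ hδ _ => h1 x δ hδ).trans (ENNReal.ofReal_le_ofReal (le_of_eq ?_))
        rw [Real.inv_rpow hR0.le, Real.rpow_sub hR0, hRs, Real.rpow_natCast]
        field_simp
        rfl
      have e2 : ∫⁻ y in B2 \ B1, edist x y ^ (-s) ∂μ ≤ ENNReal.ofReal K := by
        calc _ ≤ ∫⁻ _y in B2 \ B1, ENNReal.ofReal (R⁻¹ ^ (-s)) ∂μ := by
              refine setLIntegral_mono measurable_const fun y hy =>
                edist_rpow_neg_le (by positivity) hs0 ?_
              have := hy.2
              rw [hB1, Metric.mem_closedBall', not_le] at this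
              exact this.le
          _ ≤ ENNReal.ofReal (R⁻¹ ^ (-s)) * ENNReal.ofReal (K * q⁻¹ ^ d) := by
              rw [setLIntegral_const]
              gcongr
              exact (measure_mono Set.sdiff_subset).trans (h2 x _ le_rfl)
          _ = ENNReal.ofReal K := by
              rw [← ENNReal.ofReal_mul (by positivity), Real.rpow_neg (by positivity),
                Real.inv_rpow hR0.le, hRs]
              congr 1
              rw [inv_pow]
              field_simp
      have e3 : ∫⁻ y in B3 \ B2, edist x y ^ (-s) ∂μ ≤ ENNReal.ofReal (K * G) := by
        -- Once the inner ball is removed, balls about `x` of radius less than `q⁻¹` have measure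
        -- zero, so the growth `K δ ^ d` holds at every radius and the potential estimate applies up
        -- to radius `1`.
        have hres : (μ.restrict (B3 \ B2)) = (μ.restrict B2ᶜ).restrict B3 := by
          rw [Measure.restrict_restrict Metric.isClosed_closedBall.measurableSet, Set.sdiff_eq]
        rw [hres]
        refine (setLIntegral_edist_rpow_neg_le hd hK one_pos hs0 hsd fun δ hδ _ => ?_).trans
          (by rw [Real.one_rpow, mul_one])
        rcases le_or_gt q⁻¹ δ with hc | hc
        · exact (Measure.restrict_apply_le _ _).trans (h2 x δ hc)
        · rw [Measure.restrict_apply Metric.isClosed_closedBall.measurableSet]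
          have : Metric.closedBall x δ ∩ B2ᶜ = ∅ := by
            rw [← Set.sdiff_eq, Set.sdiff_eq_empty]
            exact Metric.closedBall_subset_closedBall hc.le
          rw [this, measure_empty]
          exact bot_le
      have e4 : ∫⁻ y in B3ᶜ, edist x y ^ (-s) ∂μ ≤ ENNReal.ofReal 1 := by
        calc _ ≤ ∫⁻ _y in B3ᶜ, ENNReal.ofReal (1 ^ (-s)) ∂μ := by
              refine setLIntegral_mono measurable_const fun y hy =>
                edist_rpow_neg_le one_pos hs0 ?_
              rw [hB3, Set.mem_compl_iff, Metric.mem_closedBall', not_le] at hy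
              exact hy.le
          _ ≤ _ := by
              rw [setLIntegral_const]
              simpa using prob_le_one
      have hcov : (Set.univ : Set (Euc d)) ⊆ ((B1 ∪ B2 \ B1) ∪ B3 \ B2) ∪ B3ᶜ := by
        intro y _
        simp only [Set.mem_union, Set.mem_sdiff, Set.mem_compl_iff]
        tauto
      calc ∫⁻ y, edist x y ^ (-s) ∂μ = ∫⁻ y in Set.univ, edist x y ^ (-s) ∂μ := by simp
        _ ≤ _ := lintegral_mono_set hcov
        _ ≤ _ := (lintegral_union_le _ _ _)
        _ ≤ _ := add_le_add_left (lintegral_union_le _ _ _) _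
        _ ≤ _ := add_le_add_left (add_le_add_left (lintegral_union_le _ _ _) _) _
        _ ≤ ENNReal.ofReal (K * G) + ENNReal.ofReal K + ENNReal.ofReal (K * G)
              + ENNReal.ofReal 1 := add_le_add (add_le_add (add_le_add e1 e2) e3) e4
        _ = _ := by
            rw [← ENNReal.ofReal_add (by positivity) (by positivity),
              ← ENNReal.ofReal_add (by positivity) (by positivity),
              ← ENNReal.ofReal_add (by positivity) (by positivity)]
            congr 1
            ring
    calc rieszEnergy s μ ≤ ∫⁻ _x, ENNReal.ofReal (2 * (K * G) + K + 1) ∂μ := lintegral_mono hinner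
      _ = _ := by simp

end Energy

/-! ### The thickened measure: density, support and Frostman bounds. -/

section ThickMeasure

variable {d : ℕ} {φ : Euc d → ℝ}

lemma IsThickener.nonneg (hφ : IsThickener φ) (x : Euc d) : 0 ≤ φ x := by
  by_contra h
  have hx : x ∈ Function.support φ := fun h0 => h h0.ge
  refine h (hφ.pos x (interior_mono (subset_tsupport φ) ?_)).le
  rwa [hφ.smooth.continuous.isOpen_support.interior_eq]

lemma IsThickener.eq_zero (hφ : IsThickener φ) {x : Euc d} (hx : 1 < ‖x‖) : φ x = 0 := by
  by_contra h
  have := hφ.support_subset (subset_tsupport φ h)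
  rw [mem_closedBall_zero_iff] at this
  linarith

lemma IsThickener.hasCompactSupport (hφ : IsThickener φ) : HasCompactSupport φ :=
  (isCompact_closedBall (0 : Euc d) 1).of_isClosed_subset (isClosed_tsupport φ) hφ.support_subset

lemma IsThickener.exists_bound (hφ : IsThickener φ) : ∃ Φ : ℝ, 0 ≤ Φ ∧ ∀ x, φ x ≤ Φ := by
  obtain ⟨Φ, hΦ⟩ := hφ.hasCompactSupport.exists_bound_of_continuous hφ.smooth.continuous
  exact ⟨Φ, (norm_nonneg _).trans (hΦ 0), fun x => (le_abs_self _).trans (hΦ x)⟩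

lemma IsThickener.integrable (hφ : IsThickener φ) : Integrable φ :=
  hφ.smooth.continuous.integrable_of_hasCompactSupport hφ.hasCompactSupport

lemma IsThickener.integrable_dilate (hφ : IsThickener φ) {r : ℝ} (hr : 0 < r) (a : Euc d) :
    Integrable fun x => dilate φ r (x - a) :=
  (((integrable_comp_smul_iff volume φ hr.ne').2 hφ.integrable).const_mul _).comp_sub_right a

lemma IsThickener.integral_dilate (hφ : IsThickener φ) {r : ℝ} (hr : 0 < r) (a : Euc d) :
    ∫ x, dilate φ r (x - a) = 1 := by
  rw [integral_sub_right_eq_self (dilate φ r) a]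
  simp only [dilate]
  rw [integral_const_mul, Measure.integral_comp_smul, hφ.integral_eq_one, finrank_euclideanSpace_fin]
  rw [abs_of_pos (by positivity), smul_eq_mul, mul_one]
  field_simp

variable {p c C q : ℝ} {A : Set (Euc d)}

lemma rawDensity_eq (hd : 0 < d) (hc : 0 < c) (hA : WellDistributed c C A) (x : Euc d) :
    rawDensity φ p A q x
      = (q ^ d)⁻¹ * ∑ a ∈ truncFinset A q, dilate φ (q ^ p) (x - q⁻¹ • a) := by
  have h := truncation_finite hd hc hA q
  rw [rawDensity, finsum_mem_eq_finite_toFinset_sum _ h, truncFinset, dif_pos h]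

/-- Every dilate has integral one, so normalisation trades `q ^ (-d)` for the reciprocal of the
number of points. -/
lemma thickDensity_eq (hd : 0 < d) (hφ : IsThickener φ) (hc : 0 < c)
    (hA : WellDistributed c C A) (hq : 0 < q) (x : Euc d) :
    thickDensity φ p A q x = ((truncFinset A q).card : ℝ)⁻¹ *
      ∑ a ∈ truncFinset A q, (q ^ p) ^ d * φ ((q ^ p) • (x - q⁻¹ • a)) := by
  have hint : ∫ y, rawDensity φ p A q y = (q ^ d)⁻¹ * (truncFinset A q).card := by
    simp only [rawDensity_eq hd hc hA]
    rw [integral_const_mul, integral_finsetSum _ fun a _ =>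
      hφ.integrable_dilate (by positivity) _]
    simp [hφ.integral_dilate (r := q ^ p) (by positivity)]
  rw [thickDensity, hint, rawDensity_eq hd hc hA, mul_inv, inv_inv, mul_comm (q ^ d), mul_assoc,
    mul_inv_cancel_left₀ (by positivity)]
  rfl

lemma thickDensity_nonneg (hd : 0 < d) (hφ : IsThickener φ) (hc : 0 < c)
    (hA : WellDistributed c C A) (hq : 0 < q) (x : Euc d) : 0 ≤ thickDensity φ p A q x := by
  rw [thickDensity_eq hd hφ hc hA hq]
  exact mul_nonneg (by positivity) (Finset.sum_nonneg fun a _ =>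
    mul_nonneg (by positivity) (hφ.nonneg _))

lemma contDiff_thickDensity (hd : 0 < d) (hφ : IsThickener φ) (hc : 0 < c)
    (hA : WellDistributed c C A) (hq : 0 < q) : ContDiff ℝ ∞ (thickDensity φ p A q) := by
  rw [funext (thickDensity_eq hd hφ hc hA hq)]
  refine contDiff_const.mul (ContDiff.sum fun a _ => contDiff_const.mul (hφ.smooth.comp ?_))
  fun_prop

lemma integrable_thickDensity (hd : 0 < d) (hφ : IsThickener φ) (hc : 0 < c)
    (hA : WellDistributed c C A) (hq : 0 < q) : Integrable (thickDensity φ p A q) := by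
  rw [funext (thickDensity_eq hd hφ hc hA hq)]
  exact (integrable_finsetSum _ fun a _ =>
    hφ.integrable_dilate (r := q ^ p) (by positivity) _).const_mul _

lemma isProbabilityMeasure_thickMeasure (hd : 0 < d) (hφ : IsThickener φ) (hc : 0 < c)
    (hA : WellDistributed c C A) (hq : 0 < q) (hN : (truncFinset A q).card ≠ 0) :
    IsProbabilityMeasure (thickMeasure φ p A q) := by
  constructor
  rw [thickMeasure, withDensity_apply _ .univ, Measure.restrict_univ,
    ← ofReal_integral_eq_lintegral_ofReal (integrable_thickDensity hd hφ hc hA hq)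
      (Filter.Eventually.of_forall (thickDensity_nonneg hd hφ hc hA hq)),
    ← ENNReal.ofReal_one]
  congr 1
  have hsum : ∫ x, ∑ a ∈ truncFinset A q, dilate φ (q ^ p) (x - q⁻¹ • a)
      = (truncFinset A q).card := by
    rw [integral_finsetSum _ fun a _ => hφ.integrable_dilate (r := q ^ p) (by positivity) _]
    simp [hφ.integral_dilate (r := q ^ p) (by positivity)]
  rw [funext (thickDensity_eq hd hφ hc hA hq), integral_const_mul]
  simp only [dilate] at hsum
  rw [hsum]
  have : ((truncFinset A q).card : ℝ) ≠ 0 := by exact_mod_cast hN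
  exact inv_mul_cancel₀ this

/-- The smallest parameter `q` that is considered. -/
noncomputable def qMin (d : ℕ) (C : ℝ) : ℝ := max 2 (2 * (C * √d))

/-- The lower density of well-distributed sets. -/
noncomputable def lowerDensity (d : ℕ) (C : ℝ) : ℝ := (2 * (C * √d))⁻¹ ^ d

lemma lowerDensity_pos (hd : 0 < d) (hC : 0 < C) : 0 < lowerDensity d C := by
  have : (0 : ℝ) < √d := Real.sqrt_pos.2 (by exact_mod_cast hd)
  unfold lowerDensity
  positivity

lemma two_le_of_qMin_le (hq : qMin d C ≤ q) : 2 ≤ q := (le_max_left _ _).trans hq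

lemma lowerDensity_mul_le (hd : 0 < d) (hc : 0 < c) (hC : 0 < C) (hA : WellDistributed c C A)
    (hq : qMin d C ≤ q) : lowerDensity d C * q ^ d ≤ ((truncFinset A q).card : ℝ) :=
  le_card_truncFinset hd hc hC hA ((le_max_right _ _).trans hq)

lemma card_truncFinset_pos (hd : 0 < d) (hc : 0 < c) (hC : 0 < C) (hA : WellDistributed c C A)
    (hq : qMin d C ≤ q) : (0 : ℝ) < (truncFinset A q).card := by
  have := two_le_of_qMin_le hq
  have := lowerDensity_pos hd hC
  exact lt_of_lt_of_le (by positivity) (lowerDensity_mul_le hd hc hC hA hq)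

/-- `φ` is at most `Φ` times the indicator of the unit ball, and the number of points is at least
`lowerDensity d C * q ^ d`. -/
lemma thickMeasure_apply_le (hd : 0 < d) (hφ : IsThickener φ) (hc : 0 < c) (hC : 0 < C)
    (hA : WellDistributed c C A) (hq : qMin d C ≤ q) {Φ : ℝ} (hΦ : 0 ≤ Φ) (hφΦ : ∀ x, φ x ≤ Φ)
    (E : Set (Euc d)) :
    thickMeasure φ p A q E ≤ ENNReal.ofReal (Φ / lowerDensity d C) *
      ∫⁻ X in E, envelope (truncFinset A q) q (q ^ p) X := by
  have hq0 : 0 < q := by linarith [two_le_of_qMin_le hq]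
  rw [thickMeasure, withDensity_apply' , ← lintegral_const_mul _ (measurable_envelope _ _ _)]
  refine lintegral_mono fun X => ?_
  rw [thickDensity_eq hd hφ hc hA hq0]
  exact ofReal_sum_dilate_le_envelope hq0 (by positivity) (lowerDensity_pos hd hC)
    (lowerDensity_mul_le hd hc hC hA hq) hΦ hφΦ (fun x hx => hφ.eq_zero hx) X

lemma thickDensity_eq_zero (hd : 0 < d) (hφ : IsThickener φ) (hc : 0 < c)
    (hA : WellDistributed c C A) (hq : 0 < q) {X : Euc d} (hX : 1 + (q ^ p)⁻¹ < ‖X‖) :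
    thickDensity φ p A q X = 0 := by
  have hR : 0 < q ^ p := by positivity
  rw [thickDensity_eq hd hφ hc hA hq, Finset.sum_eq_zero, mul_zero]
  intro a ha
  rw [hφ.eq_zero, mul_zero]
  have h1 : ‖q⁻¹ • a‖ ≤ 1 := by
    rw [norm_smul, norm_inv, Real.norm_of_nonneg hq.le, inv_mul_le_iff₀ hq, mul_one]
    exact ((mem_truncFinset hd hc hA).1 ha).2
  have := norm_sub_norm_le X (q⁻¹ • a)
  rw [norm_smul, Real.norm_of_nonneg hR.le]
  calc 1 = q ^ p * (q ^ p)⁻¹ := by field_simp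
    _ < _ := by gcongr; linarith

lemma le_rpow_self_of_one_le (hq : 1 ≤ q) (hp : 1 ≤ p) : q ≤ q ^ p := by
  simpa using Real.rpow_le_rpow_of_exponent_le hq hp

/-- The centres lie in the unit ball and the bumps have radius `(q ^ p)⁻¹ ≤ 1 / 2`. That `3 / 2` is
smaller than half the side of a tile, which is at least `2`, is what later leaves only one layer of
tiles in the direction `w`. -/
lemma thickMeasure_compl_ball (hd : 0 < d) (hφ : IsThickener φ) (hc : 0 < c)
    (hA : WellDistributed c C A) (hq : 2 ≤ q) (hp : 1 ≤ p) :
    thickMeasure φ p A q (Metric.closedBall 0 (3 / 2))ᶜ = 0 := by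
  rw [thickMeasure, withDensity_apply _ Metric.isClosed_closedBall.measurableSet.compl]
  refine setLIntegral_eq_zero Metric.isClosed_closedBall.measurableSet.compl fun X hX => ?_
  have hX' : 3 / 2 < ‖X‖ := by simpa using hX
  have hR : (q ^ p)⁻¹ ≤ 2⁻¹ :=
    inv_anti₀ (by norm_num) (hq.trans (le_rpow_self_of_one_le (by linarith) hp))
  rw [thickDensity_eq_zero hd hφ hc hA (by linarith) (by linarith)]
  simp

/-- The thickened measures are uniformly Frostman, of dimension `d / p` and with bounded energy. -/
lemma exists_isFrostman_thickMeasure (hd : 0 < d) (hφ : IsThickener φ) (hp : 1 < p) (hc : 0 < c)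
    (hC : 0 < C) : ∃ K : ℝ, 0 < K ∧ ∀ A : Set (Euc d), WellDistributed c C A →
      ∀ q : ℝ, qMin d C ≤ q → IsFrostman ((d : ℝ) / p) K (thickMeasure φ p A q) := by
  obtain ⟨Φ, hΦ, hφΦ⟩ := hφ.exists_bound
  have hd' : (0 : ℝ) < d := by exact_mod_cast hd
  set V := (volume (Metric.ball (0 : Euc d) 1)).toReal with hVdef
  have hV : volume (Metric.ball (0 : Euc d) 1) = ENNReal.ofReal V :=
    (ENNReal.ofReal_toReal volume_unitBall_ne_top).symm
  have hV0 : 0 ≤ V := ENNReal.toReal_nonneg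
  have hl := lowerDensity_pos hd hC
  set K := Φ / lowerDensity d C * ((2 / c + 1) ^ d * V + (2 / c) ^ d * ((2 + c) ^ d * V)) with hKdef
  have hK : 0 ≤ K := by positivity
  have hG : 0 ≤ potentialConst d (d / p) := potentialConst_nonneg (div_lt_self hd' hp)
  refine ⟨2 * (K * potentialConst d (d / p)) + K + 1, by positivity, fun A hA q hq => ?_⟩
  have hq2 := two_le_of_qMin_le hq
  have hq0 : 0 < q := by linarith
  have hqR : q ≤ q ^ p := le_rpow_self_of_one_le (by linarith) hp.le
  have : IsProbabilityMeasure (thickMeasure φ p A q) :=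
    isProbabilityMeasure_thickMeasure hd hφ hc hA hq0
      (by exact_mod_cast (card_truncFinset_pos hd hc hC hA hq).ne')
  refine isFrostman_of_ball_bounds hd (q := q) hp (by linarith) hK
    ⟨_, isCompact_closedBall _ _, thickMeasure_compl_ball hd hφ hc hA hq2 hp.le⟩
    (fun x δ hδ => ?_) (fun x δ hδ => ?_)
  · calc _ ≤ _ := thickMeasure_apply_le hd hφ hc hC hA hq hΦ hφΦ _
      _ ≤ ENNReal.ofReal (Φ / lowerDensity d C) * ∫⁻ _X in Metric.closedBall x δ,
            ENNReal.ofReal ((2 / c + 1) ^ d * ((q ^ p) ^ d / q ^ d)) := by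
          gcongr with X
          exact envelope_le hd hc (truncFinset_separated hd hc hA q) hq0 hqR X
      _ = ENNReal.ofReal (Φ / lowerDensity d C * ((2 / c + 1) ^ d * ((q ^ p) ^ d / q ^ d)
            * (δ ^ d * V))) := by
          rw [setLIntegral_const, volume_closedBall_euc _ hδ.le, hV,
            ← ENNReal.ofReal_mul (by positivity), ← ENNReal.ofReal_mul (by positivity),
            ← ENNReal.ofReal_mul (by positivity)]
      _ ≤ _ := by
          apply ENNReal.ofReal_le_ofReal
          calc _ = Φ / lowerDensity d C * ((2 / c + 1) ^ d * V)
                * ((q ^ p) ^ d / q ^ d) * δ ^ d := by ring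
            _ ≤ _ := by
              rw [hKdef]
              gcongr
              have : 0 ≤ (2 / c) ^ d * ((2 + c) ^ d * V) := by positivity
              linarith
  · have hδ0 : 0 < δ := lt_of_lt_of_le (by positivity) hδ
    calc _ ≤ _ := thickMeasure_apply_le hd hφ hc hC hA hq hΦ hφΦ _
      _ ≤ ENNReal.ofReal (Φ / lowerDensity d C) * (ENNReal.ofReal ((2 / c) ^ d) *
            volume (Metric.closedBall x ((2 + c) * δ))) := by
          gcongr
          refine setLIntegral_envelope_le hd hc (truncFinset_separated hd hc hA q) hq0 hqR
            fun y hy z hz => ?_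
          rw [Metric.mem_closedBall] at hy ⊢
          rw [← dist_eq_norm] at hz
          have h3 : (1 + c) / q ≤ (1 + c) * δ := by rw [div_eq_mul_inv]; gcongr
          linarith [dist_triangle z y x]
      _ = ENNReal.ofReal (Φ / lowerDensity d C * ((2 / c) ^ d * (((2 + c) * δ) ^ d * V))) := by
          rw [volume_closedBall_euc _ (by positivity), hV,
            ← ENNReal.ofReal_mul (by positivity), ← ENNReal.ofReal_mul (by positivity),
            ← ENNReal.ofReal_mul (by positivity)]
      _ ≤ _ := by
          apply ENNReal.ofReal_le_ofReal
          calc _ = Φ / lowerDensity d C * ((2 / c) ^ d * ((2 + c) ^ d * V)) * δ ^ d := by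
                rw [mul_pow]; ring
            _ ≤ _ := by
              rw [hKdef]
              gcongr
              have : 0 ≤ (2 / c + 1) ^ d * V := by positivity
              linarith

end ThickMeasure

/-! ### Polar coordinates and restriction to the sphere by a radial Sobolev inequality. -/

section Polar

variable {d : ℕ}

/-- Integration in polar coordinates. -/
lemma lintegral_eq_lintegral_sphere {G : Euc d → ℝ≥0∞} (hd : 0 < d) (hG : Measurable G) :
    ∫⁻ ξ, G ξ = ∫⁻ θ : Metric.sphere (0 : Euc d) 1, (∫⁻ r in Set.Ioi (0 : ℝ),
      ENNReal.ofReal (r ^ (d - 1)) * G (r • (θ : Euc d))) ∂(volume : Measure (Euc d)).toSphere := by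
  have : Nonempty (Fin d) := ⟨⟨0, hd⟩⟩
  have : Nontrivial (Euc d) := inferInstance
  have hmp := (volume : Measure (Euc d)).measurePreserving_homeomorphUnitSphereProd
  have hm : Measurable fun z : Metric.sphere (0 : Euc d) 1 × Set.Ioi (0 : ℝ) =>
      G ((z.2 : ℝ) • (z.1 : Euc d)) := by
    apply hG.comp
    fun_prop
  calc ∫⁻ ξ, G ξ = ∫⁻ ξ in ({0}ᶜ : Set (Euc d)), G ξ := by
        rw [restrict_compl_singleton]
    _ = ∫⁻ x : ({0}ᶜ : Set (Euc d)), G x ∂(volume : Measure (Euc d)).comap (↑) :=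
        (lintegral_subtype_comap (measurableSet_singleton _).compl _).symm
    _ = ∫⁻ z, G ((z.2 : ℝ) • (z.1 : Euc d)) ∂((volume : Measure (Euc d)).toSphere.prod
          (Measure.volumeIoiPow (Module.finrank ℝ (Euc d) - 1))) := by
        rw [← hmp.lintegral_comp hm]
        refine lintegral_congr fun x => ?_
        congr 1
        have hx : ‖(x : Euc d)‖ ≠ 0 := norm_ne_zero_iff.2 x.2
        simp [smul_smul, hx]
    _ = _ := by
        rw [lintegral_prod _ hm.aemeasurable, finrank_euclideanSpace_fin]
        refine lintegral_congr fun θ => ?_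
        have hm' : Measurable fun r : Set.Ioi (0 : ℝ) => G ((r : ℝ) • (θ : Euc d)) :=
          hm.comp measurable_prodMk_left
        rw [Measure.volumeIoiPow, lintegral_withDensity_eq_lintegral_mul _ (by fun_prop) hm']
        exact lintegral_subtype_comap measurableSet_Ioi
          fun r : ℝ => ENNReal.ofReal (r ^ (d - 1)) * G (r • (θ : Euc d))

/-- A one-dimensional Sobolev inequality. -/
lemma sq_norm_le_of_hasDerivAt {f f' : ℝ → ℂ} {h : ℝ} (hh : 0 < h)
    (hf : ∀ r, HasDerivAt f (f' r) r) (hf' : Continuous f') :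
    ‖f 1‖ ^ 2 ≤ 2 / h * ∫ r in (1 : ℝ)..(1 + h), (‖f r‖ ^ 2 + h ^ 2 * ‖f' r‖ ^ 2) := by
  have hfc : Continuous f := continuous_iff_continuousAt.2 fun r => (hf r).continuousAt
  have h1 : (1 : ℝ) ≤ 1 + h := by linarith
  set m := ∫ r in (1 : ℝ)..(1 + h), ‖f' r‖ with hm
  set Q := ∫ r in (1 : ℝ)..(1 + h), ‖f' r‖ ^ 2 with hQ
  -- Cauchy–Schwarz, read off from the non-negative variance of `‖f'‖` about its mean `m / h`.
  have hcs : m ^ 2 ≤ h * Q := by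
    have h0 : 0 ≤ ∫ r in (1 : ℝ)..(1 + h), (‖f' r‖ - m / h) ^ 2 :=
      intervalIntegral.integral_nonneg h1 fun r _ => sq_nonneg _
    have hexp : ∫ r in (1 : ℝ)..(1 + h), (‖f' r‖ - m / h) ^ 2
        = Q - 2 * (m / h) * m + (m / h) ^ 2 * h := by
      have : ∀ r, (‖f' r‖ - m / h) ^ 2 = ‖f' r‖ ^ 2 - 2 * (m / h) * ‖f' r‖ + (m / h) ^ 2 :=
        fun r => by ring
      simp only [this]
      rw [intervalIntegral.integral_add, intervalIntegral.integral_sub,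
        intervalIntegral.integral_const_mul, intervalIntegral.integral_const, smul_eq_mul]
      · rw [← hm, ← hQ]; ring
      all_goals apply Continuous.intervalIntegrable; fun_prop
    rw [hexp] at h0
    have : h * (Q - 2 * (m / h) * m + (m / h) ^ 2 * h) = h * Q - m ^ 2 := by field_simp; ring
    have h3 := mul_nonneg hh.le h0
    rw [this] at h3
    linarith
  -- The bound holds at every `r` of the interval; averaging it over `r` gives the claim.
  have hpt : ∀ r ∈ Set.Icc (1 : ℝ) (1 + h), ‖f 1‖ ^ 2 ≤ 2 * ‖f r‖ ^ 2 + 2 * (h * Q) := by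
    intro r hr
    have e1 : ∫ x in (1 : ℝ)..r, f' x = f r - f 1 :=
      intervalIntegral.integral_eq_sub_of_hasDerivAt (fun x _ => hf x)
        (hf'.intervalIntegrable _ _)
    have e2 : ‖∫ x in (1 : ℝ)..r, f' x‖ ≤ m := by
      refine (intervalIntegral.norm_integral_le_integral_norm hr.1).trans ?_
      refine intervalIntegral.integral_mono_interval le_rfl hr.1 hr.2
        (Filter.Eventually.of_forall fun _ => norm_nonneg _) ?_
      exact hf'.norm.intervalIntegrable _ _
    have e3 : ‖f 1‖ ≤ ‖f r‖ + m := by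
      calc ‖f 1‖ = ‖f r - (f r - f 1)‖ := by congr 1; ring
        _ ≤ ‖f r‖ + ‖f r - f 1‖ := norm_sub_le _ _
        _ ≤ _ := by rw [← e1]; gcongr
    calc ‖f 1‖ ^ 2 ≤ (‖f r‖ + m) ^ 2 := by gcongr
      _ ≤ 2 * ‖f r‖ ^ 2 + 2 * m ^ 2 := by nlinarith [sq_nonneg (‖f r‖ - m)]
      _ ≤ _ := by linarith
  have hint := intervalIntegral.integral_mono_on h1
    (continuous_const.intervalIntegrable (μ := volume) _ _)
    (Continuous.intervalIntegrable (by fun_prop) _ _) hpt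
  rw [intervalIntegral.integral_const, smul_eq_mul, add_sub_cancel_left,
    intervalIntegral.integral_add (Continuous.intervalIntegrable (by fun_prop) _ _)
      (Continuous.intervalIntegrable (by fun_prop) _ _), intervalIntegral.integral_const_mul,
    intervalIntegral.integral_const, smul_eq_mul, add_sub_cancel_left] at hint
  rw [intervalIntegral.integral_add (Continuous.intervalIntegrable (by fun_prop) _ _)
      (Continuous.intervalIntegrable (by fun_prop) _ _), intervalIntegral.integral_const_mul, ← hQ]
  rw [div_mul_eq_mul_div, le_div_iff₀ hh]
  linarith

/-- The values on the sphere are controlled by the values, and the radial derivative, in a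
neighbourhood. -/
lemma lintegral_sphere_le (hd : 0 < d) {F : Euc d → ℂ} (hF : ContDiff ℝ 1 F) {h : ℝ} (hh : 0 < h)
    {E D : Set (Euc d)} (hD : MeasurableSet D)
    (hED : ∀ θ ∈ E, ‖θ‖ = 1 → ∀ r, 1 ≤ r → r ≤ 1 + h → r • θ ∈ D) :
    ∫⁻ θ : Metric.sphere (0 : Euc d) 1, E.indicator (fun θ => ‖F θ‖ₑ ^ 2) θ
        ∂(volume : Measure (Euc d)).toSphere
      ≤ ENNReal.ofReal (2 / h) * ∫⁻ ξ in D, ‖F ξ‖ₑ ^ 2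
          + ENNReal.ofReal (h ^ 2) * ‖fderiv ℝ F ξ ξ‖ₑ ^ 2 := by
  have hF1 : Continuous fun ξ => fderiv ℝ F ξ ξ :=
    (hF.continuous_fderiv one_ne_zero).clm_apply continuous_id
  set H : Euc d → ℝ≥0∞ := fun ξ => ‖F ξ‖ₑ ^ 2 + ENNReal.ofReal (h ^ 2) * ‖fderiv ℝ F ξ ξ‖ₑ ^ 2
    with hH
  have hHm : Measurable H := by
    have := hF.continuous.measurable
    have := hF1.measurable
    fun_prop
  rw [← lintegral_indicator hD, lintegral_eq_lintegral_sphere hd (hHm.indicator hD),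
    ← lintegral_const_mul' _ _ ENNReal.ofReal_ne_top]
  refine lintegral_mono fun θ => ?_
  have hθ : ‖(θ : Euc d)‖ = 1 := by simp
  by_cases hθE : (θ : Euc d) ∈ E
  swap
  · simp [hθE]
  rw [Set.indicator_of_mem hθE]
  set f : ℝ → ℂ := fun r => F (r • (θ : Euc d))
  set f' : ℝ → ℂ := fun r => fderiv ℝ F (r • (θ : Euc d)) θ
  have hf : ∀ r, HasDerivAt f (f' r) r := by
    intro r
    have h1 : HasDerivAt (fun r : ℝ => r • (θ : Euc d)) ((1 : ℝ) • (θ : Euc d)) r :=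
      (hasDerivAt_id r).smul_const _
    rw [one_smul] at h1
    exact ((hF.differentiable one_ne_zero _).hasFDerivAt).comp_hasDerivAt r h1
  have hf' : Continuous f' := by
    have := hF.continuous_fderiv one_ne_zero
    fun_prop
  have hfc : Continuous f := continuous_iff_continuousAt.2 fun r => (hf r).continuousAt
  have h1 : (1 : ℝ) ≤ 1 + h := by linarith
  have hS := sq_norm_le_of_hasDerivAt hh hf hf'
  have hfθ : f 1 = F θ := by simp [f]
  rw [hfθ] at hS
  calc ‖F θ‖ₑ ^ 2 = ENNReal.ofReal (‖F θ‖ ^ 2) := by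
        rw [ENNReal.ofReal_pow (norm_nonneg _), ofReal_norm]
    _ ≤ ENNReal.ofReal (2 / h) * ENNReal.ofReal
          (∫ r in Set.Ioc (1 : ℝ) (1 + h), (‖f r‖ ^ 2 + h ^ 2 * ‖f' r‖ ^ 2)) := by
        rw [← ENNReal.ofReal_mul (by positivity), ← intervalIntegral.integral_of_le h1]
        exact ENNReal.ofReal_le_ofReal hS
    _ = ENNReal.ofReal (2 / h) * ∫⁻ r in Set.Ioc (1 : ℝ) (1 + h),
          ENNReal.ofReal (‖f r‖ ^ 2 + h ^ 2 * ‖f' r‖ ^ 2) := by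
        rw [ofReal_integral_eq_lintegral_ofReal]
        · exact ((Continuous.intervalIntegrable (by fun_prop) _ _ :
            IntervalIntegrable _ volume 1 (1 + h)).1)
        · exact Filter.Eventually.of_forall fun r => by positivity
    _ ≤ ENNReal.ofReal (2 / h) * ∫⁻ r in Set.Ioc (1 : ℝ) (1 + h),
          ENNReal.ofReal (r ^ (d - 1)) * D.indicator H (r • (θ : Euc d)) := by
        refine mul_le_mul_right (setLIntegral_mono' measurableSet_Ioc fun r hr => ?_) _
        have hr1 : 1 ≤ r := hr.1.le
        rw [Set.indicator_of_mem (hED θ hθE hθ r hr1 hr.2)]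
        -- Integrating outwards, over `r ≥ 1`, lets the polar Jacobian be inserted for free; in `e2`
        -- it likewise lets the derivative along `θ` be replaced by the one along `r θ`.
        have e1 : (1 : ℝ≥0∞) ≤ ENNReal.ofReal (r ^ (d - 1)) := by
          rw [← ENNReal.ofReal_one]
          exact ENNReal.ofReal_le_ofReal (one_le_pow₀ hr1)
        refine le_trans ?_ (le_mul_of_one_le_left bot_le e1)
        rw [ENNReal.ofReal_add (by positivity) (by positivity), ENNReal.ofReal_mul (by positivity),
          ENNReal.ofReal_pow (norm_nonneg _), ENNReal.ofReal_pow (norm_nonneg _),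
          ofReal_norm, ofReal_norm, hH]
        have e2 : ‖f' r‖ₑ ≤ ‖fderiv ℝ F (r • (θ : Euc d)) (r • (θ : Euc d))‖ₑ := by
          rw [map_smul, enorm_smul]
          refine le_mul_of_one_le_left bot_le ?_
          rw [← ofReal_norm, ← ENNReal.ofReal_one]
          exact ENNReal.ofReal_le_ofReal (hr1.trans (le_abs_self r))
        exact add_le_add le_rfl (mul_le_mul_right (pow_le_pow_left' e2 2) _)
    _ ≤ _ := by
        refine mul_le_mul_right (lintegral_mono_set fun r hr => ?_) _
        exact lt_trans one_pos hr.1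

end Polar

/-! ### Waves, Gaussian sums and the local large sieve. -/

section LargeSieve

variable {d : ℕ}

/-- The exponential `x, ξ ↦ e^{-2πi x·ξ}`. -/
noncomputable def wave (x ξ : Euc d) : ℂ :=
  Complex.exp (-(2 * Real.pi * inner ℝ x ξ : ℝ) * Complex.I)

lemma wave_eq_exp_ofReal_mul_I (x ξ : Euc d) :
    wave x ξ = Complex.exp ((-(2 * Real.pi * inner ℝ x ξ) : ℝ) * Complex.I) := by
  rw [wave]; push_cast; ring_nf

@[simp] lemma norm_wave (x ξ : Euc d) : ‖wave x ξ‖ = 1 := by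
  rw [wave_eq_exp_ofReal_mul_I, Complex.norm_exp_ofReal_mul_I]

lemma wave_add_left (x y ξ : Euc d) : wave (x + y) ξ = wave x ξ * wave y ξ := by
  rw [wave, wave, wave, ← Complex.exp_add, inner_add_left]
  congr 1; push_cast; ring

lemma wave_add_right (x ξ η : Euc d) : wave x (ξ + η) = wave x ξ * wave x η := by
  rw [wave, wave, wave, ← Complex.exp_add, inner_add_right]
  congr 1; push_cast; ring

lemma wave_smul_left (r : ℝ) (x ξ : Euc d) : wave (r • x) ξ = wave x (r • ξ) := by
  simp [wave, inner_smul_left, inner_smul_right]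

lemma conj_wave (x ξ : Euc d) : starRingEnd ℂ (wave x ξ) = wave (-x) ξ := by
  rw [wave_eq_exp_ofReal_mul_I, wave_eq_exp_ofReal_mul_I, ← Complex.exp_conj, map_mul,
    Complex.conj_ofReal, Complex.conj_I, inner_neg_left]
  congr 1
  push_cast
  ring

@[fun_prop]
lemma contDiff_wave (x : Euc d) {n : ℕ∞ω} : ContDiff ℝ n (wave x) := by
  have h : ContDiff ℝ n fun ξ : Euc d => 2 * Real.pi * inner ℝ x ξ :=
    contDiff_const.mul (contDiff_const.inner ℝ contDiff_id)
  exact ((Complex.ofRealCLM.contDiff.comp h).neg.mul contDiff_const).cexp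

@[fun_prop]
lemma continuous_wave (x : Euc d) : Continuous (wave x) := (contDiff_wave x (n := 0)).continuous

lemma continuous_wave_left (ξ : Euc d) : Continuous fun x => wave x ξ := by
  unfold wave
  fun_prop

lemma fderiv_wave_apply (x ξ v : Euc d) :
    fderiv ℝ (wave x) ξ v = -(2 * Real.pi * inner ℝ x v : ℝ) * Complex.I * wave x ξ := by
  have h : HasFDerivAt (fun ξ : Euc d => 2 * Real.pi * inner ℝ x ξ)
      ((2 * Real.pi) • innerSL ℝ x) ξ := by
    simpa using ((innerSL ℝ x).hasFDerivAt (x := ξ)).const_mul (2 * Real.pi)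
  have h2 := ((Complex.ofRealCLM.hasFDerivAt.comp ξ h).neg.mul_const Complex.I).cexp
  have h3 : HasFDerivAt (wave x) _ ξ := h2
  rw [h3.fderiv]
  simp [wave]
  ring

/-- This Gaussian is its own Fourier transform, and moving its centre to `ζ` only produces the
unimodular factor `wave x ζ`. The inner products of waves with Gaussian weight thus become explicit,
and small for distant frequencies. -/
lemma integral_wave_mul_gaussian (x ζ : Euc d) :
    ∫ ξ, wave x ξ * (Real.exp (-Real.pi * ‖ξ - ζ‖ ^ 2) : ℂ)
      = wave x ζ * Real.exp (-Real.pi * ‖x‖ ^ 2) := by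
  have h0 := fourier_gaussian_innerProductSpace (b := Real.pi) (by simpa using Real.pi_pos) x
  rw [div_self (by exact_mod_cast Real.pi_ne_zero), Complex.one_cpow, one_mul,
    Real.fourier_eq'] at h0
  have h1 : ∫ ξ, wave x ξ * (Real.exp (-Real.pi * ‖ξ‖ ^ 2) : ℂ)
      = Real.exp (-Real.pi * ‖x‖ ^ 2) := by
    have h2 : (-(Real.pi : ℂ) ^ 2 * (‖x‖ : ℂ) ^ 2 / Real.pi)
        = ((-Real.pi * ‖x‖ ^ 2 : ℝ) : ℂ) := by
      push_cast
      field_simp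
    rw [h2, ← Complex.ofReal_exp] at h0
    rw [← h0]
    refine integral_congr_ae (Filter.Eventually.of_forall fun ξ => ?_)
    simp only [smul_eq_mul]
    rw [wave, real_inner_comm]
    push_cast
    ring_nf
  rw [← h1, ← integral_const_mul, ← integral_add_right_eq_self _ ζ]
  refine integral_congr_ae (Filter.Eventually.of_forall fun ξ => ?_)
  simp only [add_sub_cancel_right]
  rw [wave_add_right]
  ring

lemma integrable_gaussian {b : ℝ} (hb : 0 < b) (ζ : Euc d) :
    Integrable fun ξ : Euc d => Real.exp (-b * ‖ξ - ζ‖ ^ 2) := by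
  have h := GaussianFourier.integrable_cexp_neg_mul_sq_norm_add (b := (b : ℂ)) (by simpa using hb)
    0 (0 : Euc d)
  have h2 := h.norm.comp_sub_right ζ
  refine h2.congr (Filter.Eventually.of_forall fun ξ => ?_)
  simp only [Complex.norm_exp]
  congr 1
  simp [← Complex.ofReal_pow]

/-- Gaussian sums over separated points are bounded. -/
lemma exists_sum_gaussian_le (hd : 0 < d) {δ : ℝ} (hδ : 0 < δ) :
    ∃ C : ℝ, 0 < C ∧ ∀ {ι : Type} (I : Finset ι) (x : ι → Euc d),
      (∀ i ∈ I, ∀ j ∈ I, i ≠ j → δ ≤ ‖x i - x j‖) → ∀ y : Euc d,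
        ∑ i ∈ I, Real.exp (-Real.pi * ‖y - x i‖ ^ 2) ≤ C := by
  set v := volume.real (Metric.ball (0 : Euc d) (δ / 2)) with hv
  have hv0 : 0 < v :=
    ENNReal.toReal_pos (Metric.measure_ball_pos volume 0 (by positivity)).ne' measure_ball_lt_top.ne
  set G := ∫ z : Euc d, Real.exp (-(Real.pi / 2) * ‖z‖ ^ 2) with hG
  have hG0 : 0 ≤ G := integral_nonneg fun _ => (Real.exp_pos _).le
  refine ⟨Real.exp (Real.pi * (δ ^ 2 / 4)) * G / v + 1, by positivity, fun {ι} I x hsep y => ?_⟩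
  have hint := integrable_gaussian (b := Real.pi / 2) (by positivity) y
  have hGy : ∫ z : Euc d, Real.exp (-(Real.pi / 2) * ‖z - y‖ ^ 2) = G :=
    integral_sub_right_eq_self (fun z : Euc d => Real.exp (-(Real.pi / 2) * ‖z‖ ^ 2)) y
  -- Each term is compared with the integral of a wider Gaussian over the ball of radius `δ / 2`
  -- about `x i`, by `‖z - y‖² ≤ 2 (δ / 2)² + 2 ‖y - x i‖²`. The balls are disjoint, so the sum is
  -- at most one full Gaussian integral.
  have hone : ∀ i ∈ I, v * Real.exp (-Real.pi * ‖y - x i‖ ^ 2)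
      ≤ Real.exp (Real.pi * (δ ^ 2 / 4)) *
        ∫ z in Metric.ball (x i) (δ / 2), Real.exp (-(Real.pi / 2) * ‖z - y‖ ^ 2) := by
    intro i _
    have hvi : volume.real (Metric.ball (x i) (δ / 2)) = v := by
      rw [hv, measureReal_def, measureReal_def, volume_ball_euc hd (x i) (by positivity),
        volume_ball_euc hd (0 : Euc d) (by positivity : 0 ≤ δ / 2)]
    rw [← integral_const_mul, ← hvi, ← smul_eq_mul, ← setIntegral_const]
    refine setIntegral_mono_on (integrableOn_const measure_ball_lt_top.ne)
      (hint.const_mul _).integrableOn measurableSet_ball fun z hz => ?_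
    rw [← Real.exp_add, Real.exp_le_exp]
    rw [Metric.mem_ball, dist_eq_norm] at hz
    have h1 : ‖z - y‖ ≤ ‖z - x i‖ + ‖y - x i‖ := by
      calc ‖z - y‖ = ‖(z - x i) - (y - x i)‖ := by congr 1; abel
        _ ≤ _ := norm_sub_le _ _
    have h2 : ‖z - y‖ ^ 2 ≤ 2 * (δ ^ 2 / 4) + 2 * ‖y - x i‖ ^ 2 := by
      have h3 : ‖z - y‖ ^ 2 ≤ (δ / 2 + ‖y - x i‖) ^ 2 := by gcongr; linarith
      nlinarith [sq_nonneg (δ / 2 - ‖y - x i‖)]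
    have := mul_le_mul_of_nonneg_left h2 Real.pi_pos.le
    linarith
  have hsum : ∑ i ∈ I, ∫ z in Metric.ball (x i) (δ / 2), Real.exp (-(Real.pi / 2) * ‖z - y‖ ^ 2)
      ≤ G := by
    rw [← integral_biUnion_finset I (fun _ _ => measurableSet_ball) (pairwiseDisjoint_ball hsep)
      fun _ _ => hint.integrableOn, ← hGy]
    exact setIntegral_le_integral hint (Filter.Eventually.of_forall fun _ => (Real.exp_pos _).le)
  have h4 : v * ∑ i ∈ I, Real.exp (-Real.pi * ‖y - x i‖ ^ 2)
      ≤ Real.exp (Real.pi * (δ ^ 2 / 4)) * G := by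
    rw [Finset.mul_sum]
    refine (Finset.sum_le_sum hone).trans ?_
    rw [← Finset.mul_sum]
    gcongr
  have h5 : ∑ i ∈ I, Real.exp (-Real.pi * ‖y - x i‖ ^ 2)
      ≤ Real.exp (Real.pi * (δ ^ 2 / 4)) * G / v := by
    rw [le_div_iff₀ hv0, mul_comm]; exact h4
  linarith

/-- The exponential sum with frequencies `x i` and coefficients `a i`. -/
noncomputable def expSum {ι : Type*} (I : Finset ι) (x : ι → Euc d) (a : ι → ℂ) (ξ : Euc d) : ℂ :=
  ∑ i ∈ I, a i * wave (x i) ξ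

@[fun_prop]
lemma contDiff_expSum {ι : Type*} (I : Finset ι) (x : ι → Euc d) (a : ι → ℂ) {n : ℕ∞ω} :
    ContDiff ℝ n (expSum I x a) :=
  ContDiff.sum fun _ _ => contDiff_const.mul (contDiff_wave _)

@[fun_prop]
lemma continuous_expSum {ι : Type*} (I : Finset ι) (x : ι → Euc d) (a : ι → ℂ) :
    Continuous (expSum I x a) := (contDiff_expSum I x a (n := 0)).continuous

lemma fderiv_expSum_apply {ι : Type*} (I : Finset ι) (x : ι → Euc d) (a : ι → ℂ) (ξ v : Euc d) :
    fderiv ℝ (expSum I x a) ξ v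
      = ∑ i ∈ I, a i * (-(2 * Real.pi * inner ℝ (x i) v : ℝ) * Complex.I * wave (x i) ξ) := by
  have hw : ∀ i ∈ I, HasFDerivAt (fun ξ => a i * wave (x i) ξ)
      (a i • fderiv ℝ (wave (x i)) ξ) ξ := fun i _ =>
    (((contDiff_wave (x i) (n := 1)).differentiable one_ne_zero ξ).hasFDerivAt).const_mul _
  have h := HasFDerivAt.fun_sum hw
  have h' : HasFDerivAt (expSum I x a) _ ξ := h
  rw [h'.fderiv]
  simp [fderiv_wave_apply]

/-- The local large sieve inequality: exponential sums with separated frequencies are locally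
almost orthogonal. -/
lemma exists_lintegral_expSum_gaussian_le (hd : 0 < d) {δ : ℝ} (hδ : 0 < δ) :
    ∃ C : ℝ, 0 < C ∧ ∀ {ι : Type} (I : Finset ι) (x : ι → Euc d) (a : ι → ℂ),
      (∀ i ∈ I, ∀ j ∈ I, i ≠ j → δ ≤ ‖x i - x j‖) → ∀ ζ : Euc d,
        ∫⁻ ξ, ‖expSum I x a ξ‖ₑ ^ 2 * ENNReal.ofReal (Real.exp (-Real.pi * ‖ξ - ζ‖ ^ 2))
          ≤ ENNReal.ofReal C * ∑ i ∈ I, ‖a i‖ₑ ^ 2 := by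
  obtain ⟨C, hC, hCsum⟩ := exists_sum_gaussian_le hd hδ
  refine ⟨C, hC, fun {ι} I x a hsep ζ => ?_⟩
  set g : Euc d → ℝ := fun ξ => Real.exp (-Real.pi * ‖ξ - ζ‖ ^ 2) with hg
  have hgint : Integrable g := integrable_gaussian Real.pi_pos ζ
  have hwint : ∀ y : Euc d, Integrable fun ξ => wave y ξ * (g ξ : ℂ) := fun y =>
    hgint.ofReal.bdd_mul (c := 1) (continuous_wave y).aestronglyMeasurable
      (Filter.Eventually.of_forall fun ξ => by simp)
  have hexp : ∀ ξ, ((‖expSum I x a ξ‖ ^ 2 * g ξ : ℝ) : ℂ) = ∑ i ∈ I, ∑ j ∈ I,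
      a i * starRingEnd ℂ (a j) * (wave (x i - x j) ξ * (g ξ : ℂ)) := by
    intro ξ
    push_cast
    rw [← Complex.mul_conj', expSum, map_sum, Finset.sum_mul_sum, Finset.sum_mul]
    refine Finset.sum_congr rfl fun i _ => ?_
    rw [Finset.sum_mul]
    refine Finset.sum_congr rfl fun j _ => ?_
    rw [map_mul, conj_wave, sub_eq_add_neg, wave_add_left]
    ring
  have hint2 : Integrable fun ξ => ((‖expSum I x a ξ‖ ^ 2 * g ξ : ℝ) : ℂ) := by
    simp only [hexp]
    exact integrable_finsetSum _ fun i _ => integrable_finsetSum _ fun j _ =>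
      (hwint _).const_mul _
  have hint : Integrable fun ξ => ‖expSum I x a ξ‖ ^ 2 * g ξ := by
    exact hint2.re
  have hval : ((∫ ξ, ‖expSum I x a ξ‖ ^ 2 * g ξ : ℝ) : ℂ) = ∑ i ∈ I, ∑ j ∈ I,
      a i * starRingEnd ℂ (a j) *
        (wave (x i - x j) ζ * Real.exp (-Real.pi * ‖x i - x j‖ ^ 2)) := by
    rw [← integral_complex_ofReal]
    simp only [hexp]
    rw [integral_finsetSum _ fun i _ => integrable_finsetSum _ fun j _ => (hwint _).const_mul _]
    refine Finset.sum_congr rfl fun i _ => ?_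
    rw [integral_finsetSum _ fun j _ => (hwint _).const_mul _]
    refine Finset.sum_congr rfl fun j _ => ?_
    rw [integral_const_mul, integral_wave_mul_gaussian]
  -- Schur's test: the matrix `e` is symmetric with row sums at most `C`, and `2 ‖a i‖ ‖a j‖ ≤ ‖a
  -- i‖² + ‖a j‖²`.
  have hbound : ∫ ξ, ‖expSum I x a ξ‖ ^ 2 * g ξ ≤ C * ∑ i ∈ I, ‖a i‖ ^ 2 := by
    set e : ι → ι → ℝ := fun i j => Real.exp (-Real.pi * ‖x i - x j‖ ^ 2) with he
    have hsym : ∀ i j, e i j = e j i := fun i j => by simp only [he, norm_sub_rev]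
    have hrow : ∀ i, ∑ j ∈ I, e i j ≤ C := fun i => hCsum I x hsep (x i)
    have he0 : ∀ i j, 0 ≤ e i j := fun i j => (Real.exp_pos _).le
    calc ∫ ξ, ‖expSum I x a ξ‖ ^ 2 * g ξ ≤ ‖((∫ ξ, ‖expSum I x a ξ‖ ^ 2 * g ξ : ℝ) : ℂ)‖ := by
          rw [Complex.norm_real]; exact le_abs_self _
      _ ≤ ∑ i ∈ I, ∑ j ∈ I, ‖a i‖ * ‖a j‖ * e i j := by
          rw [hval]
          refine (norm_sum_le _ _).trans (Finset.sum_le_sum fun i _ => (norm_sum_le _ _).trans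
            (Finset.sum_le_sum fun j _ => ?_))
          rw [norm_mul, norm_mul, norm_mul, norm_wave, RCLike.norm_conj, Complex.norm_real, one_mul,
            Real.norm_of_nonneg (Real.exp_pos _).le]
      _ ≤ ∑ i ∈ I, ∑ j ∈ I, (‖a i‖ ^ 2 * e i j / 2 + ‖a j‖ ^ 2 * e j i / 2) := by
          refine Finset.sum_le_sum fun i _ => Finset.sum_le_sum fun j _ => ?_
          rw [hsym j i]
          have h1 := mul_nonneg (sq_nonneg (‖a i‖ - ‖a j‖)) (he0 i j)
          nlinarith
      _ = ∑ i ∈ I, ∑ j ∈ I, ‖a i‖ ^ 2 * e i j := by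
          simp only [Finset.sum_add_distrib]
          rw [Finset.sum_comm (f := fun i j => ‖a j‖ ^ 2 * e j i / 2), ← Finset.sum_add_distrib]
          refine Finset.sum_congr rfl fun i _ => ?_
          rw [← Finset.sum_add_distrib]
          exact Finset.sum_congr rfl fun j _ => by ring
      _ ≤ ∑ i ∈ I, ‖a i‖ ^ 2 * C := by
          refine Finset.sum_le_sum fun i _ => ?_
          rw [← Finset.mul_sum]
          gcongr
          exact hrow i
      _ = _ := by rw [← Finset.sum_mul, mul_comm]
  have hnn : ∀ ξ, 0 ≤ ‖expSum I x a ξ‖ ^ 2 * g ξ := fun ξ =>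
    mul_nonneg (sq_nonneg _) (Real.exp_pos _).le
  calc ∫⁻ ξ, ‖expSum I x a ξ‖ₑ ^ 2 * ENNReal.ofReal (g ξ)
      = ∫⁻ ξ, ENNReal.ofReal (‖expSum I x a ξ‖ ^ 2 * g ξ) := by
        refine lintegral_congr fun ξ => ?_
        rw [ENNReal.ofReal_mul (sq_nonneg _), ENNReal.ofReal_pow (norm_nonneg _), ofReal_norm]
    _ = ENNReal.ofReal (∫ ξ, ‖expSum I x a ξ‖ ^ 2 * g ξ) :=
        (ofReal_integral_eq_lintegral_ofReal hint (Filter.Eventually.of_forall hnn)).symm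
    _ ≤ ENNReal.ofReal (C * ∑ i ∈ I, ‖a i‖ ^ 2) := ENNReal.ofReal_le_ofReal hbound
    _ = _ := by
        rw [ENNReal.ofReal_mul hC.le, ENNReal.ofReal_sum_of_nonneg fun i _ => sq_nonneg _]
        simp only [ENNReal.ofReal_pow (norm_nonneg _), ofReal_norm]

end LargeSieve

/-! ### Mean squares of exponential sums over annuli and spheres. -/

section SphereBound

variable {d : ℕ}

open scoped Pointwise in
-- Dividing by `T` turns the annulus into part of a unit shell of thickness `2 / T ≤ 2 / c₀`. The
-- interval `[T - 1, T + 2]` is the unit neighbourhood of `[T, T + 1]`, where the centres of the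
-- Gaussians will range.
lemma exists_volume_annulus_le (hd : 0 < d) {c₀ : ℝ} (hc₀ : 0 < c₀) :
    ∃ C : ℝ, 0 < C ∧ ∀ T : ℝ, c₀ ≤ T →
      volume {ξ : Euc d | T - 1 ≤ ‖ξ‖ ∧ ‖ξ‖ ≤ T + 2} ≤ ENNReal.ofReal (C * T ^ (d - 1)) := by
  obtain ⟨C, hC, hsh⟩ := exists_volume_shell_le hd (2 / c₀)
  refine ⟨C * 2, by positivity, fun T hT => ?_⟩
  have hT0 : 0 < T := hc₀.trans_le hT
  have hsub : {ξ : Euc d | T - 1 ≤ ‖ξ‖ ∧ ‖ξ‖ ≤ T + 2}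
      ⊆ T • {x : Euc d | 1 - 2 / T ≤ ‖x‖ ∧ ‖x‖ ≤ 1 + 2 / T} := by
    intro ξ hξ
    refine ⟨T⁻¹ • ξ, ?_, smul_inv_smul₀ hT0.ne' ξ⟩
    rw [Set.mem_ofPred_eq, norm_smul, norm_inv, Real.norm_of_nonneg hT0.le]
    constructor
    · rw [le_inv_mul_iff₀ hT0, mul_sub, mul_div_cancel₀ _ hT0.ne', mul_one]
      linarith [hξ.1]
    · rw [inv_mul_le_iff₀ hT0, mul_add, mul_div_cancel₀ _ hT0.ne', mul_one]
      exact hξ.2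
  calc _ ≤ _ := measure_mono hsub
    _ = ENNReal.ofReal (T ^ d) * volume {x : Euc d | 1 - 2 / T ≤ ‖x‖ ∧ ‖x‖ ≤ 1 + 2 / T} := by
        rw [Measure.addHaar_smul, finrank_euclideanSpace_fin, abs_of_pos (by positivity)]
    _ ≤ ENNReal.ofReal (T ^ d) * ENNReal.ofReal (C * (2 / T)) := by
        gcongr
        exact hsh _ (by positivity) (by gcongr)
    _ = _ := by
        rw [← ENNReal.ofReal_mul (by positivity)]
        congr 1
        obtain ⟨n, rfl⟩ : ∃ n, d = n + 1 := ⟨d - 1, by omega⟩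
        rw [Nat.add_sub_cancel, pow_succ]
        field_simp

lemma measurableSet_annulus (r s : ℝ) : MeasurableSet {ξ : Euc d | r ≤ ‖ξ‖ ∧ ‖ξ‖ ≤ s} :=
  (measurableSet_le measurable_const measurable_norm).inter
    (measurableSet_le measurable_norm measurable_const)

lemma le_setLIntegral_gaussian (hd : 0 < d) {D : Set (Euc d)} {ξ : Euc d}
    (hD : Metric.ball ξ 1 ⊆ D) :
    ENNReal.ofReal (Real.exp (-Real.pi)) * volume (Metric.ball (0 : Euc d) 1)
      ≤ ∫⁻ ζ in D, ENNReal.ofReal (Real.exp (-Real.pi * ‖ξ - ζ‖ ^ 2)) := by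
  calc _ = ∫⁻ _ζ in Metric.ball ξ 1, ENNReal.ofReal (Real.exp (-Real.pi)) := by
        rw [setLIntegral_const, volume_ball_euc hd ξ zero_le_one, one_pow, ENNReal.ofReal_one,
          one_mul]
    _ ≤ ∫⁻ ζ in Metric.ball ξ 1, ENNReal.ofReal (Real.exp (-Real.pi * ‖ξ - ζ‖ ^ 2)) := by
        refine setLIntegral_mono' measurableSet_ball fun ζ hζ => ?_
        apply ENNReal.ofReal_le_ofReal
        rw [Real.exp_le_exp]
        rw [Metric.mem_ball', dist_eq_norm] at hζ
        have : ‖ξ - ζ‖ ^ 2 ≤ 1 := pow_le_one₀ (norm_nonneg _) hζ.le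
        nlinarith [Real.pi_pos]
    _ ≤ _ := lintegral_mono_set hD

/-- If Gaussian averages of a function are bounded, then so are its averages over large sets. -/
lemma setLIntegral_le_of_gaussian_average_le (hd : 0 < d) {H : Euc d → ℝ≥0∞} (hH : Measurable H)
    {M : ℝ≥0∞} (hM : ∀ ζ, ∫⁻ ξ, H ξ * ENNReal.ofReal (Real.exp (-Real.pi * ‖ξ - ζ‖ ^ 2)) ≤ M)
    {D D' : Set (Euc d)} (hDm : MeasurableSet D) (hD : ∀ ξ ∈ D, Metric.ball ξ 1 ⊆ D') :
    ENNReal.ofReal (Real.exp (-Real.pi)) * volume (Metric.ball (0 : Euc d) 1) * ∫⁻ ξ in D, H ξ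
      ≤ M * volume D' := by
  have hgm : Measurable fun z : Euc d × Euc d =>
      ENNReal.ofReal (Real.exp (-Real.pi * ‖z.1 - z.2‖ ^ 2)) := by fun_prop
  calc _ = ∫⁻ ξ in D, H ξ * (ENNReal.ofReal (Real.exp (-Real.pi))
          * volume (Metric.ball (0 : Euc d) 1)) := by
        rw [lintegral_mul_const _ hH, mul_comm]
    _ ≤ ∫⁻ ξ in D, H ξ * ∫⁻ ζ in D', ENNReal.ofReal (Real.exp (-Real.pi * ‖ξ - ζ‖ ^ 2)) :=
        setLIntegral_mono' hDm fun ξ hξ =>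
          mul_le_mul_right (le_setLIntegral_gaussian hd (hD ξ hξ)) _
    _ ≤ ∫⁻ ξ, H ξ * ∫⁻ ζ in D', ENNReal.ofReal (Real.exp (-Real.pi * ‖ξ - ζ‖ ^ 2)) :=
        setLIntegral_le_lintegral _ _
    _ = ∫⁻ ξ, ∫⁻ ζ in D', H ξ * ENNReal.ofReal (Real.exp (-Real.pi * ‖ξ - ζ‖ ^ 2)) := by
        refine lintegral_congr fun ξ => (lintegral_const_mul _ ?_).symm
        fun_prop
    -- After the exchange of integrals, the inner one is the Gaussian average centred at `ζ`, which
    -- is at most `M`.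
    _ = ∫⁻ ζ in D', ∫⁻ ξ, H ξ * ENNReal.ofReal (Real.exp (-Real.pi * ‖ξ - ζ‖ ^ 2)) := by
        rw [lintegral_lintegral_swap]
        exact ((hH.comp measurable_fst).mul hgm).aemeasurable
    _ ≤ ∫⁻ _ζ in D', M := lintegral_mono fun ζ => hM ζ
    _ = _ := setLIntegral_const _ _

/-- The mean square of an exponential sum with separated frequencies over an annulus of width
one. -/
lemma exists_lintegral_annulus_expSum_le (hd : 0 < d) {δ c₀ : ℝ} (hδ : 0 < δ) (hc₀ : 0 < c₀) :
    ∃ C : ℝ, 0 < C ∧ ∀ {ι : Type} (I : Finset ι) (x : ι → Euc d) (a : ι → ℂ),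
      (∀ i ∈ I, ∀ j ∈ I, i ≠ j → δ ≤ ‖x i - x j‖) → ∀ T : ℝ, c₀ ≤ T →
        ∫⁻ ξ in {ξ : Euc d | T ≤ ‖ξ‖ ∧ ‖ξ‖ ≤ T + 1}, ‖expSum I x a ξ‖ₑ ^ 2
          ≤ ENNReal.ofReal (C * T ^ (d - 1)) * ∑ i ∈ I, ‖a i‖ₑ ^ 2 := by
  obtain ⟨C, hC, hls⟩ := exists_lintegral_expSum_gaussian_le hd hδ
  obtain ⟨C', hC', hann⟩ := exists_volume_annulus_le hd hc₀
  set V := (volume (Metric.ball (0 : Euc d) 1)).toReal with hVdef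
  have hV : volume (Metric.ball (0 : Euc d) 1) = ENNReal.ofReal V :=
    (ENNReal.ofReal_toReal volume_unitBall_ne_top).symm
  have hV0 : 0 < V := ENNReal.toReal_pos volume_unitBall_ne_zero volume_unitBall_ne_top
  set m := Real.exp (-Real.pi) * V with hm
  have hm0 : 0 < m := by positivity
  refine ⟨m⁻¹ * C * C', by positivity, fun {ι} I x a hsep T hT => ?_⟩
  have hT0 : 0 < T := hc₀.trans_le hT
  have hFm : Measurable fun ξ => ‖expSum I x a ξ‖ₑ ^ 2 :=
    (continuous_expSum I x a).measurable.enorm.pow_const 2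
  have h := setLIntegral_le_of_gaussian_average_le hd hFm (hls I x a hsep)
    (D := {ξ : Euc d | T ≤ ‖ξ‖ ∧ ‖ξ‖ ≤ T + 1}) (D' := {ξ : Euc d | T - 1 ≤ ‖ξ‖ ∧ ‖ξ‖ ≤ T + 2})
    (measurableSet_annulus _ _) (fun ξ hξ ζ hζ => by
      rw [Metric.mem_ball, dist_eq_norm] at hζ
      have h1 := norm_sub_norm_le ξ ζ
      have h2 := norm_sub_norm_le ζ ξ
      rw [norm_sub_rev] at h1
      exact ⟨by linarith [hξ.1], by linarith [hξ.2]⟩)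
  rw [hV, ← ENNReal.ofReal_mul (Real.exp_pos _).le, ← hm] at h
  calc ∫⁻ ξ in {ξ : Euc d | T ≤ ‖ξ‖ ∧ ‖ξ‖ ≤ T + 1}, ‖expSum I x a ξ‖ₑ ^ 2
      = ENNReal.ofReal m⁻¹ * (ENNReal.ofReal m *
          ∫⁻ ξ in {ξ : Euc d | T ≤ ‖ξ‖ ∧ ‖ξ‖ ≤ T + 1}, ‖expSum I x a ξ‖ₑ ^ 2) := by
        rw [← mul_assoc, ← ENNReal.ofReal_mul (by positivity), inv_mul_cancel₀ hm0.ne',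
          ENNReal.ofReal_one, one_mul]
    _ ≤ ENNReal.ofReal m⁻¹ * (ENNReal.ofReal C * (∑ i ∈ I, ‖a i‖ₑ ^ 2)
          * ENNReal.ofReal (C' * T ^ (d - 1))) := by
        refine mul_le_mul_right (h.trans ?_) _
        gcongr
        exact hann T hT
    _ = _ := by
        rw [show m⁻¹ * C * C' * T ^ (d - 1) = m⁻¹ * (C * (C' * T ^ (d - 1))) by ring,
          ENNReal.ofReal_mul (inv_nonneg.2 hm0.le), ENNReal.ofReal_mul hC.le]
        ring

lemma lintegral_comp_smul_euc {f : Euc d → ℝ≥0∞} (hf : Measurable f) {T : ℝ} (hT : 0 < T) :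
    ∫⁻ ξ, f (T • ξ) = ENNReal.ofReal ((T ^ d)⁻¹) * ∫⁻ ξ, f ξ := by
  have h := Measure.map_addHaar_smul (volume : Measure (Euc d)) hT.ne'
  rw [finrank_euclideanSpace_fin, abs_of_pos (by positivity)] at h
  rw [← lintegral_map hf (by fun_prop), h, lintegral_smul_measure, smul_eq_mul]

lemma enorm_sum_mul_sq_le {ι : Type*} (s : Finset ι) (f g : ι → ℂ) :
    ‖∑ i ∈ s, f i * g i‖ₑ ^ 2 ≤ (∑ i ∈ s, ‖f i‖ₑ ^ 2) * ∑ i ∈ s, ‖g i‖ₑ ^ 2 := by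
  have h : ‖∑ i ∈ s, f i * g i‖ ^ 2 ≤ (∑ i ∈ s, ‖f i‖ ^ 2) * ∑ i ∈ s, ‖g i‖ ^ 2 := by
    calc _ ≤ (∑ i ∈ s, ‖f i‖ * ‖g i‖) ^ 2 := by
          gcongr
          exact (norm_sum_le _ _).trans (Finset.sum_le_sum fun i _ => (norm_mul _ _).le)
      _ ≤ _ := Finset.sum_mul_sq_le_sq_mul_sq _ _ _
  have h' := ENNReal.ofReal_le_ofReal h
  rw [ENNReal.ofReal_mul (by positivity), ENNReal.ofReal_sum_of_nonneg fun i _ => sq_nonneg _,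
    ENNReal.ofReal_sum_of_nonneg fun i _ => sq_nonneg _] at h'
  simpa only [ENNReal.ofReal_pow (norm_nonneg _), ofReal_norm] using h'

lemma sum_enorm_coord_sq (x : Euc d) :
    ∑ k, ‖((x k : ℝ) : ℂ)‖ₑ ^ 2 = ENNReal.ofReal (‖x‖ ^ 2) := by
  rw [EuclideanSpace.norm_sq_eq, ENNReal.ofReal_sum_of_nonneg fun i _ => sq_nonneg _]
  refine Finset.sum_congr rfl fun k _ => ?_
  rw [ENNReal.ofReal_pow (norm_nonneg _), ← ofReal_norm, Complex.norm_real]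

/-- The mean square over a sphere of an exponential sum with separated frequencies of size at most
`q`. -/
lemma exists_lintegral_sphere_expSum_le (hd : 0 < d) {δ c₀ : ℝ} (hδ : 0 < δ) (hc₀ : 0 < c₀) :
    ∃ C : ℝ, 0 < C ∧ ∀ {ι : Type} (I : Finset ι) (x : ι → Euc d) (a : ι → ℂ),
      (∀ i ∈ I, ∀ j ∈ I, i ≠ j → δ ≤ ‖x i - x j‖) → ∀ q T : ℝ, 1 ≤ q → (∀ i ∈ I, ‖x i‖ ≤ q) →
        c₀ ≤ T → ∫⁻ θ : Metric.sphere (0 : Euc d) 1, ‖expSum I x a (T • (θ : Euc d))‖ₑ ^ 2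
            ∂(volume : Measure (Euc d)).toSphere
          ≤ ENNReal.ofReal (C * q) * ∑ i ∈ I, ‖a i‖ₑ ^ 2 := by
  obtain ⟨C, hC, hann⟩ := exists_lintegral_annulus_expSum_le hd hδ hc₀
  set B := (2 * Real.pi * (1 + 1 / c₀)) ^ 2 with hB
  refine ⟨2 * C * (1 + B), by positivity, fun {ι} I x a hsep q T hq hxq hT => ?_⟩
  have hT0 : 0 < T := hc₀.trans_le hT
  have hq0 : 0 < q := by linarith
  -- The frequencies `T • x i` have size at most `T q`, so this is the radial scale on which `F`
  -- varies near the unit sphere.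
  set h := 1 / (q * T) with hh
  have hh0 : 0 < h := by positivity
  set F : Euc d → ℂ := expSum I (fun i => T • x i) a with hF
  have hFT : ∀ ξ, F ξ = expSum I x a (T • ξ) := fun ξ => by simp [hF, expSum, wave_smul_left]
  -- The radial derivative of `F` is a combination of these sums. They have the same separated
  -- frequencies, so the large sieve applies to them too; the new coefficients cost `q²` in the mean
  -- square.
  set Fk : Fin d → Euc d → ℂ := fun k => expSum I x (fun i => a i * ((x i k : ℝ) : ℂ)) with hFk
  set D := {ξ : Euc d | 1 ≤ ‖ξ‖ ∧ ‖ξ‖ ≤ 1 + h} with hD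
  set D' := {ξ : Euc d | T ≤ ‖ξ‖ ∧ ‖ξ‖ ≤ T + 1} with hD'
  have hscale : ∀ G : Euc d → ℂ, Continuous G → ∫⁻ ξ in D, ‖G (T • ξ)‖ₑ ^ 2
      ≤ ENNReal.ofReal ((T ^ d)⁻¹) * ∫⁻ ξ in D', ‖G ξ‖ₑ ^ 2 := by
    intro G hG
    have hGm : Measurable fun ξ => ‖G ξ‖ₑ ^ 2 := hG.measurable.enorm.pow_const 2
    rw [← lintegral_indicator (measurableSet_annulus _ _),
      ← lintegral_indicator (measurableSet_annulus _ _),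
      ← lintegral_comp_smul_euc (hGm.indicator (measurableSet_annulus _ _)) hT0]
    refine lintegral_mono fun ξ => ?_
    by_cases hξ : ξ ∈ D
    · have hξ' : T • ξ ∈ D' := by
        rw [hD', Set.mem_ofPred_eq, norm_smul, Real.norm_of_nonneg hT0.le]
        constructor
        · exact le_mul_of_one_le_right hT0.le hξ.1
        · calc T * ‖ξ‖ ≤ T * (1 + h) := by gcongr; exact hξ.2
            _ = T + q⁻¹ := by rw [hh]; field_simp
            _ ≤ T + 1 := by gcongr; exact inv_le_one_of_one_le₀ hq
      rw [Set.indicator_of_mem hξ, Set.indicator_of_mem hξ']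
    · rw [Set.indicator_of_notMem hξ]
      exact bot_le
  have hderiv : ∀ ξ ∈ D, ENNReal.ofReal (h ^ 2) * ‖fderiv ℝ F ξ ξ‖ₑ ^ 2
      ≤ ENNReal.ofReal (B * (q ^ 2)⁻¹) * ∑ k, ‖Fk k (T • ξ)‖ₑ ^ 2 := by
    intro ξ hξ
    have e1 : fderiv ℝ F ξ ξ = (-(2 * Real.pi * T : ℝ) * Complex.I) *
        ∑ k, ((ξ k : ℝ) : ℂ) * Fk k (T • ξ) := by
      rw [hF, fderiv_expSum_apply]
      simp only [hFk, expSum, Finset.mul_sum]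
      rw [Finset.sum_comm]
      refine Finset.sum_congr rfl fun i _ => ?_
      rw [inner_smul_left, wave_smul_left, PiLp.inner_apply]
      simp only [conj_trivial, RCLike.inner_apply]
      push_cast
      simp only [Finset.mul_sum, Finset.sum_mul, ← Finset.sum_neg_distrib]
      refine Finset.sum_congr rfl fun k _ => ?_
      ring
    have hξ2 : ‖ξ‖ ≤ 1 + 1 / c₀ := by
      refine hξ.2.trans ?_
      rw [hh]
      gcongr
      nlinarith
    rw [e1, enorm_mul, mul_pow]
    have e2 : ‖-((2 * Real.pi * T : ℝ) : ℂ) * Complex.I‖ₑ ^ 2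
        = ENNReal.ofReal ((2 * Real.pi * T) ^ 2) := by
      rw [← ofReal_norm, ENNReal.ofReal_pow (by positivity)]
      congr 2
      rw [norm_mul, norm_neg, Complex.norm_I, mul_one, Complex.norm_real,
        Real.norm_of_nonneg (by positivity)]
    calc _ ≤ ENNReal.ofReal (h ^ 2) * (ENNReal.ofReal ((2 * Real.pi * T) ^ 2) *
            (ENNReal.ofReal ((1 + 1 / c₀) ^ 2) * ∑ k, ‖Fk k (T • ξ)‖ₑ ^ 2)) := by
          rw [e2]
          gcongr
          refine (enorm_sum_mul_sq_le _ _ _).trans ?_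
          rw [sum_enorm_coord_sq]
          gcongr
      _ = _ := by
          rw [← mul_assoc, ← mul_assoc, ← ENNReal.ofReal_mul (by positivity),
            ← ENNReal.ofReal_mul (by positivity)]
          congr 2
          rw [hh, hB]
          field_simp
  have hFkm : ∀ k, Measurable fun ξ => ‖Fk k (T • ξ)‖ₑ ^ 2 := fun k => by
    have : Measurable fun ξ : Euc d => Fk k (T • ξ) :=
      ((continuous_expSum I x _).comp (continuous_const_smul T)).measurable
    exact this.enorm.pow_const 2
  have hFm : Measurable fun ξ => ‖F ξ‖ₑ ^ 2 :=
    (continuous_expSum I _ a).measurable.enorm.pow_const 2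
  have hsum : ∑ k, ∑ i ∈ I, ‖a i * ((x i k : ℝ) : ℂ)‖ₑ ^ 2
      ≤ ENNReal.ofReal (q ^ 2) * ∑ i ∈ I, ‖a i‖ₑ ^ 2 := by
    rw [Finset.sum_comm, Finset.mul_sum]
    refine Finset.sum_le_sum fun i hi => ?_
    simp only [enorm_mul, mul_pow]
    rw [← Finset.mul_sum, sum_enorm_coord_sq, mul_comm]
    gcongr
    exact hxq i hi
  set S := ∑ i ∈ I, ‖a i‖ₑ ^ 2 with hS
  have hmain := lintegral_sphere_le hd (contDiff_expSum I (fun i => T • x i) a) hh0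
    (E := Set.univ) (D := D) (measurableSet_annulus _ _) (by
      intro θ _ hθ r hr1 hr2
      rw [hD, Set.mem_ofPred_eq, norm_smul, hθ, mul_one, Real.norm_of_nonneg (by linarith)]
      exact ⟨hr1, hr2⟩)
  calc _ = ∫⁻ θ : Metric.sphere (0 : Euc d) 1, Set.univ.indicator (fun θ => ‖F θ‖ₑ ^ 2) θ
        ∂(volume : Measure (Euc d)).toSphere := by
        refine lintegral_congr fun θ => ?_
        rw [Set.indicator_univ, hFT]
    _ ≤ _ := hmain
    _ ≤ ENNReal.ofReal (2 / h) * ∫⁻ ξ in D, (‖expSum I x a (T • ξ)‖ₑ ^ 2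
          + ENNReal.ofReal (B * (q ^ 2)⁻¹) * ∑ k, ‖Fk k (T • ξ)‖ₑ ^ 2) := by
        refine mul_le_mul_right (setLIntegral_mono' (measurableSet_annulus _ _) fun ξ hξ => ?_) _
        rw [← hFT]
        exact add_le_add le_rfl (hderiv ξ hξ)
    _ = ENNReal.ofReal (2 / h) * ((∫⁻ ξ in D, ‖expSum I x a (T • ξ)‖ₑ ^ 2)
          + ENNReal.ofReal (B * (q ^ 2)⁻¹) * ∑ k, ∫⁻ ξ in D, ‖Fk k (T • ξ)‖ₑ ^ 2) := by
        simp only [← hFT]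
        rw [lintegral_add_left hFm, lintegral_const_mul' _ _ ENNReal.ofReal_ne_top,
          lintegral_finsetSum _ fun k _ => hFkm k]
    _ ≤ ENNReal.ofReal (2 / h) * (ENNReal.ofReal ((T ^ d)⁻¹) *
            (ENNReal.ofReal (C * T ^ (d - 1)) * S)
          + ENNReal.ofReal (B * (q ^ 2)⁻¹) * ∑ k, ENNReal.ofReal ((T ^ d)⁻¹) *
            (ENNReal.ofReal (C * T ^ (d - 1)) * ∑ i ∈ I, ‖a i * ((x i k : ℝ) : ℂ)‖ₑ ^ 2)) := by
        gcongr with k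
        · refine (hscale _ (continuous_expSum I x a)).trans ?_
          gcongr
          exact hann I x a hsep T hT
        · refine (hscale _ (continuous_expSum I x _)).trans ?_
          gcongr
          exact hann I x _ hsep T hT
    _ ≤ ENNReal.ofReal (2 / h) * (ENNReal.ofReal ((T ^ d)⁻¹) *
            (ENNReal.ofReal (C * T ^ (d - 1)) * S)
          + ENNReal.ofReal (B * (q ^ 2)⁻¹) * (ENNReal.ofReal ((T ^ d)⁻¹) *
            (ENNReal.ofReal (C * T ^ (d - 1)) * (ENNReal.ofReal (q ^ 2) * S)))) := by
        rw [← Finset.mul_sum, ← Finset.mul_sum]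
        gcongr
    _ = ENNReal.ofReal (2 / h) * ENNReal.ofReal ((T ^ d)⁻¹) * ENNReal.ofReal (C * T ^ (d - 1)) *
          (1 + ENNReal.ofReal (B * (q ^ 2)⁻¹) * ENNReal.ofReal (q ^ 2)) * S := by ring
    _ = _ := by
        have e : 1 + ENNReal.ofReal (B * (q ^ 2)⁻¹) * ENNReal.ofReal (q ^ 2)
            = ENNReal.ofReal (1 + B) := by
          rw [← ENNReal.ofReal_mul (by positivity), ENNReal.ofReal_add zero_le_one (by positivity),
            ENNReal.ofReal_one, mul_assoc, inv_mul_cancel₀ (by positivity), mul_one]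
        rw [e, ← ENNReal.ofReal_mul (by positivity), ← ENNReal.ofReal_mul (by positivity),
          ← ENNReal.ofReal_mul (by positivity)]
        -- Here `2 / h = 2 q T`, while rescaling and the volume of the annulus contribute `T ^ (-d)
        -- * T ^ (d - 1) = 1 / T`. The factor `q` that is left is the price of restricting to a
        -- sphere.
        congr 2
        obtain ⟨n, rfl⟩ : ∃ n, d = n + 1 := ⟨d - 1, by omega⟩
        rw [Nat.add_sub_cancel, pow_succ, hh]
        field_simp

end SphereBound

/-! ### The transform of the thickened measure and its spherical averages. -/

section SphericalAverage

variable {d : ℕ} {φ : Euc d → ℝ} {p c C q : ℝ} {A : Set (Euc d)}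

/-- Integrability is not needed: without it the Bochner integral has the default value zero. -/
lemma ofReal_integral_le_lintegral {α : Type*} [MeasurableSpace α] {μ : Measure α} {f : α → ℝ}
    (hf : ∀ x, 0 ≤ f x) : ENNReal.ofReal (∫ x, f x ∂μ) ≤ ∫⁻ x, ENNReal.ofReal (f x) ∂μ := by
  by_cases h : Integrable f μ
  · exact (ofReal_integral_eq_lintegral_ofReal h (Filter.Eventually.of_forall hf)).le
  · rw [integral_undef h, ENNReal.ofReal_zero]
    exact bot_le

lemma ofReal_sphericalAverage_le (μ : Measure (Euc d)) (t : ℝ) :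
    ENNReal.ofReal (sphericalAverage μ t) ≤ ∫⁻ θ : Metric.sphere (0 : Euc d) 1,
      ‖measureFourier μ (t • (θ : Euc d))‖ₑ ^ 2 ∂(volume : Measure (Euc d)).toSphere := by
  refine (ofReal_integral_le_lintegral fun _ => sq_nonneg _).trans (lintegral_mono fun θ => ?_)
  rw [ENNReal.ofReal_pow (norm_nonneg _), ofReal_norm]

lemma integral_thickMeasure (hd : 0 < d) (hφ : IsThickener φ) (hc : 0 < c)
    (hA : WellDistributed c C A) (hq : 0 < q) (f : Euc d → ℂ) :
    ∫ X, f X ∂thickMeasure φ p A q = ∫ X, (thickDensity φ p A q X : ℂ) * f X := by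
  rw [thickMeasure, integral_withDensity_eq_integral_toReal_smul
    (contDiff_thickDensity hd hφ hc hA hq).continuous.measurable.ennreal_ofReal
    (Filter.Eventually.of_forall fun _ => ENNReal.ofReal_lt_top)]
  refine integral_congr_ae (Filter.Eventually.of_forall fun X => ?_)
  simp only
  rw [ENNReal.toReal_ofReal (thickDensity_nonneg hd hφ hc hA hq X), Complex.real_smul]

/-- The Fourier transform of the test function, in terms of waves. -/
lemma fourier_eq_integral_wave (f : Euc d → ℂ) (ξ : Euc d) : 𝓕 f ξ = ∫ x, f x * wave x ξ := by
  rw [Real.fourier_eq']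
  refine integral_congr_ae (Filter.Eventually.of_forall fun x => ?_)
  simp only [smul_eq_mul]
  rw [wave, mul_comm]
  push_cast
  ring_nf

lemma IsThickener.integrable_mul_wave (hφ : IsThickener φ) {r : ℝ} (hr : 0 < r) (a ξ : Euc d) :
    Integrable fun x => ((dilate φ r (x - a) : ℝ) : ℂ) * wave x ξ :=
  (hφ.integrable_dilate hr a).ofReal.mul_bdd (c := 1)
    (continuous_wave_left ξ).aestronglyMeasurable
    (Filter.Eventually.of_forall fun x => by simp)

lemma integral_dilate_mul_wave {r : ℝ} (hr : 0 < r) (a ξ : Euc d) :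
    ∫ x, ((dilate φ r (x - a) : ℝ) : ℂ) * wave x ξ
      = wave a ξ * 𝓕 (fun x => (φ x : ℂ)) (r⁻¹ • ξ) := by
  rw [← integral_add_right_eq_self _ a, fourier_eq_integral_wave, ← integral_const_mul]
  have h : ∀ x, ((dilate φ r (x + a - a) : ℝ) : ℂ) * wave (x + a) ξ
      = (r : ℂ) ^ d * (fun y => wave a ξ * ((φ y : ℂ) * wave y (r⁻¹ • ξ))) (r • x) := by
    intro x
    simp only [add_sub_cancel_right, dilate]
    rw [wave_add_left, wave_smul_left, smul_smul, mul_inv_cancel₀ hr.ne', one_smul]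
    push_cast
    ring
  simp only [h]
  rw [integral_const_mul, Measure.integral_comp_smul volume
    (fun y => wave a ξ * ((φ y : ℂ) * wave y (r⁻¹ • ξ))), finrank_euclideanSpace_fin,
    abs_of_pos (by positivity), Complex.real_smul, ← mul_assoc]
  push_cast
  rw [mul_inv_cancel₀ (by exact_mod_cast (pow_pos hr d).ne'), one_mul]

/-- All bumps are translates of a single dilate of `φ`, so the transform factorises into the profile
at scale `q ^ p` and the arithmetic of `A_q` at scale `q`. -/
lemma measureFourier_thickMeasure (hd : 0 < d) (hφ : IsThickener φ) (hc : 0 < c)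
    (hA : WellDistributed c C A) (hq : 0 < q) (ξ : Euc d) :
    measureFourier (thickMeasure φ p A q) ξ = ((truncFinset A q).card : ℂ)⁻¹ *
      (𝓕 (fun x => (φ x : ℂ)) ((q ^ p)⁻¹ • ξ) *
        expSum (truncFinset A q) id (fun _ => 1) (q⁻¹ • ξ)) := by
  have h1 : measureFourier (thickMeasure φ p A q) ξ
      = ∫ X, wave X ξ ∂thickMeasure φ p A q := rfl
  have hR : 0 < q ^ p := by positivity
  rw [h1, integral_thickMeasure hd hφ hc hA hq]
  have h2 : ∀ X, (thickDensity φ p A q X : ℂ) * wave X ξ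
      = ((truncFinset A q).card : ℂ)⁻¹ * ∑ a ∈ truncFinset A q,
        ((dilate φ (q ^ p) (X - q⁻¹ • a) : ℝ) : ℂ) * wave X ξ := by
    intro X
    rw [thickDensity_eq hd hφ hc hA hq, ← Finset.sum_mul]
    simp only [dilate]
    push_cast
    ring
  simp only [h2]
  rw [integral_const_mul, integral_finsetSum _ fun a _ => hφ.integrable_mul_wave hR _ _]
  simp only [integral_dilate_mul_wave hR, expSum, Finset.mul_sum]
  refine Finset.sum_congr rfl fun a _ => ?_
  rw [wave_smul_left, id]
  ring

lemma IsThickener.exists_fourier_decay (hφ : IsThickener φ) (n : ℕ) :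
    ∃ C : ℝ, 0 < C ∧ ∀ ξ, ‖𝓕 (fun x => (φ x : ℂ)) ξ‖ ≤ C * ((1 + ‖ξ‖) ^ n)⁻¹ := by
  have hsm : ContDiff ℝ ∞ fun x => (φ x : ℂ) := Complex.ofRealCLM.contDiff.comp hφ.smooth
  have hcs : HasCompactSupport fun x => (φ x : ℂ) :=
    hφ.hasCompactSupport.comp_left (g := fun r : ℝ => (r : ℂ)) Complex.ofReal_zero
  set f : SchwartzMap (Euc d) ℂ := hcs.toSchwartzMap hsm
  have hf : ⇑(𝓕 f : SchwartzMap (Euc d) ℂ) = 𝓕 (fun x => (φ x : ℂ)) := SchwartzMap.fourier_coe f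
  set C := 2 ^ n * (((Finset.Iic (n, 0)).sup fun m => SchwartzMap.seminorm ℝ m.1 m.2) (𝓕 f : SchwartzMap (Euc d) ℂ))
  have hC : 0 ≤ C := by positivity
  refine ⟨C + 1, by positivity, fun ξ => ?_⟩
  have h := SchwartzMap.one_add_le_sup_seminorm_apply (𝕜 := ℝ) (m := (n, 0)) le_rfl le_rfl
    (𝓕 f : SchwartzMap (Euc d) ℂ) ξ
  rw [norm_iteratedFDeriv_zero, hf] at h
  rw [← div_eq_mul_inv, le_div_iff₀ (by positivity), mul_comm]
  linarith

/-- The decay of the spherical averages of the thickened measures. -/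
lemma exists_sphericalAverage_thickMeasure_le (hd : 0 < d) (hφ : IsThickener φ) (hc : 0 < c)
    (hC : 0 < C) (p : ℝ) {c₀ : ℝ} (hc₀ : 0 < c₀) (n : ℕ) : ∃ K : ℝ, 0 < K ∧
      ∀ A : Set (Euc d), WellDistributed c C A → ∀ q : ℝ, qMin d C ≤ q → ∀ t : ℝ, c₀ * q ≤ t →
        sphericalAverage (thickMeasure φ p A q) t
          ≤ K * q ^ (-(d : ℝ) + 1) * (1 + t / q ^ p) ^ (-(n : ℝ)) := by
  obtain ⟨C₁, hC₁, hdecay⟩ := hφ.exists_fourier_decay n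
  obtain ⟨C₂, hC₂, hsph⟩ := exists_lintegral_sphere_expSum_le hd hc hc₀
  have hκ := lowerDensity_pos hd hC
  refine ⟨C₁ ^ 2 * C₂ / lowerDensity d C, by positivity, fun A hA q hq t ht => ?_⟩
  have hq2 := two_le_of_qMin_le hq
  have hq0 : 0 < q := by linarith
  have ht0 : 0 < t := lt_of_lt_of_le (by positivity) ht
  set R := q ^ p with hR
  have hR0 : 0 < R := by positivity
  set N : ℝ := ((truncFinset A q).card : ℝ) with hN
  have hN0 : 0 < N := card_truncFinset_pos hd hc hC hA hq
  have hNq : lowerDensity d C * q ^ d ≤ N := lowerDensity_mul_le hd hc hC hA hq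
  set τ := t / R with hτ
  have hτ0 : 0 < τ := by positivity
  have hT : c₀ ≤ t / q := by rwa [le_div_iff₀ hq0]
  have hpt : ∀ θ : Metric.sphere (0 : Euc d) 1,
      ‖measureFourier (thickMeasure φ p A q) (t • (θ : Euc d))‖ₑ ^ 2
        ≤ ENNReal.ofReal ((N⁻¹ * (C₁ * ((1 + τ) ^ n)⁻¹)) ^ 2) *
          ‖expSum (truncFinset A q) id (fun _ => 1) ((t / q) • (θ : Euc d))‖ₑ ^ 2 := by
    intro θ
    have hθ : ‖(θ : Euc d)‖ = 1 := by simp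
    rw [measureFourier_thickMeasure hd hφ hc hA hq0, ← mul_assoc, enorm_mul, mul_pow, smul_smul,
      smul_smul, ← div_eq_inv_mul t q, ← div_eq_inv_mul t (q ^ p), ENNReal.ofReal_pow (by positivity)]
    gcongr ?_ ^ 2 * _
    rw [← ofReal_norm]
    apply ENNReal.ofReal_le_ofReal
    rw [norm_mul, norm_inv, Complex.norm_natCast]
    gcongr
    refine (hdecay _).trans (le_of_eq ?_)
    rw [norm_smul, hθ, mul_one, Real.norm_of_nonneg hτ0.le]
  have hfin : ENNReal.ofReal (sphericalAverage (thickMeasure φ p A q) t)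
      ≤ ENNReal.ofReal ((N⁻¹ * (C₁ * ((1 + τ) ^ n)⁻¹)) ^ 2 * (C₂ * q * N)) := by
    calc _ ≤ _ := ofReal_sphericalAverage_le _ _
      _ ≤ _ := lintegral_mono hpt
      _ = ENNReal.ofReal ((N⁻¹ * (C₁ * ((1 + τ) ^ n)⁻¹)) ^ 2) *
          ∫⁻ θ : Metric.sphere (0 : Euc d) 1,
            ‖expSum (truncFinset A q) id (fun _ => 1) ((t / q) • (θ : Euc d))‖ₑ ^ 2
            ∂(volume : Measure (Euc d)).toSphere := lintegral_const_mul' _ _ ENNReal.ofReal_ne_top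
      _ ≤ ENNReal.ofReal ((N⁻¹ * (C₁ * ((1 + τ) ^ n)⁻¹)) ^ 2) * (ENNReal.ofReal (C₂ * q) *
            ∑ _a ∈ truncFinset A q, ‖(1 : ℂ)‖ₑ ^ 2) := by
          gcongr
          exact hsph _ id _ (truncFinset_separated hd hc hA q) q _ (by linarith)
            (fun a ha => ((mem_truncFinset hd hc hA).1 ha).2) hT
      _ = _ := by
          have : ∑ _a ∈ truncFinset A q, ‖(1 : ℂ)‖ₑ ^ 2 = ENNReal.ofReal N := by
            simp [hN]
          rw [this, ← ENNReal.ofReal_mul (by positivity), ← ENNReal.ofReal_mul (by positivity)]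
  rw [ENNReal.ofReal_le_ofReal_iff (by positivity)] at hfin
  refine hfin.trans ?_
  have e1 : (1 + τ) ^ (-(n : ℝ)) = ((1 + τ) ^ n)⁻¹ := by
    rw [Real.rpow_neg (by positivity), Real.rpow_natCast]
  have e2 : q ^ (-(d : ℝ) + 1) = q / q ^ d := by
    rw [Real.rpow_add hq0, Real.rpow_neg hq0.le, Real.rpow_natCast, Real.rpow_one]
    field_simp
  -- Squaring doubles the decay; one copy is enough, as `n` is arbitrary.
  have e3 : ((1 + τ) ^ n)⁻¹ ^ 2 ≤ ((1 + τ) ^ n)⁻¹ :=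
    pow_le_of_le_one (by positivity) (inv_le_one_of_one_le₀ (one_le_pow₀ (by linarith)))
      two_ne_zero
  -- The sieve gives `q N`, normalisation gives `N⁻²`, and the lower bound for `N` turns `q / N`
  -- into `q ^ (1 - d)`.
  have e4 : q / N ≤ (lowerDensity d C)⁻¹ * (q / q ^ d) := by
    rw [div_le_iff₀ hN0]
    calc q = (lowerDensity d C)⁻¹ * (q / q ^ d) * (lowerDensity d C * q ^ d) := by field_simp
      _ ≤ _ := by gcongr
  rw [e1, e2]
  calc (N⁻¹ * (C₁ * ((1 + τ) ^ n)⁻¹)) ^ 2 * (C₂ * q * N)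
      = C₁ ^ 2 * C₂ * (q / N) * ((1 + τ) ^ n)⁻¹ ^ 2 := by field_simp
    _ ≤ C₁ ^ 2 * C₂ * ((lowerDensity d C)⁻¹ * (q / q ^ d)) * ((1 + τ) ^ n)⁻¹ := by gcongr
    _ = _ := by ring

end SphericalAverage

/-! ### Monomials as admissible amplitudes, uniformly in the degree. -/

section Amplitudes

variable {d : ℕ}

/-- A coordinate function, as a complex-valued continuous linear map. -/
noncomputable def coordCLM (i : Fin d) : Euc d →L[ℝ] ℂ :=
  Complex.ofRealCLM.comp (EuclideanSpace.proj i)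

@[simp] lemma coordCLM_apply (i : Fin d) (u : Euc d) : coordCLM i u = ((u i : ℝ) : ℂ) := rfl

lemma norm_coordCLM_le (i : Fin d) : ‖coordCLM i‖ ≤ 1 := by
  refine ContinuousLinearMap.opNorm_le_bound _ zero_le_one fun u => ?_
  rw [coordCLM_apply, Complex.norm_real, one_mul]
  exact PiLp.norm_apply_le u i

lemma norm_iteratedFDeriv_clm_one_le {E F : Type*} [NormedAddCommGroup E] [NormedSpace ℝ E]
    [NormedAddCommGroup F] [NormedSpace ℝ F] (L : E →L[ℝ] F) (x : E) :
    ‖iteratedFDeriv ℝ 1 L x‖ ≤ ‖L‖ := by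
  rw [norm_iteratedFDeriv_one, L.fderiv]

lemma iteratedFDeriv_clm_eq_zero {E F : Type*} [NormedAddCommGroup E] [NormedSpace ℝ E]
    [NormedAddCommGroup F] [NormedSpace ℝ F] (L : E →L[ℝ] F) {n : ℕ} (hn : 2 ≤ n) (x : E) :
    iteratedFDeriv ℝ n L x = 0 := by
  obtain ⟨k, rfl⟩ : ∃ k, n = k + 1 := ⟨n - 1, by omega⟩
  rw [← norm_eq_zero, ← norm_iteratedFDeriv_fderiv]
  have : fderiv ℝ (L : E → F) = fun _ => L := funext fun y => L.fderiv
  rw [this, iteratedFDeriv_const_of_ne (by omega : k ≠ 0)]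
  simp

/-- Multiplication by a coordinate function acts on amplitudes supported in a cube. -/
lemma norm_iteratedFDeriv_mul_coord_le {f : Euc d → ℂ} (hf : ContDiff ℝ ∞ f) {L M : ℝ}
    (hL : 0 ≤ L) (hM : 0 ≤ M) {K : ℕ → ℝ} (hK : ∀ k, 0 ≤ K k)
    (hK' : ∀ k : ℕ, (k + 1) * K k ≤ K (k + 1)) (hfL : ∀ u, f u ≠ 0 → ∀ i, |u i| ≤ L)
    (hfK : ∀ k u, ‖iteratedFDeriv ℝ k f u‖ ≤ K k * M) (i : Fin d) (k : ℕ) (u : Euc d) :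
    ‖iteratedFDeriv ℝ k (fun u => f u * ((u i : ℝ) : ℂ)) u‖ ≤ K k * (M * (L + 1)) := by
  have h0 : 0 ≤ K k * (M * (L + 1)) := mul_nonneg (hK k) (by positivity)
  -- Where `|u i| > L` the function vanishes on an open set, so all its derivatives vanish;
  -- elsewhere the coordinate is bounded by `L`.
  rcases lt_or_ge L |u i| with hu | hu
  · have hev : (fun u => f u * ((u i : ℝ) : ℂ)) =ᶠ[nhds u] fun _ => 0 := by
      have hopen : IsOpen {y : Euc d | L < |y i|} :=
        isOpen_lt continuous_const (by fun_prop)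
      filter_upwards [hopen.mem_nhds hu] with y hy
      have : f y = 0 := by
        by_contra hne
        exact absurd (hfL y hne i) (not_le.2 hy)
      rw [this, zero_mul]
    rw [(Filter.EventuallyEq.iteratedFDeriv ℝ hev k).eq_of_nhds, iteratedFDeriv_fun_zero]
    simpa using h0
  -- A coordinate has no derivatives of order two or more, so only two Leibniz terms survive. The
  -- one of order `k` in `f` is at most `K k * M * L`. The one of order `k - 1` carries the binomial
  -- factor `k`, which the factorial growth of `K` absorbs, and is at most `K k * M`. Hence the
  -- factor `L + 1`, with `K` unchanged.
  · have hleib := norm_iteratedFDeriv_mul_le (N := ∞) hf (coordCLM i).contDiff u (n := k)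
      (by exact_mod_cast le_top)
    refine hleib.trans ?_
    have hc0 : ‖iteratedFDeriv ℝ 0 (coordCLM i) u‖ ≤ L := by
      rw [norm_iteratedFDeriv_zero, coordCLM_apply, Complex.norm_real]
      exact hu
    have hc1 : ‖iteratedFDeriv ℝ 1 (coordCLM i) u‖ ≤ 1 :=
      (norm_iteratedFDeriv_clm_one_le _ _).trans (norm_coordCLM_le i)
    have hA : ((k.choose k : ℕ) : ℝ) * ‖iteratedFDeriv ℝ k f u‖ *
        ‖iteratedFDeriv ℝ (k - k) (coordCLM i) u‖ ≤ K k * M * L := by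
      rw [Nat.choose_self, Nat.cast_one, one_mul, Nat.sub_self]
      gcongr
      · exact mul_nonneg (hK k) hM
      · exact hfK k u
    rw [Finset.sum_range_succ]
    rcases k with _ | k
    · rw [Finset.sum_range_zero, zero_add]
      refine hA.trans ?_
      have := mul_nonneg (hK 0) hM
      linarith
    · rw [Finset.sum_range_succ, Finset.sum_eq_zero fun l hl => ?_, zero_add]
      · have hB : (((k + 1).choose k : ℕ) : ℝ) * ‖iteratedFDeriv ℝ k f u‖ *
            ‖iteratedFDeriv ℝ (k + 1 - k) (coordCLM i) u‖ ≤ K (k + 1) * M := by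
          rw [Nat.choose_succ_self_right, Nat.add_sub_cancel_left]
          calc _ ≤ ((k + 1 : ℕ) : ℝ) * (K k * M) * 1 := by
                gcongr
                · exact mul_nonneg (by positivity) (mul_nonneg (hK k) hM)
                · exact hfK k u
            _ = (k + 1) * K k * M := by push_cast; ring
            _ ≤ _ := by gcongr; exact hK' k
        linarith
      · rw [iteratedFDeriv_clm_eq_zero _ (by have := Finset.mem_range.1 hl; omega), norm_zero,
          mul_zero]

/-- The monomials which occur in the Taylor expansion of `exp ⟨ζ, u⟩`. -/
noncomputable def monomialFun {m : ℕ} (σ : Fin m → Fin d) (u : Euc d) : ℂ :=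
  ∏ k, ((u (σ k) : ℝ) : ℂ)

lemma contDiff_monomialFun {m : ℕ} (σ : Fin m → Fin d) : ContDiff ℝ ∞ (monomialFun σ) :=
  contDiff_prod fun k _ => (coordCLM (σ k)).contDiff

lemma exists_cutoff {L : ℝ} (hL : 0 < L) : ∃ β : Euc d → ℂ, ContDiff ℝ ∞ β ∧ HasCompactSupport β ∧
    (∀ u, (∀ i, |u i| ≤ L / 2) → β u = 1) ∧ ∀ u, β u ≠ 0 → ∀ i, |u i| ≤ L := by
  let χ : ContDiffBump (0 : ℝ) := ⟨L / 2, L, by positivity, by linarith⟩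
  have hsupp : ∀ u : Euc d, (∏ i, ((χ (u i) : ℝ) : ℂ)) ≠ 0 → ∀ i, |u i| ≤ L := by
    intro u hu i
    have hi : ((χ (u i) : ℝ) : ℂ) ≠ 0 := Finset.prod_ne_zero_iff.1 hu i (Finset.mem_univ i)
    have : u i ∈ Function.support χ := by exact_mod_cast hi
    rw [χ.support_eq, Metric.mem_ball, Real.dist_eq, sub_zero] at this
    exact this.le
  refine ⟨fun u => ∏ i, ((χ (u i) : ℝ) : ℂ), ?_, ?_, ?_, hsupp⟩
  · refine contDiff_prod fun i _ => Complex.ofRealCLM.contDiff.comp (χ.contDiff.comp ?_)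
    exact (EuclideanSpace.proj (𝕜 := ℝ) i).contDiff
  · refine HasCompactSupport.of_support_subset_isCompact
      (isCompact_closedBall (0 : Euc d) (√(∑ _i : Fin d, L ^ 2))) fun u hu => ?_
    rw [mem_closedBall_zero_iff, EuclideanSpace.norm_eq]
    refine Real.sqrt_le_sqrt (Finset.sum_le_sum fun i _ => ?_)
    rw [Real.norm_eq_abs]
    gcongr
    exact hsupp u hu i
  · intro u hu
    refine Finset.prod_eq_one fun i _ => ?_
    rw [χ.one_of_mem_closedBall (by simpa using hu i), Complex.ofReal_one]

/-- A sequence which dominates `B` and grows at least factorially. -/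
noncomputable def factorialMajorant (B : ℕ → ℝ) : ℕ → ℝ
  | 0 => B 0
  | k + 1 => max (B (k + 1)) ((k + 1) * factorialMajorant B k)

/-- The normalised products of a cutoff with the monomials are admissible amplitudes, with bounds
that do not depend on the degree. -/
lemma exists_monomial_amplitudes (d : ℕ) {L : ℝ} (hL : 0 < L) :
    ∃ (K : ℕ → ℝ) (β : Euc d → ℂ), (∀ u, (∀ i, |u i| ≤ L / 2) → β u = 1) ∧
      ∀ (m : ℕ) (σ : Fin m → Fin d),
        IsAmplitude K L fun u => (((L + 1) ^ m)⁻¹ : ℝ) • (β u * monomialFun σ u) := by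
  obtain ⟨β, hβ, hβc, hβ1, hβL⟩ := exists_cutoff (d := d) hL
  have hbd : ∀ k : ℕ, ∃ B : ℝ, ∀ u, ‖iteratedFDeriv ℝ k β u‖ ≤ B := fun k =>
    (hβc.iteratedFDeriv k).exists_bound_of_continuous
      (hβ.continuous_iteratedFDeriv (by exact_mod_cast le_top))
  choose B hB using hbd
  have hB0 : ∀ k, 0 ≤ B k := fun k => (norm_nonneg _).trans (hB k 0)
  set K := factorialMajorant B with hKdef
  have hBK : ∀ k, B k ≤ K k := by
    intro k
    cases k with
    | zero => exact le_rfl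
    | succ k => exact le_max_left _ _
  have hK : ∀ k, 0 ≤ K k := fun k => (hB0 k).trans (hBK k)
  have hK' : ∀ k : ℕ, (k + 1) * K k ≤ K (k + 1) := fun k => le_max_right _ _
  -- Induction on the degree: each coordinate multiplies the bound by `L + 1` and keeps the same
  -- sequence `K`, so that dividing by `(L + 1) ^ m` makes the bound uniform in `m`.
  have hprod : ∀ (m : ℕ) (σ : Fin m → Fin d) (k : ℕ) (u : Euc d),
      ‖iteratedFDeriv ℝ k (fun u => β u * monomialFun σ u) u‖ ≤ K k * (L + 1) ^ m := by
    intro m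
    induction m with
    | zero =>
      intro σ k u
      have : (fun u => β u * monomialFun σ u) = β := funext fun u => by simp [monomialFun]
      rw [this, pow_zero, mul_one]
      exact (hB k u).trans (hBK k)
    | succ m ih =>
      intro σ k u
      have : (fun u => β u * monomialFun σ u) = fun u =>
          (β u * monomialFun (fun k => σ k.succ) u) * ((u (σ 0) : ℝ) : ℂ) := by
        funext u
        simp only [monomialFun, Fin.prod_univ_succ]
        ring
      rw [this, pow_succ]
      exact norm_iteratedFDeriv_mul_coord_le (hβ.mul (contDiff_monomialFun _)) hL.le
        (by positivity) hK hK' (fun u hu => hβL u (left_ne_zero_of_mul hu)) (ih _) (σ 0) k u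
  refine ⟨K, β, hβ1, fun m σ => ⟨?_, fun u hu => hβL u ?_, fun k u => ?_⟩⟩
  · exact (hβ.mul (contDiff_monomialFun σ)).const_smul _
  · intro h0
    apply hu
    simp [h0]
  · have hsm : ContDiffAt ℝ k (fun u => β u * monomialFun σ u) u :=
      ((hβ.mul (contDiff_monomialFun σ)).of_le (by exact_mod_cast le_top)).contDiffAt
    have h1 := iteratedFDeriv_const_smul_apply (a := (((L + 1) ^ m)⁻¹ : ℝ)) hsm
    have h2 : (fun u => (((L + 1) ^ m)⁻¹ : ℝ) • (β u * monomialFun σ u))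
        = (((L + 1) ^ m)⁻¹ : ℝ) • fun u => β u * monomialFun σ u := rfl
    rw [h2, h1, norm_smul, Real.norm_of_nonneg (by positivity), inv_mul_le_iff₀ (by positivity),
      mul_comm]
    exact hprod m σ k u

end Amplitudes

/-! ### Cauchy–Schwarz for infinite sums in `ℝ≥0∞`. -/

section ENNRealCauchySchwarz

lemma ENNReal.two_mul_mul_le_sq_add_sq (a b : ℝ≥0∞) : 2 * (a * b) ≤ a ^ 2 + b ^ 2 := by
  wlog h : a ≤ b generalizing a b
  · rw [mul_comm a b, add_comm]
    exact this b a (le_of_not_ge h)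
  obtain ⟨e, rfl⟩ := exists_add_of_le h
  calc 2 * (a * (a + e)) ≤ 2 * (a * (a + e)) + e ^ 2 := le_self_add
    _ = a ^ 2 + (a + e) ^ 2 := by ring

/-- A weighted Cauchy–Schwarz inequality. -/
lemma ENNReal.sq_tsum_mul_le {ι : Type*} (w g : ι → ℝ≥0∞) :
    (∑' i, w i * g i) ^ 2 ≤ (∑' i, w i) * ∑' i, w i * g i ^ 2 := by
  have h1 : ∀ i k, 2 * ((w i * g i) * (w k * g k))
      ≤ w k * (w i * g i ^ 2) + w i * (w k * g k ^ 2) := by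
    intro i k
    calc 2 * ((w i * g i) * (w k * g k)) = w i * w k * (2 * (g i * g k)) := by ring
      _ ≤ w i * w k * (g i ^ 2 + g k ^ 2) := by
          gcongr
          exact ENNReal.two_mul_mul_le_sq_add_sq _ _
      _ = _ := by ring
  have h2 : 2 * (∑' i, w i * g i) ^ 2 ≤ 2 * ((∑' i, w i) * ∑' i, w i * g i ^ 2) := by
    calc 2 * (∑' i, w i * g i) ^ 2 = ∑' i, ∑' k, 2 * ((w i * g i) * (w k * g k)) := by
          simp only [ENNReal.tsum_mul_left, ENNReal.tsum_mul_right, sq]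
      _ ≤ ∑' i, ∑' k, (w k * (w i * g i ^ 2) + w i * (w k * g k ^ 2)) :=
          ENNReal.tsum_le_tsum fun i => ENNReal.tsum_le_tsum fun k => h1 i k
      _ = _ := by
          simp only [ENNReal.tsum_add, ENNReal.tsum_mul_left, ENNReal.tsum_mul_right]
          ring
  rwa [ENNReal.mul_le_mul_iff_right two_ne_zero ENNReal.ofNat_ne_top] at h2

end ENNRealCauchySchwarz

/-! ### Scaled coordinates and the tiling. -/

section Tiles

variable {d : ℕ} {t L : ℝ} {b : OrthonormalBasis (Fin d) ℝ (Euc d)}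

lemma scaledCoord_apply (t : ℝ) (b : OrthonormalBasis (Fin d) ℝ (Euc d)) (X : Euc d) (i : Fin d) :
    scaledCoord t b X i = (if i.val = 0 then 1 else √t) * inner ℝ (b i) X := rfl

/-- The scaled coordinates as a continuous linear map. -/
noncomputable def scaledCoordCLM (t : ℝ) (b : OrthonormalBasis (Fin d) ℝ (Euc d)) :
    Euc d →L[ℝ] Euc d :=
  LinearMap.toContinuousLinearMap
    { toFun := scaledCoord t b
      map_add' := fun X Y => by
        ext i
        simp only [scaledCoord_apply, PiLp.add_apply, inner_add_right]
        ring
      map_smul' := fun r X => by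
        ext i
        simp only [scaledCoord_apply, PiLp.smul_apply, inner_smul_right, smul_eq_mul,
          RingHom.id_apply]
        ring }

@[simp] lemma scaledCoordCLM_apply (X : Euc d) : scaledCoordCLM t b X = scaledCoord t b X := rfl

lemma continuous_scaledCoord : Continuous (scaledCoord t b) := (scaledCoordCLM t b).continuous

lemma norm_scaledCoordCLM_le : ‖scaledCoordCLM t b‖ ≤ 1 + √t := by
  refine ContinuousLinearMap.opNorm_le_bound _ (by positivity) fun X => ?_
  rw [scaledCoordCLM_apply, EuclideanSpace.norm_eq]
  have hsum : ∑ i, ‖scaledCoord t b X i‖ ^ 2 ≤ ((1 + √t) * ‖X‖) ^ 2 := by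
    rw [mul_pow, ← b.sum_sq_norm_inner_right X, Finset.mul_sum]
    refine Finset.sum_le_sum fun i _ => ?_
    rw [scaledCoord_apply, norm_mul, mul_pow]
    have h0 := Real.sqrt_nonneg t
    gcongr
    split_ifs
    · rw [norm_one]; linarith
    · rw [Real.norm_of_nonneg h0]; linarith
  calc _ ≤ √(((1 + √t) * ‖X‖) ^ 2) := Real.sqrt_le_sqrt hsum
    _ = _ := Real.sqrt_sq (by positivity)

lemma mem_tile {j : Fin d → ℤ} {X : Euc d} : X ∈ tile t L b j ↔
    ∀ i, -(L / 2) ≤ scaledCoord t b X i - L * j i ∧ scaledCoord t b X i - L * j i < L / 2 :=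
  Iff.rfl

lemma measurableSet_tile (j : Fin d → ℤ) : MeasurableSet (tile t L b j) := by
  have h : ∀ i, Measurable fun X => scaledCoord t b X i - L * j i := fun i =>
    (((EuclideanSpace.proj (𝕜 := ℝ) i).continuous.comp continuous_scaledCoord).sub
      continuous_const).measurable
  simp only [tile, Set.ofPred_forall]
  refine MeasurableSet.iInter fun i => ?_
  exact (measurableSet_le measurable_const (h i)).inter (measurableSet_lt (h i) measurable_const)

lemma pairwise_disjoint_tile (hL : 0 < L) :
    Pairwise (Function.onFun Disjoint fun j : Fin d → ℤ => tile t L b j) := by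
  intro j j' hjj'
  rw [Function.onFun, Set.disjoint_left]
  intro X hX hX'
  apply hjj'
  funext i
  obtain ⟨h1, h2⟩ := mem_tile.1 hX i
  obtain ⟨h3, h4⟩ := mem_tile.1 hX' i
  have h5 : L * ((j i : ℝ) - j' i) < L * 1 := by linarith
  have h6 : L * ((j' i : ℝ) - j i) < L * 1 := by linarith
  have h7 := lt_of_mul_lt_mul_left h5 hL.le
  have h8 := lt_of_mul_lt_mul_left h6 hL.le
  have h9 : (j i : ℝ) < (j' i : ℝ) + 1 := by linarith
  have h10 : (j' i : ℝ) < (j i : ℝ) + 1 := by linarith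
  norm_cast at h9 h10
  omega

lemma exists_mem_tile (hL : 0 < L) (X : Euc d) : ∃ j, X ∈ tile t L b j := by
  refine ⟨fun i => ⌊(scaledCoord t b X i + L / 2) / L⌋, mem_tile.2 fun i => ?_⟩
  have h1 := Int.floor_le ((scaledCoord t b X i + L / 2) / L)
  have h2 := Int.lt_floor_add_one ((scaledCoord t b X i + L / 2) / L)
  rw [le_div_iff₀ hL] at h1
  rw [div_lt_iff₀ hL] at h2
  constructor <;> linarith

/-- The indices of the tiles which may meet the support of the measures under consideration. -/
noncomputable def tileIndices (d : ℕ) (t : ℝ) : Finset (Fin d → ℤ) :=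
  (Fintype.piFinset fun _ : Fin d => Finset.Icc (-⌊√t + 1⌋) ⌊√t + 1⌋).filter
    fun j => ∀ i : Fin d, i.val = 0 → j i = 0

lemma abs_le_of_mem_tileIndices {j : Fin d → ℤ} (hj : j ∈ tileIndices d t) (i : Fin d) :
    |(j i : ℝ)| ≤ √t + 1 := by
  have h := Finset.mem_Icc.1 (Fintype.mem_piFinset.1 (Finset.mem_filter.1 hj).1 i)
  have h1 : |j i| ≤ ⌊√t + 1⌋ := abs_le.2 h
  calc |(j i : ℝ)| = ((|j i| : ℤ) : ℝ) := by push_cast; rfl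
    _ ≤ (⌊√t + 1⌋ : ℝ) := by exact_mod_cast h1
    _ ≤ _ := Int.floor_le _

lemma eq_zero_of_mem_tileIndices {j : Fin d → ℤ} (hj : j ∈ tileIndices d t) {i : Fin d}
    (hi : i.val = 0) : j i = 0 := (Finset.mem_filter.1 hj).2 i hi

/-- The unscaled first coordinate is at most `3 / 2 < L / 2`, which forces index zero there. In
every direction `|j i| L ≤ (3 / 2) (1 + √t) + L / 2 ≤ (√t + 1) L`, because `L ≥ 4`. -/
lemma mem_tileIndices (hL : 4 ≤ L) {X : Euc d} (hX : ‖X‖ ≤ 3 / 2) {j : Fin d → ℤ}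
    (hj : X ∈ tile t L b j) : j ∈ tileIndices d t := by
  have hin : ∀ i, |inner ℝ (b i) X| ≤ 3 / 2 := fun i => by
    have := abs_real_inner_le_norm (b i) X
    rw [b.norm_eq_one, one_mul] at this
    exact this.trans hX
  have h0 := Real.sqrt_nonneg t
  refine Finset.mem_filter.2 ⟨Fintype.mem_piFinset.2 fun i => ?_, fun i hi => ?_⟩
  · have hu : |scaledCoord t b X i| ≤ (1 + √t) * (3 / 2) := by
      rw [scaledCoord_apply, abs_mul]
      gcongr
      · split_ifs
        · rw [abs_one]; linarith
        · rw [abs_of_nonneg h0]; linarith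
      · exact hin i
    obtain ⟨h1, h2⟩ := mem_tile.1 hj i
    rw [abs_le] at hu
    rw [Finset.mem_Icc, ← abs_le, Int.le_floor]
    push_cast
    have h3 : |(j i : ℝ)| * L ≤ (√t + 1) * L := by
      rw [← abs_of_pos (by linarith : 0 < L), ← abs_mul, abs_of_pos (by linarith : 0 < L)]
      have h4 : √t * 4 ≤ √t * L := by gcongr
      rw [abs_le]
      constructor <;> linarith
    exact le_of_mul_le_mul_right h3 (by linarith)
  · obtain ⟨h1, h2⟩ := mem_tile.1 hj i
    rw [scaledCoord_apply, if_pos hi, one_mul] at h1 h2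
    have h3 := abs_le.1 (hin i)
    have h5 : L * (j i : ℝ) < L * 1 := by linarith
    have h6 : L * (-1) < L * (j i : ℝ) := by linarith
    have h7 := lt_of_mul_lt_mul_left h5 (by linarith)
    have h8 := lt_of_mul_lt_mul_left h6 (by linarith)
    norm_cast at h7 h8
    omega

lemma integral_eq_sum_tile (hL : 4 ≤ L) {μ : Measure (Euc d)}
    (hμ : μ (Metric.closedBall 0 (3 / 2))ᶜ = 0) {f : Euc d → ℂ} (hf : Integrable f μ) :
    ∫ X, f X ∂μ = ∑ j ∈ tileIndices d t, ∫ X in tile t L b j, f X ∂μ := by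
  rw [← integral_biUnion_finset _ (fun j _ => measurableSet_tile j)
    (fun j _ j' _ h => pairwise_disjoint_tile (by linarith) h) fun j _ => hf.integrableOn]
  rw [Measure.restrict_eq_self_of_ae_mem]
  have hae : ∀ᵐ X ∂μ, X ∈ Metric.closedBall (0 : Euc d) (3 / 2) := hμ
  filter_upwards [hae] with X hX
  obtain ⟨j, hj⟩ := exists_mem_tile (t := t) (b := b) (by linarith : 0 < L) X
  exact Set.mem_iUnion₂.2 ⟨j, mem_tileIndices hL (by simpa using hX) hj, hj⟩

end Tiles

/-! ### Almost orthogonality of the tiles on a cap. -/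

section Cap

variable {d : ℕ}

/-- The lattice vector with integral coordinates `j` in the frame `b`. -/
noncomputable def latticeVec (b : OrthonormalBasis (Fin d) ℝ (Euc d)) (j : Fin d → ℤ) : Euc d :=
  ∑ i, (j i : ℝ) • b i

lemma inner_latticeVec (b : OrthonormalBasis (Fin d) ℝ (Euc d)) (j : Fin d → ℤ) (ξ : Euc d) :
    inner ℝ (latticeVec b j) ξ = ∑ i, (j i : ℝ) * inner ℝ (b i) ξ := by
  rw [latticeVec, sum_inner]
  exact Finset.sum_congr rfl fun i _ => by rw [inner_smul_left]; rfl

lemma one_le_norm_latticeVec_sub (b : OrthonormalBasis (Fin d) ℝ (Euc d)) {j j' : Fin d → ℤ}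
    (h : j ≠ j') : 1 ≤ ‖latticeVec b j - latticeVec b j'‖ := by
  obtain ⟨i, hi⟩ := Function.ne_iff.1 h
  have h1 : ∀ k : Fin d → ℤ, inner ℝ (b i) (latticeVec b k) = (k i : ℝ) := fun k =>
    b.orthonormal.inner_right_fintype _ i
  have h2 := abs_real_inner_le_norm (b i) (latticeVec b j - latticeVec b j')
  rw [inner_sub_right, h1, h1, b.norm_eq_one, one_mul] at h2
  refine le_trans ?_ h2
  have : 1 ≤ |j i - j' i| := Int.one_le_abs (sub_ne_zero.2 hi)
  exact_mod_cast this

/-- The functions associated with different tiles are almost orthogonal on a cap of radius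
`t^{-1/2}`. -/
lemma exists_lintegral_cap_expSum_le (hd : 0 < d) {L c₁ t₀ : ℝ} (hL : 1 ≤ L) (hc₁ : 0 < c₁)
    (ht₀ : 0 < t₀) : ∃ C : ℝ, 0 < C ∧ ∀ t : ℝ, t₀ ≤ t →
      ∀ (b : OrthonormalBasis (Fin d) ℝ (Euc d)) (w : Euc d),
        (∀ i : Fin d, i.val = 0 → b i = w) → ∀ a : (Fin d → ℤ) → ℂ,
        ∫⁻ θ : Metric.sphere (0 : Euc d) 1, (Metric.ball w (c₁ / √t)).indicator (fun θ =>
            ‖expSum (tileIndices d t) (fun j => (L * √t) • latticeVec b j) a θ‖ₑ ^ 2) θ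
            ∂(volume : Measure (Euc d)).toSphere
          ≤ ENNReal.ofReal (C * (√t / √t ^ d)) * ∑ j ∈ tileIndices d t, ‖a j‖ₑ ^ 2 := by
  obtain ⟨C, hC, hls⟩ := exists_lintegral_expSum_gaussian_le hd (δ := 1) one_pos
  have hst₀ : 0 < √t₀ := Real.sqrt_pos.2 ht₀
  set C₃ := 1 + 1 / √t₀ with hC₃
  set B := (2 * Real.pi * L * (c₁ + 1)) ^ 2 with hB
  -- The minimum over the enlarged cap of the rescaled Gaussian centred at `w`. In `c₁ + 1`, the
  -- `c₁` is the radius of the cap and the `1` the radial thickness, both in units of `1 / √t`.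
  set m := Real.exp (-Real.pi * (c₁ + 1) ^ 2) with hm
  have hm0 : 0 < m := Real.exp_pos _
  refine ⟨2 * (m⁻¹ * C) * (1 + d * B * (d * C₃ ^ 2)), by positivity, fun t ht b w hbw a => ?_⟩
  have ht0 : 0 < t := ht₀.trans_le ht
  set r := √t with hr
  have hr0 : 0 < r := Real.sqrt_pos.2 ht0
  have hr2 : r ^ 2 = t := Real.sq_sqrt ht0.le
  set J := tileIndices d t with hJ
  set S := ∑ j ∈ J, ‖a j‖ₑ ^ 2 with hS
  set x : (Fin d → ℤ) → Euc d := fun j => L • latticeVec b j with hx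
  have hsep : ∀ j ∈ J, ∀ j' ∈ J, j ≠ j' → 1 ≤ ‖x j - x j'‖ := by
    intro j _ j' _ h
    rw [hx, ← smul_sub, norm_smul, Real.norm_of_nonneg (by linarith)]
    nlinarith [one_le_norm_latticeVec_sub b h]
  set lam : (Fin d → ℤ) → Euc d := fun j => (L * r) • latticeVec b j with hlam
  have hscale : ∀ (a' : (Fin d → ℤ) → ℂ) (ξ : Euc d), expSum J lam a' ξ = expSum J x a' (r • ξ) := by
    intro a' ξ
    refine Finset.sum_congr rfl fun j _ => ?_
    rw [hlam, hx, ← wave_smul_left, smul_smul, mul_comm r L]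
  -- On the cap the phases vary radially at rate `O(√t)`, not `O(t)`: the frequencies have size up
  -- to about `t`, but they are orthogonal to `w`.
  set h := 1 / r with hh
  have hh0 : 0 < h := by positivity
  set D := Metric.ball w ((c₁ + 1) / r) with hD
  have hloc : ∀ a' : (Fin d → ℤ) → ℂ, ∫⁻ ξ in D, ‖expSum J lam a' ξ‖ₑ ^ 2
      ≤ ENNReal.ofReal (m⁻¹ * C * (r ^ d)⁻¹) * ∑ j ∈ J, ‖a' j‖ₑ ^ 2 := by
    intro a'
    set G : Euc d → ℝ≥0∞ := fun ζ => ‖expSum J x a' ζ‖ₑ ^ 2 *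
      ENNReal.ofReal (Real.exp (-Real.pi * ‖ζ - r • w‖ ^ 2)) with hG
    have hGm : Measurable G := by
      have h1 : Measurable fun ζ => ‖expSum J x a' ζ‖ₑ ^ 2 :=
        (continuous_expSum J x a').measurable.enorm.pow_const 2
      exact h1.mul (by fun_prop)
    calc ∫⁻ ξ in D, ‖expSum J lam a' ξ‖ₑ ^ 2
        ≤ ∫⁻ ξ in D, ENNReal.ofReal m⁻¹ * G (r • ξ) := by
          refine setLIntegral_mono' measurableSet_ball fun ξ hξ => ?_
          rw [hscale, hG]
          have hξ' : ‖ξ - w‖ < (c₁ + 1) / r := by rwa [← dist_eq_norm]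
          have h1 : m ≤ Real.exp (-Real.pi * ‖r • ξ - r • w‖ ^ 2) := by
            rw [hm, Real.exp_le_exp, ← smul_sub, norm_smul, Real.norm_of_nonneg hr0.le]
            have h2 : r * ‖ξ - w‖ ≤ c₁ + 1 := by
              rw [mul_comm, ← le_div_iff₀ hr0]; exact hξ'.le
            have h3 : (r * ‖ξ - w‖) ^ 2 ≤ (c₁ + 1) ^ 2 := by gcongr
            nlinarith [Real.pi_pos]
          calc _ = ENNReal.ofReal m⁻¹ * (‖expSum J x a' (r • ξ)‖ₑ ^ 2 * ENNReal.ofReal m) := by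
                rw [mul_left_comm, ← ENNReal.ofReal_mul (by positivity),
                  inv_mul_cancel₀ hm0.ne', ENNReal.ofReal_one, mul_one]
            _ ≤ _ := mul_le_mul_right (mul_le_mul_right (ENNReal.ofReal_le_ofReal h1) _) _
      _ ≤ ∫⁻ ξ, ENNReal.ofReal m⁻¹ * G (r • ξ) := setLIntegral_le_lintegral _ _
      _ = ENNReal.ofReal m⁻¹ * (ENNReal.ofReal ((r ^ d)⁻¹) * ∫⁻ ζ, G ζ) := by
          rw [lintegral_const_mul' _ _ ENNReal.ofReal_ne_top, lintegral_comp_smul_euc hGm hr0]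
      _ ≤ ENNReal.ofReal m⁻¹ * (ENNReal.ofReal ((r ^ d)⁻¹) *
            (ENNReal.ofReal C * ∑ j ∈ J, ‖a' j‖ₑ ^ 2)) := by
          gcongr
          exact hls J x a' hsep (r • w)
      _ = _ := by
          rw [mul_assoc m⁻¹, mul_comm C, ENNReal.ofReal_mul (by positivity),
            ENNReal.ofReal_mul (by positivity)]
          ring
  set ai : Fin d → (Fin d → ℤ) → ℂ := fun i j => a j * ((j i : ℝ) : ℂ) with hai
  have hderiv : ∀ ξ ∈ D, ENNReal.ofReal (h ^ 2) * ‖fderiv ℝ (expSum J lam a) ξ ξ‖ₑ ^ 2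
      ≤ ENNReal.ofReal (h ^ 2 * (d * B)) * ∑ i, ‖expSum J lam (ai i) ξ‖ₑ ^ 2 := by
    intro ξ hξ
    have hξ' : ‖ξ - w‖ < (c₁ + 1) / r := by rwa [← dist_eq_norm]
    -- The first direction drops out because the first index of a tile is zero. In the other
    -- directions `b i` is orthogonal to `w`, so `√t ⟨b i, ξ⟩` is at most `c₁ + 1`; this bounds `κ`.
    -- The indices themselves go into the coefficients `ai`.
    set κ : Fin d → ℂ := fun i => if i.val = 0 then 0 else
      -(2 * Real.pi * L * (r * inner ℝ (b i) ξ) : ℝ) * Complex.I with hκ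
    have e1 : fderiv ℝ (expSum J lam a) ξ ξ = ∑ i, κ i * expSum J lam (ai i) ξ := by
      rw [fderiv_expSum_apply]
      simp only [expSum, Finset.mul_sum]
      rw [Finset.sum_comm]
      refine Finset.sum_congr rfl fun j hj => ?_
      have e2 : inner ℝ (lam j) ξ = ∑ i, L * r * ((j i : ℝ) * inner ℝ (b i) ξ) := by
        rw [hlam, inner_smul_left, inner_latticeVec, Finset.mul_sum]
        rfl
      rw [e2]
      push_cast
      simp only [Finset.mul_sum, Finset.sum_mul, ← Finset.sum_neg_distrib]
      refine Finset.sum_congr rfl fun i _ => ?_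
      simp only [hκ, hai]
      split_ifs with hi
      · rw [eq_zero_of_mem_tileIndices hj hi]
        simp
      · push_cast
        ring
    have e3 : ∀ i, ‖κ i‖ₑ ^ 2 ≤ ENNReal.ofReal B := by
      intro i
      rw [← ofReal_norm, ← ENNReal.ofReal_pow (norm_nonneg _)]
      apply ENNReal.ofReal_le_ofReal
      rw [hB]
      gcongr
      simp only [hκ]
      split_ifs with hi
      · rw [norm_zero]; positivity
      · rw [norm_mul, norm_neg, Complex.norm_I, mul_one, Complex.norm_real, norm_mul,
          Real.norm_of_nonneg (by positivity)]
        gcongr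
        have horth : inner ℝ (b i) w = 0 := by
          have hd0 : (⟨0, hd⟩ : Fin d).val = 0 := rfl
          rw [← hbw ⟨0, hd⟩ hd0]
          exact b.orthonormal.inner_eq_zero fun h => hi (by rw [h])
        have e4 : inner ℝ (b i) ξ = inner ℝ (b i) (ξ - w) := by
          rw [inner_sub_right, horth, sub_zero]
        have e5 := abs_real_inner_le_norm (b i) (ξ - w)
        rw [b.norm_eq_one, one_mul] at e5
        rw [norm_mul, Real.norm_of_nonneg hr0.le, Real.norm_eq_abs, e4]
        calc r * |inner ℝ (b i) (ξ - w)| ≤ r * ((c₁ + 1) / r) := by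
              gcongr
              exact e5.trans hξ'.le
          _ = c₁ + 1 := by field_simp
    rw [e1, ENNReal.ofReal_mul (by positivity), mul_assoc]
    gcongr
    refine (enorm_sum_mul_sq_le _ _ _).trans ?_
    gcongr
    refine (Finset.sum_le_sum fun i _ => e3 i).trans (le_of_eq ?_)
    rw [Finset.sum_const, Finset.card_univ, Fintype.card_fin, nsmul_eq_mul,
      ENNReal.ofReal_mul (by positivity), ENNReal.ofReal_natCast]
  have hsum : ∑ i, ∑ j ∈ J, ‖ai i j‖ₑ ^ 2 ≤ ENNReal.ofReal (d * (C₃ ^ 2 * t)) * S := by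
    have h1 : ∀ i, ∑ j ∈ J, ‖ai i j‖ₑ ^ 2 ≤ ENNReal.ofReal (C₃ ^ 2 * t) * S := by
      intro i
      rw [hS, Finset.mul_sum]
      refine Finset.sum_le_sum fun j hj => ?_
      rw [hai, enorm_mul, mul_pow, mul_comm]
      gcongr
      rw [← ofReal_norm, ← ENNReal.ofReal_pow (norm_nonneg _), ← hr2, ← mul_pow]
      apply ENNReal.ofReal_le_ofReal
      gcongr
      rw [Complex.norm_real, Real.norm_eq_abs]
      refine (abs_le_of_mem_tileIndices hj i).trans ?_
      have h2 : √t₀ ≤ r := Real.sqrt_le_sqrt ht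
      have h3 : 1 ≤ 1 / √t₀ * r := by
        rw [one_div, ← div_eq_inv_mul, one_le_div hst₀]
        exact h2
      rw [hC₃, add_mul, one_mul]
      linarith
    refine (Finset.sum_le_sum fun i _ => h1 i).trans (le_of_eq ?_)
    rw [Finset.sum_const, Finset.card_univ, Fintype.card_fin, nsmul_eq_mul,
      ENNReal.ofReal_mul (by positivity : (0 : ℝ) ≤ d), ENNReal.ofReal_natCast, mul_assoc]
  have hFm : ∀ a' : (Fin d → ℤ) → ℂ, Measurable fun ξ => ‖expSum J lam a' ξ‖ₑ ^ 2 := fun a' =>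
    (continuous_expSum J lam a').measurable.enorm.pow_const 2
  have hmain := lintegral_sphere_le hd (contDiff_expSum J lam a) hh0
    (E := Metric.ball w (c₁ / r)) (D := D) measurableSet_ball (by
      intro θ hθ hθ1 ρ h1 h2
      rw [Metric.mem_ball, dist_eq_norm] at hθ
      rw [hD, Metric.mem_ball, dist_eq_norm]
      calc ‖ρ • θ - w‖ = ‖(θ - w) + (ρ - 1) • θ‖ := by
            congr 1
            rw [sub_smul, one_smul]
            abel
        _ ≤ ‖θ - w‖ + ‖(ρ - 1) • θ‖ := norm_add_le _ _
        _ < c₁ / r + 1 / r := by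
            rw [norm_smul, hθ1, mul_one, Real.norm_of_nonneg (by linarith)]
            linarith
        _ = _ := by rw [add_div])
  calc _ ≤ _ := hmain
    _ ≤ ENNReal.ofReal (2 / h) * ∫⁻ ξ in D, (‖expSum J lam a ξ‖ₑ ^ 2
          + ENNReal.ofReal (h ^ 2 * (d * B)) * ∑ i, ‖expSum J lam (ai i) ξ‖ₑ ^ 2) := by
        refine mul_le_mul_right (setLIntegral_mono' measurableSet_ball fun ξ hξ => ?_) _
        exact add_le_add le_rfl (hderiv ξ hξ)
    _ = ENNReal.ofReal (2 / h) * ((∫⁻ ξ in D, ‖expSum J lam a ξ‖ₑ ^ 2)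
          + ENNReal.ofReal (h ^ 2 * (d * B)) * ∑ i, ∫⁻ ξ in D, ‖expSum J lam (ai i) ξ‖ₑ ^ 2) := by
        rw [lintegral_add_left (hFm a), lintegral_const_mul' _ _ ENNReal.ofReal_ne_top,
          lintegral_finsetSum _ fun i _ => hFm (ai i)]
    _ ≤ ENNReal.ofReal (2 / h) * (ENNReal.ofReal (m⁻¹ * C * (r ^ d)⁻¹) * S
          + ENNReal.ofReal (h ^ 2 * (d * B)) *
            (ENNReal.ofReal (m⁻¹ * C * (r ^ d)⁻¹) * (ENNReal.ofReal (d * (C₃ ^ 2 * t)) * S))) := by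
        gcongr
        · exact hloc a
        · refine (Finset.sum_le_sum fun i _ => hloc (ai i)).trans ?_
          rw [← Finset.mul_sum]
          gcongr
    _ = ENNReal.ofReal (2 / h) * ENNReal.ofReal (m⁻¹ * C * (r ^ d)⁻¹) *
          (1 + ENNReal.ofReal (h ^ 2 * (d * B)) * ENNReal.ofReal (d * (C₃ ^ 2 * t))) * S := by
        ring
    _ = _ := by
        have e : 1 + ENNReal.ofReal (h ^ 2 * (d * B)) * ENNReal.ofReal (d * (C₃ ^ 2 * t))
            = ENNReal.ofReal (1 + d * B * (d * C₃ ^ 2)) := by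
          rw [← ENNReal.ofReal_mul (by positivity), ENNReal.ofReal_add zero_le_one (by positivity),
            ENNReal.ofReal_one]
          congr 2
          rw [hh, ← hr2]
          field_simp
        rw [e, ← ENNReal.ofReal_mul (by positivity), ← ENNReal.ofReal_mul (by positivity)]
        congr 2
        rw [hh]
        field_simp

end Cap

/-! ### Multinomial expansion of the exponential, integrated term by term. -/

section Taylor

variable {d : ℕ}

lemma HasSum.of_eq {ι : Type*} {f g : ι → ℂ} {x y : ℂ} (h : HasSum f x) (hfg : ∀ i, g i = f i)
    (hxy : y = x) : HasSum g y := by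
  rw [hxy, funext hfg]
  exact h

/-- The coefficient `z^σ / m!` in the multinomial expansion of the exponential. -/
noncomputable def expCoeff (z : Fin d → ℂ) (s : Σ m : ℕ, (Fin m → Fin d)) : ℂ :=
  (s.1.factorial : ℂ)⁻¹ * ∏ k, z (s.2 k)

lemma norm_expCoeff_le {z : Fin d → ℂ} {ρ : ℝ} (hz : ∀ i, ‖z i‖ ≤ ρ)
    (s : Σ m : ℕ, (Fin m → Fin d)) : ‖expCoeff z s‖ ≤ (s.1.factorial : ℝ)⁻¹ * ρ ^ s.1 := by
  rw [expCoeff, norm_mul, norm_inv, Complex.norm_natCast, norm_prod]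
  gcongr
  calc _ ≤ ∏ _k : Fin s.1, ρ := Finset.prod_le_prod (fun _ _ => norm_nonneg _) fun k _ => hz _
    _ = _ := by simp

/-- There are `d ^ m` index maps of degree `m`, so grouping by degree gives the exponential series
at `d * ρ`. -/
lemma summable_expCoeff_bound (d : ℕ) {ρ : ℝ} (hρ : 0 ≤ ρ) :
    Summable fun s : Σ m : ℕ, (Fin m → Fin d) => (s.1.factorial : ℝ)⁻¹ * ρ ^ s.1 := by
  rw [summable_sigma_of_nonneg fun s => by positivity]
  refine ⟨fun m => Summable.of_finite, ?_⟩
  refine (Real.summable_pow_div_factorial (d * ρ)).congr fun m => ?_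
  rw [tsum_fintype]
  simp only [Finset.sum_const, Finset.card_univ, Fintype.card_fun, Fintype.card_fin, nsmul_eq_mul]
  push_cast
  rw [mul_pow]
  ring

/-- Indexing by maps `Fin m → Fin d` instead of exponents expands `(∑ z i) ^ m` without multinomial
coefficients. Absolute summability permits regrouping by degree. -/
lemma hasSum_expCoeff (z : Fin d → ℂ) : HasSum (expCoeff z) (Complex.exp (∑ i, z i)) := by
  have hz : ∀ i, ‖z i‖ ≤ ∑ i, ‖z i‖ := fun i =>
    Finset.single_le_sum (f := fun i => ‖z i‖) (fun _ _ => norm_nonneg _) (Finset.mem_univ i)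
  have hs : Summable (expCoeff z) := Summable.of_norm_bounded
    (summable_expCoeff_bound d (Finset.sum_nonneg fun _ _ => norm_nonneg _))
    (norm_expCoeff_le hz)
  have h := NormedSpace.exp_series_hasSum_exp' (𝕂 := ℂ) (∑ i, z i)
  rw [← Complex.exp_eq_exp_ℂ] at h
  have h2 := hs.hasSum.sigma fun m => hasSum_fintype _
  refine hs.hasSum.of_eq (fun _ => rfl) (h.unique (h2.of_eq (fun m => ?_) rfl))
  rw [smul_eq_mul]
  simp only [expCoeff]
  rw [← Finset.mul_sum, Finset.sum_pow', Fintype.piFinset_univ]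

lemma norm_monomialFun_le {m : ℕ} (σ : Fin m → Fin d) {u : Euc d} {ℓ : ℝ} (hu : ∀ i, |u i| ≤ ℓ) :
    ‖monomialFun σ u‖ ≤ ℓ ^ m := by
  rw [monomialFun, norm_prod]
  calc _ ≤ ∏ _k : Fin m, ℓ := Finset.prod_le_prod (fun _ _ => norm_nonneg _) fun k _ => by
        rw [Complex.norm_real]; exact hu _
    _ = _ := by simp

lemma expCoeff_mul (z : Fin d → ℂ) (u : Euc d) (s : Σ m : ℕ, (Fin m → Fin d)) :
    expCoeff (fun i => z i * ((u i : ℝ) : ℂ)) s = expCoeff z s * monomialFun s.2 u := by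
  rw [expCoeff, expCoeff, monomialFun, Finset.prod_mul_distrib, mul_assoc]

/-- Almost everywhere a term of degree `m` is at most `(ρ ℓ) ^ m / m!`, with `ρ = ∑ ‖z i‖`. This is
summable and `ν` is finite, so sum and integral commute. -/
lemma hasSum_integral_expCoeff {ν : Measure (Euc d)} [IsFiniteMeasure ν] {v : Euc d → Euc d}
    (hv : Continuous v) {e : Euc d → ℂ} (he : Continuous e) (he1 : ∀ X, ‖e X‖ ≤ 1) {ℓ : ℝ}
    (hℓ : 0 ≤ ℓ) (hvℓ : ∀ᵐ X ∂ν, ∀ i, |v X i| ≤ ℓ) (z : Fin d → ℂ) :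
    HasSum (fun s => expCoeff z s * ∫ X, monomialFun s.2 (v X) * e X ∂ν)
      (∫ X, Complex.exp (∑ i, z i * ((v X i : ℝ) : ℂ)) * e X ∂ν) := by
  set ρ := ∑ i, ‖z i‖ with hρ
  have hz : ∀ i, ‖z i‖ ≤ ρ := fun i =>
    Finset.single_le_sum (f := fun i => ‖z i‖) (fun _ _ => norm_nonneg _) (Finset.mem_univ i)
  have hρ0 : 0 ≤ ρ := Finset.sum_nonneg fun _ _ => norm_nonneg _
  set F : (Σ m : ℕ, (Fin m → Fin d)) → Euc d → ℂ := fun s X =>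
    expCoeff z s * (monomialFun s.2 (v X) * e X) with hF
  have hFb : ∀ s, ∀ᵐ X ∂ν, ‖F s X‖ ≤ (s.1.factorial : ℝ)⁻¹ * (ρ * ℓ) ^ s.1 := by
    intro s
    filter_upwards [hvℓ] with X hX
    calc ‖F s X‖ = ‖expCoeff z s‖ * (‖monomialFun s.2 (v X)‖ * ‖e X‖) := by
          rw [hF, norm_mul, norm_mul]
      _ ≤ ((s.1.factorial : ℝ)⁻¹ * ρ ^ s.1) * (ℓ ^ s.1 * 1) := by
          gcongr
          · exact norm_expCoeff_le hz s
          · exact norm_monomialFun_le _ hX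
          · exact he1 X
      _ = _ := by rw [mul_pow]; ring
  have hFi : ∀ s, Integrable (F s) ν := fun s =>
    Integrable.of_bound (Continuous.aestronglyMeasurable (continuous_const.mul
      (((contDiff_monomialFun s.2).continuous.comp hv).mul he))) _ (hFb s)
  have hsum : Summable fun s => ∫ X, ‖F s X‖ ∂ν := by
    refine Summable.of_nonneg_of_le (fun s => integral_nonneg fun _ => norm_nonneg _)
      (fun s => ?_) ((summable_expCoeff_bound d (mul_nonneg hρ0 hℓ)).mul_left (ν.real Set.univ))
    calc ∫ X, ‖F s X‖ ∂ν ≤ ∫ _X, (s.1.factorial : ℝ)⁻¹ * (ρ * ℓ) ^ s.1 ∂ν :=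
          integral_mono_ae (hFi s).norm (integrable_const _) (hFb s)
      _ = _ := by rw [integral_const, smul_eq_mul]
  have h := hasSum_integral_of_summable_integral_norm hFi hsum
  have e1 : ∀ X, ∑' s, F s X = Complex.exp (∑ i, z i * ((v X i : ℝ) : ℂ)) * e X := by
    intro X
    have h1 := (hasSum_expCoeff fun i => z i * ((v X i : ℝ) : ℂ)).mul_right (e X)
    rw [← h1.tsum_eq]
    exact tsum_congr fun s => by rw [hF, expCoeff_mul, mul_assoc]
  simp only [e1] at h
  refine h.of_eq (fun s => ?_) rfl
  rw [hF, integral_const_mul]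

end Taylor

/-! ### From spherical averages to the direction sum. -/

section CapBound

variable {d : ℕ}

/-- On a tile, all frequencies near `t w` are controlled by amplitudes at the frequency `t w`. -/
lemma hasSum_localFourier {L : ℝ} (hL : 0 < L) {β : Euc d → ℂ}
    (hβ : ∀ u, (∀ i, |u i| ≤ L / 2) → β u = 1) (μ : Measure (Euc d)) [IsFiniteMeasure μ] (t : ℝ)
    (w : Euc d) (b : OrthonormalBasis (Fin d) ℝ (Euc d)) (j : Fin d → ℤ) (z : Fin d → ℂ) :
    HasSum (fun s => expCoeff z s * (L + 1) ^ s.1 * localFourier μ t L w b j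
        fun u => (((L + 1) ^ s.1)⁻¹ : ℝ) • (β u * monomialFun s.2 u))
      (∫ X in tile t L b j, Complex.exp (∑ i, z i *
        (((scaledCoord t b X - tileCentre L j) i : ℝ) : ℂ)) *
          Complex.exp (-(2 * Real.pi * (t * inner ℝ w X) : ℝ) * Complex.I) ∂μ) := by
  have hle : ∀ X ∈ tile t L b j, ∀ i, |(scaledCoord t b X - tileCentre L j) i| ≤ L / 2 :=
    fun X hX i => abs_le.2 ⟨(hX i).1, (hX i).2.le⟩
  have h := hasSum_integral_expCoeff (ν := μ.restrict (tile t L b j))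
    (v := fun X => scaledCoord t b X - tileCentre L j) (continuous_scaledCoord.sub continuous_const)
    (e := fun X => Complex.exp (-(2 * Real.pi * (t * inner ℝ w X) : ℝ) * Complex.I))
    (by fun_prop) (fun X => by
      rw [← Complex.ofReal_neg, Complex.norm_exp_ofReal_mul_I]) (ℓ := L / 2) (by positivity)
    ((ae_restrict_iff' (measurableSet_tile j)).2 (Filter.Eventually.of_forall hle)) z
  refine h.of_eq (fun s => ?_) rfl
  rw [mul_assoc]
  congr 1
  rw [localFourier, ← integral_const_mul]
  -- On the tile itself the cutoff equals one, and the factor `(L + 1) ^ m` outside cancels the one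
  -- in the amplitude.
  refine setIntegral_congr_fun (measurableSet_tile j) fun X hX => ?_
  have h1 : ((L : ℂ) + 1) ≠ 0 := by exact_mod_cast (by linarith : L + 1 ≠ 0)
  simp only [hβ _ (hle X hX), one_mul, Complex.real_smul]
  push_cast
  field_simp

/-- The curvature of the sphere: the displacement along `w` is quadratic in the distance, hence `O(1
/ t)` on a cap of radius `O(t ^ (-1/2))`. -/
lemma inner_sphere_sub {w θ : Euc d} (hw : ‖w‖ = 1) (hθ : ‖θ‖ = 1) :
    inner ℝ w (θ - w) = -(‖θ - w‖ ^ 2 / 2) := by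
  have h1 := norm_sub_sq_real θ w
  rw [hw, hθ] at h1
  rw [inner_sub_right, real_inner_self_eq_norm_sq, hw, h1, real_inner_comm]
  ring

/-- The frequency `t θ` seen from `t w`, in scaled coordinates. -/
noncomputable def capCoord (t : ℝ) (b : OrthonormalBasis (Fin d) ℝ (Euc d)) (w θ : Euc d)
    (i : Fin d) : ℝ :=
  (if i.val = 0 then t else √t) * inner ℝ (b i) (θ - w)

variable {t c₁ : ℝ} {b : OrthonormalBasis (Fin d) ℝ (Euc d)} {w θ : Euc d}

/-- In the direction `w` the factor `t` meets a quadratic displacement; in the other directions `√t`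
meets a linear one. Both products are bounded, so the Taylor expansion in scaled coordinates has
bounded arguments. -/
lemma abs_capCoord_le (ht : 0 < t) (hc₁ : 0 < c₁) (hbw : ∀ i : Fin d, i.val = 0 → b i = w)
    (hw : ‖w‖ = 1) (hθ : ‖θ‖ = 1) (hθw : ‖θ - w‖ < c₁ / √t) (i : Fin d) :
    |capCoord t b w θ i| ≤ c₁ ^ 2 + c₁ := by
  have hr : 0 < √t := Real.sqrt_pos.2 ht
  have h1 : √t * ‖θ - w‖ ≤ c₁ := by
    rw [lt_div_iff₀ hr] at hθw; linarith
  rw [capCoord, abs_mul]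
  split_ifs with hi
  · rw [hbw i hi, inner_sphere_sub hw hθ, abs_neg, abs_of_pos ht, abs_of_nonneg (by positivity)]
    have h2 : (√t * ‖θ - w‖) ^ 2 ≤ c₁ ^ 2 := by gcongr
    rw [mul_pow, Real.sq_sqrt ht.le] at h2
    nlinarith
  · rw [abs_of_pos hr]
    have h2 := abs_real_inner_le_norm (b i) (θ - w)
    rw [b.norm_eq_one, one_mul] at h2
    have h3 : √t * |inner ℝ (b i) (θ - w)| ≤ √t * ‖θ - w‖ := by gcongr
    nlinarith

/-- The scalings of frequency and position are dual: in each coordinate they multiply to `t`, as `t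
· 1` or as `√t · √t`. -/
lemma sum_capCoord_mul_scaledCoord (ht : 0 ≤ t) (X : Euc d) :
    ∑ i, capCoord t b w θ i * scaledCoord t b X i = t * inner ℝ X (θ - w) := by
  rw [← b.sum_inner_mul_inner X (θ - w), Finset.mul_sum]
  refine Finset.sum_congr rfl fun i _ => ?_
  rw [capCoord, scaledCoord_apply, real_inner_comm X (b i)]
  split_ifs
  · ring
  · rw [← Real.mul_self_sqrt ht]
    simp only [Real.sqrt_mul_self (Real.sqrt_nonneg t)]
    ring

/-- The first index is zero and the remaining `b i` are orthogonal to `w`, so the phase at the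
centre of a tile is linear in `θ`: a wave with a lattice frequency, to which the large sieve
applies. -/
lemma sum_capCoord_mul_tileCentre (hd : 0 < d) (hbw : ∀ i : Fin d, i.val = 0 → b i = w) (L : ℝ)
    {j : Fin d → ℤ} (hj : j ∈ tileIndices d t) :
    ∑ i, capCoord t b w θ i * tileCentre L j i = inner ℝ ((L * √t) • latticeVec b j) θ := by
  rw [inner_smul_left, inner_latticeVec, Finset.mul_sum]
  refine Finset.sum_congr rfl fun i _ => ?_
  have e1 : tileCentre L j i = L * (j i : ℝ) := rfl
  rw [e1, capCoord]
  split_ifs with hi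
  · rw [eq_zero_of_mem_tileIndices hj hi]
    simp
  · have horth : inner ℝ (b i) w = 0 := by
      rw [← hbw ⟨0, hd⟩ rfl]
      exact b.orthonormal.inner_eq_zero fun h => hi (by rw [h])
    rw [inner_sub_right, horth, sub_zero]
    simp only [conj_trivial]
    ring

lemma measureFourier_eq_wave (μ : Measure (Euc d)) (ξ : Euc d) :
    measureFourier μ ξ = ∫ X, wave X ξ ∂μ := rfl

/-- On a tile the wave at `t θ` is the wave at `t w`, times the phase of the tile centre, times the
exponential of a linear form in the local coordinates. Expanding the last factor separates the
variables: for each monomial there remains an exponential sum in `θ` whose coefficients are local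
Fourier coefficients at `t w`, independent of `θ`. -/
lemma hasSum_measureFourier (hd : 0 < d) {L : ℝ} (hL : 4 ≤ L) {β : Euc d → ℂ}
    (hβ : ∀ u, (∀ i, |u i| ≤ L / 2) → β u = 1) (μ : Measure (Euc d)) [IsFiniteMeasure μ]
    (hμ : μ (Metric.closedBall 0 (3 / 2))ᶜ = 0) (ht : 0 < t)
    (hbw : ∀ i : Fin d, i.val = 0 → b i = w) (θ : Euc d) :
    HasSum (fun s => expCoeff (fun i => -(2 * Real.pi * capCoord t b w θ i : ℝ) * Complex.I) s *
        (L + 1) ^ s.1 * expSum (tileIndices d t) (fun j => (L * √t) • latticeVec b j)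
          (fun j => localFourier μ t L w b j
            fun u => (((L + 1) ^ s.1)⁻¹ : ℝ) • (β u * monomialFun s.2 u)) θ)
      (measureFourier μ (t • θ)) := by
  have hint : Integrable (fun X => wave X (t • θ)) μ := Integrable.of_bound
    (continuous_wave_left _).aestronglyMeasurable 1 (Filter.Eventually.of_forall fun X => by simp)
  rw [measureFourier_eq_wave, integral_eq_sum_tile (t := t) (b := b) hL hμ hint]
  set z : Fin d → ℂ := fun i => -(2 * Real.pi * capCoord t b w θ i : ℝ) * Complex.I with hz
  have hphase : ∀ j ∈ tileIndices d t, ∀ X, wave X (t • θ) =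
      wave ((L * √t) • latticeVec b j) θ * (Complex.exp (∑ i, z i *
        (((scaledCoord t b X - tileCentre L j) i : ℝ) : ℂ)) *
          Complex.exp (-(2 * Real.pi * (t * inner ℝ w X) : ℝ) * Complex.I)) := by
    intro j hj X
    have e1 : ∑ i, z i * (((scaledCoord t b X - tileCentre L j) i : ℝ) : ℂ)
        = -(2 * Real.pi * (t * inner ℝ X (θ - w) - inner ℝ ((L * √t) • latticeVec b j) θ) : ℝ)
          * Complex.I := by
      rw [← sum_capCoord_mul_scaledCoord ht.le (b := b), ← sum_capCoord_mul_tileCentre hd hbw L hj,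
        ← Finset.sum_sub_distrib, Finset.mul_sum]
      push_cast
      rw [← Finset.sum_neg_distrib, Finset.sum_mul]
      refine Finset.sum_congr rfl fun i _ => ?_
      rw [hz, PiLp.sub_apply]
      push_cast
      ring
    rw [e1, wave, wave, ← Complex.exp_add, ← Complex.exp_add, inner_smul_right, inner_sub_right,
      real_inner_comm X w]
    congr 1
    push_cast
    ring
  have hsum := hasSum_sum (s := tileIndices d t) fun j _ =>
    (hasSum_localFourier (by linarith : 0 < L) hβ μ t w b j z).mul_left
      (wave ((L * √t) • latticeVec b j) θ)
  refine hsum.of_eq (fun s => ?_) ?_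
  · rw [expSum, Finset.mul_sum]
    exact Finset.sum_congr rfl fun j _ => by ring
  · refine Finset.sum_congr rfl fun j hj => ?_
    rw [← integral_const_mul]
    exact integral_congr_ae (Filter.Eventually.of_forall fun X => hphase j hj X)

/-- The contribution of a cap to the spherical average. -/
lemma exists_lintegral_cap_measureFourier_le (hd : 0 < d) {L c₁ t₀ : ℝ} (hL : 4 ≤ L)
    (hc₁ : 0 < c₁) (ht₀ : 0 < t₀) : ∃ (K : ℕ → ℝ) (C : ℝ), 0 < C ∧
      ∀ (μ : Measure (Euc d)) [IsFiniteMeasure μ], μ (Metric.closedBall 0 (3 / 2))ᶜ = 0 →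
      ∀ t : ℝ, t₀ ≤ t → ∀ (b : OrthonormalBasis (Fin d) ℝ (Euc d)) (w : Euc d), ‖w‖ = 1 →
        (∀ i : Fin d, i.val = 0 → b i = w) →
        ∫⁻ θ : Metric.sphere (0 : Euc d) 1, (Metric.ball w (c₁ / √t)).indicator (fun θ =>
            ‖measureFourier μ (t • θ)‖ₑ ^ 2) θ ∂(volume : Measure (Euc d)).toSphere
          ≤ ENNReal.ofReal (C * (√t / √t ^ d)) *
            ∑' j : Fin d → ℤ, ⨆ Ψ : {Ψ : Euc d → ℂ // IsAmplitude K L Ψ},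
              ‖localFourier μ t L w b j Ψ.1‖ₑ ^ 2 := by
  obtain ⟨K, β, hβ, hamp⟩ := exists_monomial_amplitudes d (by linarith : 0 < L)
  obtain ⟨C, hC, hcap⟩ := exists_lintegral_cap_expSum_le hd (by linarith : 1 ≤ L) hc₁ ht₀
  -- The bound for the Taylor arguments, times the factor `L + 1` lost per degree in normalising the
  -- amplitudes; the factorials still make the weights `W` summable.
  set ρ := 2 * Real.pi * (c₁ ^ 2 + c₁) * (L + 1) with hρ
  have hρ0 : 0 ≤ ρ := by positivity
  set W : (Σ m : ℕ, (Fin m → Fin d)) → ℝ≥0∞ := fun s =>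
    ENNReal.ofReal ((s.1.factorial : ℝ)⁻¹ * ρ ^ s.1) with hW
  have hWtop : ∑' s, W s ≠ ⊤ := (summable_expCoeff_bound d hρ0).tsum_ofReal_ne_top
  set S := (∑' s, W s).toReal with hS
  have hSW : ∑' s, W s = ENNReal.ofReal S := (ENNReal.ofReal_toReal hWtop).symm
  refine ⟨K, S ^ 2 * C + 1, by positivity, fun μ _ hμ t ht b w hw hbw => ?_⟩
  have ht0 : 0 < t := ht₀.trans_le ht
  set a : (Σ m : ℕ, (Fin m → Fin d)) → (Fin d → ℤ) → ℂ := fun s j =>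
    localFourier μ t L w b j fun u => (((L + 1) ^ s.1)⁻¹ : ℝ) • (β u * monomialFun s.2 u) with ha
  set g : (Σ m : ℕ, (Fin m → Fin d)) → Euc d → ℝ≥0∞ := fun s θ =>
    ‖expSum (tileIndices d t) (fun j => (L * √t) • latticeVec b j) (a s) θ‖ₑ with hg
  set D := Metric.ball w (c₁ / √t) with hD
  set Q := ∑' j : Fin d → ℤ, ⨆ Ψ : {Ψ : Euc d → ℂ // IsAmplitude K L Ψ},
    ‖localFourier μ t L w b j Ψ.1‖ₑ ^ 2 with hQ
  have hpt : ∀ θ ∈ D, ‖θ‖ = 1 → ‖measureFourier μ (t • θ)‖ₑ ≤ ∑' s, W s * g s θ := by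
    intro θ hθ hθ1
    rw [hD, Metric.mem_ball, dist_eq_norm] at hθ
    rw [← (hasSum_measureFourier hd hL hβ μ hμ ht0 hbw θ).tsum_eq]
    refine enorm_tsum_le_tsum_enorm.trans (ENNReal.tsum_le_tsum fun s => ?_)
    rw [enorm_mul]
    gcongr
    rw [hW, ← ofReal_norm]
    apply ENNReal.ofReal_le_ofReal
    rw [norm_mul, norm_pow, ← Complex.ofReal_one, ← Complex.ofReal_add, Complex.norm_real,
      Real.norm_of_nonneg (by linarith)]
    refine (mul_le_mul_of_nonneg_right (norm_expCoeff_le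
      (ρ := 2 * Real.pi * (c₁ ^ 2 + c₁)) (fun i => ?_) s) (by positivity)).trans (le_of_eq ?_)
    · rw [norm_mul, norm_neg, Complex.norm_I, mul_one, Complex.norm_real, norm_mul,
        Real.norm_of_nonneg (by positivity)]
      gcongr
      exact abs_capCoord_le ht0 hc₁ hbw hw hθ1 hθ i
    · rw [hρ, mul_pow _ (L + 1)]
      ring
  have hgm : ∀ s, Measurable fun θ => g s θ ^ 2 := fun s =>
    (continuous_expSum _ _ _).measurable.enorm.pow_const 2
  have hsup : ∀ s, ∑ j ∈ tileIndices d t, ‖a s j‖ₑ ^ 2 ≤ Q := by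
    intro s
    refine le_trans (Finset.sum_le_sum fun j _ => ?_) (ENNReal.sum_le_tsum _)
    exact le_iSup (fun Ψ : {Ψ : Euc d → ℂ // IsAmplitude K L Ψ} =>
      ‖localFourier μ t L w b j Ψ.1‖ₑ ^ 2) ⟨_, hamp s.1 s.2⟩
  calc _ ≤ ∫⁻ θ : Metric.sphere (0 : Euc d) 1, ENNReal.ofReal S *
            ∑' s, W s * D.indicator (fun θ => g s θ ^ 2) θ
            ∂(volume : Measure (Euc d)).toSphere := by
        refine lintegral_mono fun θ => ?_
        by_cases hθ : (θ : Euc d) ∈ D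
        · simp only [Set.indicator_of_mem hθ]
          rw [← hSW]
          have h1 := hpt θ hθ (by simp)
          calc _ ≤ (∑' s, W s * g s θ) ^ 2 := by gcongr
            -- Cauchy–Schwarz with the summable weights `W` reduces the square of the series to the
            -- mean squares of the single monomials.
            _ ≤ _ := ENNReal.sq_tsum_mul_le _ _
        · simp [Set.indicator_of_notMem hθ]
    _ = ENNReal.ofReal S * ∑' s, W s * ∫⁻ θ : Metric.sphere (0 : Euc d) 1,
          D.indicator (fun θ => g s θ ^ 2) θ ∂(volume : Measure (Euc d)).toSphere := by
        have hm : ∀ s, Measurable fun θ : Metric.sphere (0 : Euc d) 1 =>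
            D.indicator (fun θ => g s θ ^ 2) θ := fun s =>
          ((hgm s).indicator measurableSet_ball).comp measurable_subtype_coe
        rw [lintegral_const_mul' _ _ ENNReal.ofReal_ne_top,
          lintegral_tsum fun s => ((hm s).const_mul _).aemeasurable]
        congr 2
        funext s
        rw [lintegral_const_mul' _ _ ENNReal.ofReal_ne_top]
    _ ≤ ENNReal.ofReal S * ∑' s, W s * (ENNReal.ofReal (C * (√t / √t ^ d)) * Q) := by
        gcongr with s
        exact (hcap t ht b w hbw (a s)).trans (mul_le_mul_right (hsup s) _)
    _ = ENNReal.ofReal (S ^ 2 * C * (√t / √t ^ d)) * Q := by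
        rw [ENNReal.tsum_mul_right, hSW, ← mul_assoc, ← mul_assoc,
          ← ENNReal.ofReal_mul ENNReal.toReal_nonneg, ← ENNReal.ofReal_mul (by positivity)]
        congr 2
        ring
    _ ≤ _ := by
        gcongr
        linarith

/-- The spherical average is controlled by the sum over the directions and the tiles. -/
lemma exists_sphericalAverage_le_directionSum (hd : 0 < d) {L c₁ t₀ : ℝ} (hL : 4 ≤ L)
    (hc₁ : 0 < c₁) (ht₀ : 0 < t₀) : ∃ (K : ℕ → ℝ) (C : ℝ), 0 < C ∧
      ∀ (μ : Measure (Euc d)) [IsFiniteMeasure μ], μ (Metric.closedBall 0 (3 / 2))ᶜ = 0 →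
      ∀ t : ℝ, t₀ ≤ t →
      ∀ (P : Finset (Euc d)) (b : Euc d → OrthonormalBasis (Fin d) ℝ (Euc d)),
        IsMaximalSeparated (c₁ / √t) P → (∀ w ∈ P, ∀ i : Fin d, i.val = 0 → b w i = w) →
        ENNReal.ofReal (sphericalAverage μ t)
          ≤ ENNReal.ofReal (C * t ^ (1 - (d : ℝ))) * directionSum μ K t L P b := by
  obtain ⟨K, C, hC, hcap⟩ := exists_lintegral_cap_measureFourier_le hd hL hc₁ ht₀
  have hL0 : 0 < L := by linarith
  refine ⟨K, C * L ^ d, by positivity, fun μ _ hμ t ht P b hP hb => ?_⟩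
  have ht0 : 0 < t := ht₀.trans_le ht
  have hr : 0 < √t := Real.sqrt_pos.2 ht0
  -- The sieve constant `t ^ (-(d - 1) / 2)` of a cap is, up to `L ^ d`, the claimed power `t ^ (1 -
  -- d)` divided by the volume of a tile.
  have hvol : √t / √t ^ d = L ^ d * t ^ (1 - (d : ℝ)) * (tileVolume d t L)⁻¹ := by
    rw [tileVolume, mul_inv, ← Real.rpow_neg ht0.le, mul_mul_mul_comm,
      mul_inv_cancel₀ (by positivity), one_mul, ← Real.rpow_add ht0, Real.sqrt_eq_rpow,
      ← Real.rpow_natCast, ← Real.rpow_mul ht0.le, ← Real.rpow_sub ht0]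
    congr 1
    ring
  calc ENNReal.ofReal (sphericalAverage μ t)
      ≤ ∫⁻ θ : Metric.sphere (0 : Euc d) 1, ‖measureFourier μ (t • (θ : Euc d))‖ₑ ^ 2
          ∂(volume : Measure (Euc d)).toSphere := ofReal_sphericalAverage_le μ t
    _ ≤ ∫⁻ θ : Metric.sphere (0 : Euc d) 1, ∑ w ∈ P, (Metric.ball w (c₁ / √t)).indicator
          (fun θ => ‖measureFourier μ (t • θ)‖ₑ ^ 2) θ ∂(volume : Measure (Euc d)).toSphere := by
        refine lintegral_mono fun θ => ?_
        obtain ⟨w, hw, hθ⟩ := hP.maximal θ (by simp)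
        have hmem : (θ : Euc d) ∈ Metric.ball w (c₁ / √t) := by
          rwa [Metric.mem_ball, dist_eq_norm]
        refine le_trans (le_of_eq ?_) (Finset.single_le_sum (f := fun w =>
          (Metric.ball w (c₁ / √t)).indicator (fun θ => ‖measureFourier μ (t • θ)‖ₑ ^ 2)
            (θ : Euc d)) (fun _ _ => zero_le) hw)
        simp only [Set.indicator_of_mem hmem]
    _ = ∑ w ∈ P, ∫⁻ θ : Metric.sphere (0 : Euc d) 1, (Metric.ball w (c₁ / √t)).indicator
          (fun θ => ‖measureFourier μ (t • θ)‖ₑ ^ 2) θ ∂(volume : Measure (Euc d)).toSphere := by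
        refine lintegral_finsetSum _ fun w _ => ?_
        have hm : Measurable fun θ : Euc d => ‖measureFourier μ (t • θ)‖ₑ ^ 2 := by
          have h1 : StronglyMeasurable fun θ : Euc d => measureFourier μ (t • θ) := by
            unfold measureFourier
            refine StronglyMeasurable.integral_prod_right
              (f := fun θ x : Euc d => Complex.exp
                (-(2 * Real.pi * inner ℝ x (t • θ) : ℝ) * Complex.I)) ?_
            refine Continuous.stronglyMeasurable ?_
            unfold Function.uncurry
            fun_prop
          exact h1.measurable.enorm.pow_const 2
        exact (hm.indicator measurableSet_ball).comp measurable_subtype_coe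
    _ ≤ ∑ w ∈ P, ENNReal.ofReal (C * (√t / √t ^ d)) *
          ∑' j : Fin d → ℤ, ⨆ Ψ : {Ψ : Euc d → ℂ // IsAmplitude K L Ψ},
              ‖localFourier μ t L w (b w) j Ψ.1‖ₑ ^ 2 :=
        Finset.sum_le_sum fun w hw => hcap μ hμ t ht (b w) w (hP.on_sphere w hw) (hb w hw)
    _ = _ := by
        rw [directionSum, Finset.mul_sum]
        refine Finset.sum_congr rfl fun w _ => ?_
        rw [hvol, ← mul_assoc (ENNReal.ofReal _) (ENNReal.ofReal _),
          ← ENNReal.ofReal_mul (by positivity)]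
        congr 2
        ring

end CapBound

/-! ### Derivatives of the density and of its localisations. -/

section Derivatives

variable {d : ℕ} {φ : Euc d → ℝ} {c C p : ℝ}

/-- Each derivative costs `q ^ p`, by scaling. The derivatives of `φ` are bounded and still
supported in the unit ball, so the same envelope dominates them. -/
lemma exists_enorm_iteratedFDeriv_thickDensity_le (hd : 0 < d) (hφ : IsThickener φ) (hc : 0 < c)
    (hC : 0 < C) (p : ℝ) (k : ℕ) : ∃ B : ℝ, 0 ≤ B ∧ ∀ A : Set (Euc d), WellDistributed c C A →
      ∀ q : ℝ, qMin d C ≤ q → ∀ X,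
        ‖iteratedFDeriv ℝ k (thickDensity φ p A q) X‖ₑ
          ≤ ENNReal.ofReal (B * (q ^ p) ^ k) * envelope (truncFinset A q) q (q ^ p) X := by
  obtain ⟨Φ, hΦ⟩ := (hφ.hasCompactSupport.iteratedFDeriv (𝕜 := ℝ) k).exists_bound_of_continuous
    (hφ.smooth.continuous_iteratedFDeriv (by exact_mod_cast le_top))
  have hΦ0 : 0 ≤ Φ := (norm_nonneg _).trans (hΦ 0)
  have hκ := lowerDensity_pos hd hC
  refine ⟨Φ / lowerDensity d C, by positivity, fun A hA q hq X => ?_⟩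
  have hq0 : 0 < q := by linarith [two_le_of_qMin_le hq]
  have hφk : ContDiff ℝ k φ := hφ.smooth.of_le (by exact_mod_cast le_top)
  set R := q ^ p with hR
  have hR0 : 0 < R := by positivity
  set N : ℝ := ((truncFinset A q).card : ℝ) with hN
  set f : Euc d → ℝ := fun x => ‖iteratedFDeriv ℝ k φ x‖ with hf
  have hcomp : ∀ a : Euc d, ContDiff ℝ k fun x => φ (R • (x - q⁻¹ • a)) := fun a =>
    hφk.comp (by fun_prop : ContDiff ℝ k fun x : Euc d => R • (x - q⁻¹ • a))
  have hterm : ∀ a : Euc d, iteratedFDeriv ℝ k (fun x => (N⁻¹ * R ^ d) • φ (R • (x - q⁻¹ • a))) X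
      = (N⁻¹ * R ^ d) • R ^ k • iteratedFDeriv ℝ k φ (R • (X - q⁻¹ • a)) := by
    intro a
    rw [iteratedFDeriv_const_smul_apply' (hcomp a).contDiffAt,
      iteratedFDeriv_comp_sub k (f := fun z => φ (R • z)),
      iteratedFDeriv_comp_const_smul R hφk]
  have hcd : ∀ a : Euc d, ContDiffAt ℝ k (fun x => (N⁻¹ * R ^ d) • φ (R • (x - q⁻¹ • a))) X :=
    fun a => by
      have := (hcomp a).contDiffAt (x := X)
      fun_prop
  have hbound : ‖iteratedFDeriv ℝ k (thickDensity φ p A q) X‖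
      ≤ R ^ k * (N⁻¹ * ∑ a ∈ truncFinset A q, R ^ d * f (R • (X - q⁻¹ • a))) := by
    have e1 : thickDensity φ p A q = fun x => ∑ a ∈ truncFinset A q,
        (N⁻¹ * R ^ d) • φ (R • (x - q⁻¹ • a)) := by
      funext x
      rw [thickDensity_eq hd hφ hc hA hq0, Finset.mul_sum]
      exact Finset.sum_congr rfl fun a _ => by rw [smul_eq_mul, mul_assoc]
    rw [e1, iteratedFDeriv_fun_sum_apply fun a _ => hcd a]
    refine (norm_sum_le _ _).trans (le_of_eq ?_)
    rw [Finset.mul_sum, Finset.mul_sum]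
    refine Finset.sum_congr rfl fun a _ => ?_
    rw [hterm, norm_smul, norm_smul, Real.norm_of_nonneg (by positivity),
      Real.norm_of_nonneg (by positivity)]
    ring
  have henv := ofReal_sum_dilate_le_envelope (S := truncFinset A q) hq0 hR0 hκ
    (lowerDensity_mul_le hd hc hC hA hq) hΦ0 (f := f) hΦ (fun x hx => by
      rw [hf, norm_eq_zero]
      by_contra h
      have := hφ.support_subset (support_iteratedFDeriv_subset k h)
      rw [mem_closedBall_zero_iff] at this
      linarith) X
  rw [← ofReal_norm]
  calc _ ≤ _ := ENNReal.ofReal_le_ofReal hbound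
    _ ≤ ENNReal.ofReal (R ^ k) * (ENNReal.ofReal (Φ / lowerDensity d C) *
          envelope (truncFinset A q) q R X) := by
        rw [ENNReal.ofReal_mul (by positivity)]
        gcongr
    _ = _ := by
        rw [← mul_assoc, ← ENNReal.ofReal_mul (by positivity), mul_comm (R ^ k)]

/-- The norm of the scaling map is used for every derivative, also for those along `w`, where the
true cost is bounded. The waste is harmless, because an integration by parts divides by `t`. -/
lemma IsAmplitude.norm_iteratedFDeriv_comp_le {K : ℕ → ℝ} {L : ℝ} {Ψ : Euc d → ℂ}
    (hΨ : IsAmplitude K L Ψ) (t : ℝ) (b : OrthonormalBasis (Fin d) ℝ (Euc d)) (x₀ : Euc d) (n : ℕ)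
    (X : Euc d) :
    ‖iteratedFDeriv ℝ n (fun X => Ψ (scaledCoord t b X - x₀)) X‖ ≤ |K n| * (1 + √t) ^ n := by
  have hcd : ContDiff ℝ n fun u => Ψ (u - x₀) :=
    (hΨ.smooth.of_le (by exact_mod_cast le_top)).comp (by fun_prop)
  have e1 : (fun X => Ψ (scaledCoord t b X - x₀)) = (fun u => Ψ (u - x₀)) ∘ scaledCoordCLM t b :=
    rfl
  rw [e1, ContinuousLinearMap.iteratedFDeriv_comp_right _ hcd X le_rfl]
  refine (ContinuousMultilinearMap.norm_compContinuousLinearMap_le _ _).trans ?_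
  rw [iteratedFDeriv_comp_sub, Finset.prod_const, Finset.card_univ, Fintype.card_fin]
  gcongr
  · exact (hΨ.deriv_le n _).trans (le_abs_self _)
  · exact norm_scaledCoordCLM_le

/-- Leibniz' rule, each derivative falling on the density at cost `q ^ p` or on the amplitude at
cost `1 + √t`. Keeping the envelope pointwise preserves the localisation needed to sum over tiles.
-/
lemma exists_enorm_iteratedFDeriv_localDensity_le (hd : 0 < d) (hφ : IsThickener φ) (hc : 0 < c)
    (hC : 0 < C) (p : ℝ) (K : ℕ → ℝ) (L : ℝ) (n : ℕ) : ∃ B : ℝ, 0 ≤ B ∧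
      ∀ A : Set (Euc d), WellDistributed c C A → ∀ q : ℝ, qMin d C ≤ q →
      ∀ Ψ : Euc d → ℂ, IsAmplitude K L Ψ → ∀ (t : ℝ) (b : OrthonormalBasis (Fin d) ℝ (Euc d))
        (x₀ X : Euc d),
        ‖iteratedFDeriv ℝ n (fun X => thickDensity φ p A q X • Ψ (scaledCoord t b X - x₀)) X‖ₑ
          ≤ ENNReal.ofReal (B * (1 + √t + q ^ p) ^ n) *
            envelope (truncFinset A q) q (q ^ p) X := by
  choose B hB0 hB using exists_enorm_iteratedFDeriv_thickDensity_le hd hφ hc hC p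
  refine ⟨∑ i ∈ Finset.range (n + 1), (n.choose i : ℝ) * B i * |K (n - i)|,
    Finset.sum_nonneg fun i _ => mul_nonneg (mul_nonneg (by positivity) (hB0 i)) (abs_nonneg _),
    fun A hA q hq Ψ hΨ t b x₀ X => ?_⟩
  have hq0 : 0 < q := by linarith [two_le_of_qMin_le hq]
  have hcd1 : ContDiff ℝ ∞ (thickDensity φ p A q) := contDiff_thickDensity hd hφ hc hA hq0
  have hcd2 : ContDiff ℝ ∞ fun X => Ψ (scaledCoord t b X - x₀) :=
    hΨ.smooth.comp ((scaledCoordCLM t b).contDiff.sub contDiff_const)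
  have h := norm_iteratedFDeriv_smul_le hcd1 hcd2 X (n := n) (by exact_mod_cast le_top)
  set M := 1 + √t + q ^ p with hM
  have hR0 : 0 < q ^ p := by positivity
  have hs := Real.sqrt_nonneg t
  rw [← ofReal_norm]
  calc _ ≤ ENNReal.ofReal (∑ i ∈ Finset.range (n + 1), (n.choose i : ℝ) *
          ‖iteratedFDeriv ℝ i (thickDensity φ p A q) X‖ * (|K (n - i)| * M ^ (n - i))) := by
        refine ENNReal.ofReal_le_ofReal (h.trans (Finset.sum_le_sum fun i _ => ?_))
        refine mul_le_mul_of_nonneg_left ?_ (by positivity)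
        refine (hΨ.norm_iteratedFDeriv_comp_le t b x₀ (n - i) X).trans ?_
        gcongr
        linarith
    _ = ∑ i ∈ Finset.range (n + 1), ENNReal.ofReal ((n.choose i : ℝ) * (|K (n - i)| * M ^ (n - i)))
          * ‖iteratedFDeriv ℝ i (thickDensity φ p A q) X‖ₑ := by
        rw [ENNReal.ofReal_sum_of_nonneg fun i _ => by positivity]
        refine Finset.sum_congr rfl fun i _ => ?_
        rw [← ofReal_norm, ← ENNReal.ofReal_mul (by positivity)]
        congr 1
        ring
    _ ≤ ∑ i ∈ Finset.range (n + 1), ENNReal.ofReal ((n.choose i : ℝ) * (|K (n - i)| * M ^ (n - i)))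
          * (ENNReal.ofReal (B i * M ^ i) * envelope (truncFinset A q) q (q ^ p) X) := by
        refine Finset.sum_le_sum fun i _ => mul_le_mul_right ((hB i A hA q hq X).trans ?_) _
        have := hB0 i
        gcongr
        linarith
    _ = _ := by
        rw [Finset.sum_mul, ENNReal.ofReal_sum_of_nonneg fun i _ => by
          have := hB0 i; positivity, Finset.sum_mul]
        refine Finset.sum_congr rfl fun i hi => ?_
        rw [← mul_assoc, ← ENNReal.ofReal_mul (by positivity)]
        congr 2
        have e1 : M ^ n = M ^ (n - i) * M ^ i := by
          rw [← pow_add, Nat.sub_add_cancel (Nat.lt_succ_iff.1 (Finset.mem_range.1 hi))]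
        rw [e1]
        ring

end Derivatives

/-! ### Integration by parts along `w` on invariant sets. -/

section IntegrationByParts

variable {d : ℕ} {w : Euc d} {S : Set (Euc d)} {h : Euc d → ℂ}

/-- Integration by parts, against a wave in the direction `w`, on a set invariant under translation
in this direction. -/
lemma setIntegral_mul_exp_eq (hw : ‖w‖ = 1) (hS : MeasurableSet S)
    (hSw : ∀ X, ∀ s : ℝ, X + s • w ∈ S ↔ X ∈ S) (hh : ContDiff ℝ ∞ h) (hhc : HasCompactSupport h)
    {t : ℝ} (ht : 0 < t) (n : ℕ) :
    ∫ X in S, h X * Complex.exp (-(2 * Real.pi * (t * inner ℝ w X) : ℝ) * Complex.I)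
      = ((2 * Real.pi * t : ℝ) * Complex.I)⁻¹ ^ n *
        ∫ X in S, iteratedFDeriv ℝ n h X (fun _ => w) *
          Complex.exp (-(2 * Real.pi * (t * inner ℝ w X) : ℝ) * Complex.I) := by
  set e : Euc d → ℂ := fun X =>
    Complex.exp (-(2 * Real.pi * (t * inner ℝ w X) : ℝ) * Complex.I) with he
  have hec : Continuous e := by rw [he]; fun_prop
  have he1 : ∀ X, ‖e X‖ = 1 := fun X => by
    simp only [he]
    rw [← Complex.ofReal_neg, Complex.norm_exp_ofReal_mul_I]
  set g : ℕ → Euc d → ℂ := fun n X => iteratedFDeriv ℝ n h X (fun _ => w) with hg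
  have hgc : ∀ n, Continuous (g n) := fun n =>
    (ContinuousMultilinearMap.apply ℝ (fun _ : Fin n => Euc d) ℂ fun _ => w).continuous.comp
      (hh.continuous_iteratedFDeriv (by exact_mod_cast le_top))
  have hgs : ∀ n, HasCompactSupport (g n) := fun n =>
    (hhc.iteratedFDeriv (𝕜 := ℝ) n).comp_left
      (g := fun m : ContinuousMultilinearMap ℝ (fun _ : Fin n => Euc d) ℂ => m fun _ => w) rfl
  have hgi : ∀ n, Integrable fun X => S.indicator (g n) X * e X := fun n =>
    (((hgc n).integrable_of_hasCompactSupport (hgs n)).indicator hS).mul_bdd (c := 1)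
      hec.aestronglyMeasurable (Filter.Eventually.of_forall fun X => (he1 X).le)
  have hgd : ∀ n X, HasLineDerivAt ℝ (g n) (g (n + 1) X) X w := by
    intro n X
    have h1 : DifferentiableAt ℝ (iteratedFDeriv ℝ n h) X :=
      (hh.differentiable_iteratedFDeriv (by exact_mod_cast WithTop.coe_lt_top n)) X
    have h2 := ((ContinuousMultilinearMap.apply ℝ (fun _ : Fin n => Euc d) ℂ
      fun _ => w).hasFDerivAt.comp X h1.hasFDerivAt).hasLineDerivAt w
    exact h2
  -- A line in the direction `w` lies entirely in `S` or entirely outside it, so the sharp cutoff is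
  -- invisible to the derivative along `w` and there are no boundary terms.
  have hind : ∀ n X, HasLineDerivAt ℝ (S.indicator (g n)) (S.indicator (g (n + 1)) X) X w := by
    intro n X
    by_cases hX : X ∈ S
    · have e1 : (fun s : ℝ => S.indicator (g n) (X + s • w)) = fun s => g n (X + s • w) :=
        funext fun s => Set.indicator_of_mem ((hSw X s).2 hX) _
      rw [Set.indicator_of_mem hX, HasLineDerivAt, e1]
      exact hgd n X
    · have e1 : (fun s : ℝ => S.indicator (g n) (X + s • w)) = fun _ => 0 :=
        funext fun s => Set.indicator_of_notMem (fun h => hX ((hSw X s).1 h)) _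
      rw [Set.indicator_of_notMem hX, HasLineDerivAt, e1]
      exact hasDerivAt_const _ _
  have hed : ∀ X, HasLineDerivAt ℝ e (-((2 * Real.pi * t : ℝ) * Complex.I) * e X) X w := by
    intro X
    have e1 : (fun s : ℝ => e (X + s • w)) = fun s : ℝ =>
        Complex.exp (-((2 * Real.pi * t : ℝ) * Complex.I) * (s : ℂ)) * e X := by
      funext s
      simp only [he]
      rw [← Complex.exp_add, inner_add_right, inner_smul_right, real_inner_self_eq_norm_sq, hw]
      congr 1
      push_cast
      ring
    rw [HasLineDerivAt, e1]
    have h1 := ((Complex.ofRealCLM.hasDerivAt (x := (0 : ℝ))).const_mul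
      (-((2 * Real.pi * t : ℝ) * Complex.I))).cexp.mul_const (e X)
    simpa using h1
  have hstep : ∀ n, ∫ X, S.indicator (g n) X * e X =
      ((2 * Real.pi * t : ℝ) * Complex.I)⁻¹ * ∫ X, S.indicator (g (n + 1)) X * e X := by
    intro n
    have hz : ((2 * Real.pi * t : ℝ) * Complex.I) ≠ 0 :=
      mul_ne_zero (by exact_mod_cast (by positivity : 2 * Real.pi * t ≠ 0)) Complex.I_ne_zero
    have hibp := integral_bilinear_hasLineDerivAt_right_eq_neg_left_of_integrable
      (μ := (volume : Measure (Euc d))) (f := S.indicator (g n)) (f' := S.indicator (g (n + 1)))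
      (g := e) (g' := fun X => -((2 * Real.pi * t : ℝ) * Complex.I) * e X) (v := w)
      (B := ContinuousLinearMap.mul ℝ ℂ) (hgi (n + 1))
      (by
        refine ((hgi n).const_mul (-((2 * Real.pi * t : ℝ) * Complex.I))).congr
          (Filter.Eventually.of_forall fun X => ?_)
        simp only [ContinuousLinearMap.mul_apply']
        ring)
      (hgi n) (fun X _ => hind n X) (fun X _ => hed X)
    simp only [ContinuousLinearMap.mul_apply'] at hibp
    have e2 : ∀ X, S.indicator (g n) X * (-((2 * Real.pi * t : ℝ) * Complex.I) * e X)
        = -((2 * Real.pi * t : ℝ) * Complex.I) * (S.indicator (g n) X * e X) := fun X => by ring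
    simp only [e2] at hibp
    rw [integral_const_mul, neg_mul, neg_inj] at hibp
    rw [← hibp, inv_mul_cancel_left₀ hz]
  have hset : ∀ n, ∫ X in S, g n X * e X = ∫ X, S.indicator (g n) X * e X := by
    intro n
    rw [← integral_indicator hS]
    refine integral_congr_ae (Filter.Eventually.of_forall fun X => ?_)
    by_cases hX : X ∈ S <;> simp [hX]
  have hmain : ∀ n, ∫ X in S, g 0 X * e X
      = ((2 * Real.pi * t : ℝ) * Complex.I)⁻¹ ^ n * ∫ X in S, g n X * e X := by
    intro n
    induction n with
    | zero => simp
    | succ n ih => rw [ih, hset n, hstep n, hset (n + 1), pow_succ, ← mul_assoc]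
  exact hmain n

lemma enorm_setIntegral_mul_exp_le (hw : ‖w‖ = 1) (hS : MeasurableSet S)
    (hSw : ∀ X, ∀ s : ℝ, X + s • w ∈ S ↔ X ∈ S) (hh : ContDiff ℝ ∞ h) (hhc : HasCompactSupport h)
    {t : ℝ} (ht : 0 < t) (n : ℕ) :
    ‖∫ X in S, h X * Complex.exp (-(2 * Real.pi * (t * inner ℝ w X) : ℝ) * Complex.I)‖ₑ
      ≤ ENNReal.ofReal ((t ^ n)⁻¹) * ∫⁻ X in S, ‖iteratedFDeriv ℝ n h X‖ₑ := by
  rw [setIntegral_mul_exp_eq hw hS hSw hh hhc ht n, enorm_mul]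
  refine mul_le_mul' ?_ ((enorm_integral_le_lintegral_enorm _).trans (lintegral_mono fun X => ?_))
  · rw [← ofReal_norm]
    apply ENNReal.ofReal_le_ofReal
    rw [norm_pow, norm_inv, norm_mul, Complex.norm_I, mul_one, Complex.norm_real,
      Real.norm_of_nonneg (by positivity), ← inv_pow]
    gcongr
    nlinarith [Real.pi_gt_three]
  · rw [enorm_mul, ← Complex.ofReal_neg, ← ofReal_norm (Complex.exp _),
      Complex.norm_exp_ofReal_mul_I, ENNReal.ofReal_one, mul_one, ← ofReal_norm, ← ofReal_norm]
    apply ENNReal.ofReal_le_ofReal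
    refine (ContinuousMultilinearMap.le_opNorm _ _).trans (le_of_eq ?_)
    simp [hw]

end IntegrationByParts

/-! ### Masses of tiles, total mass and the number of directions. -/

section Mass

variable {d : ℕ}

lemma volume_frame_box (b : OrthonormalBasis (Fin d) ℝ (Euc d)) (m ℓ : Fin d → ℝ) :
    volume {X | ∀ i, |inner ℝ (b i) X - m i| ≤ ℓ i} = ∏ i, ENNReal.ofReal (2 * ℓ i) := by
  have e1 : {X | ∀ i, |inner ℝ (b i) X - m i| ≤ ℓ i}
      = b.repr ⁻¹' (WithLp.ofLp ⁻¹' Set.Icc (m - ℓ) (m + ℓ)) := by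
    ext X
    simp only [Set.mem_ofPred_eq, Set.mem_preimage, Set.mem_Icc, Pi.le_def, ← forall_and,
      Pi.sub_apply, Pi.add_apply, OrthonormalBasis.repr_apply_apply, abs_le]
    refine forall_congr' fun i => ⟨fun h => ⟨?_, ?_⟩, fun h => ⟨?_, ?_⟩⟩ <;> linarith [h.1, h.2]
  have hm : MeasurableSet (WithLp.ofLp ⁻¹' Set.Icc (m - ℓ) (m + ℓ) : Set (Euc d)) :=
    (PiLp.volume_preserving_ofLp (Fin d)).measurable measurableSet_Icc
  rw [e1, b.measurePreserving_repr.measure_preimage hm.nullMeasurableSet,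
    (PiLp.volume_preserving_ofLp (Fin d)).measure_preimage measurableSet_Icc.nullMeasurableSet,
    Real.volume_Icc_pi]
  refine Finset.prod_congr rfl fun i _ => ?_
  congr 1
  simp only [Pi.sub_apply, Pi.add_apply]
  ring

lemma prod_ite_val_eq_zero (hd : 0 < d) (x y : ℝ) :
    ∏ i : Fin d, y * (if i.val = 0 then 1 else x) = y ^ d * x ^ (d - 1) := by
  obtain ⟨k, rfl⟩ := Nat.exists_eq_succ_of_ne_zero hd.ne'
  rw [Finset.prod_mul_distrib, Finset.prod_const, Fin.prod_univ_succ]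
  simp

/-- The mass given to a tile by the envelope. -/
lemma exists_setLIntegral_tile_envelope_le (hd : 0 < d) {c : ℝ} (hc : 0 < c) {L : ℝ} (hL : 0 < L) :
    ∃ M : ℝ, 0 < M ∧ ∀ S : Finset (Euc d), (∀ a ∈ S, ∀ a' ∈ S, a ≠ a' → c ≤ ‖a - a'‖) →
      ∀ q R t : ℝ, 1 ≤ q → q ≤ R → 0 < t →
      ∀ (b : OrthonormalBasis (Fin d) ℝ (Euc d)) (j : Fin d → ℤ),
        ∫⁻ X in tile t L b j, envelope S q R X
          ≤ ENNReal.ofReal (M * (1 / √t + 1 / q) ^ (d - 1)) := by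
  refine ⟨(2 / c) ^ d * (L + 2 * (1 + c)) ^ d, by positivity, fun S hS q R t hq hR ht b j => ?_⟩
  have hq0 : 0 < q := by linarith
  have hr : 0 < √t := Real.sqrt_pos.2 ht
  set σ : Fin d → ℝ := fun i => if i.val = 0 then 1 else √t with hσ
  have hσ0 : ∀ i, 0 < σ i := fun i => by
    simp only [hσ]
    split_ifs
    exacts [one_pos, hr]
  -- Half the side of the tile, enlarged by the margin that the packing estimate needs.
  set ℓ : Fin d → ℝ := fun i => L / (2 * σ i) + (1 + c) / q with hℓ
  have h := setLIntegral_envelope_le hd hc hS hq0 hR (E := tile t L b j)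
    (F := {X | ∀ i, |inner ℝ (b i) X - L * j i / σ i| ≤ ℓ i}) (by
      intro X hX Y hY i
      have h1 : |inner ℝ (b i) X - L * j i / σ i| ≤ L / (2 * σ i) := by
        obtain ⟨h1, h2⟩ := mem_tile.1 hX i
        have e1 : scaledCoord t b X i = σ i * inner ℝ (b i) X := rfl
        have e2 : inner ℝ (b i) X - L * j i / σ i = (scaledCoord t b X i - L * j i) / σ i := by
          rw [e1]
          field_simp [(hσ0 i).ne']
        rw [e2, abs_div, abs_of_pos (hσ0 i), ← div_div]
        gcongr
        exact abs_le.2 ⟨h1, h2.le⟩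
      have h2 : |inner ℝ (b i) (Y - X)| ≤ (1 + c) / q := by
        have := abs_real_inner_le_norm (b i) (Y - X)
        rw [b.norm_eq_one, one_mul] at this
        exact this.trans hY
      calc _ = |(inner ℝ (b i) X - L * j i / σ i) + inner ℝ (b i) (Y - X)| := by
            rw [inner_sub_right]
            congr 1
            ring
        _ ≤ _ := (abs_add_le _ _).trans (add_le_add h1 h2))
  refine h.trans ?_
  rw [volume_frame_box, ← ENNReal.ofReal_prod_of_nonneg fun i _ => by
    have := hσ0 i; positivity, ← ENNReal.ofReal_mul (by positivity)]
  apply ENNReal.ofReal_le_ofReal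
  rw [mul_assoc]
  gcongr
  rw [← prod_ite_val_eq_zero hd]
  refine Finset.prod_le_prod (fun i _ => by have := hσ0 i; positivity) fun i _ => ?_
  -- The side along `w` is `O(1)` and the other `d - 1` sides are `O(1 / √t + 1 / q)`.
  have hq1 : 1 / q ≤ 1 := by rw [div_le_one hq0]; exact hq
  have e1 : 2 * ℓ i = L * (1 / σ i) + 2 * (1 + c) * (1 / q) := by
    simp only [hℓ]
    have := hσ0 i
    field_simp
  rw [e1, add_mul]
  simp only [hσ]
  have : 0 < 1 / √t := by positivity
  have : 0 < 1 / q := by positivity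
  split_ifs
  · gcongr
    simp
  · gcongr <;> linarith

lemma exists_lintegral_envelope_le (hd : 0 < d) {c : ℝ} (hc : 0 < c) : ∃ M : ℝ, 0 < M ∧
    ∀ S : Finset (Euc d), (∀ a ∈ S, ∀ a' ∈ S, a ≠ a' → c ≤ ‖a - a'‖) →
      ∀ q R : ℝ, 1 ≤ q → q ≤ R → (∀ a ∈ S, ‖a‖ ≤ q) →
        ∫⁻ X, envelope S q R X ≤ ENNReal.ofReal M := by
  set V := volume (Metric.closedBall (0 : Euc d) (3 + c)) with hV
  have hVt : V ≠ ⊤ := measure_closedBall_lt_top.ne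
  refine ⟨(2 / c) ^ d * V.toReal + 1, by positivity, fun S hS q R hq hR hSq => ?_⟩
  have hq0 : 0 < q := by linarith
  have hR1 : R⁻¹ ≤ 1 := inv_le_one_of_one_le₀ (hq.trans hR)
  calc ∫⁻ X, envelope S q R X
      ≤ ∫⁻ X in Metric.closedBall 0 2, envelope S q R X := by
        rw [← lintegral_indicator Metric.isClosed_closedBall.measurableSet]
        refine lintegral_mono fun X => ?_
        by_cases hX : X ∈ Metric.closedBall (0 : Euc d) 2
        · rw [Set.indicator_of_mem hX]
        · rw [envelope_eq_zero hq0 hSq]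
          · exact zero_le
          · rw [mem_closedBall_zero_iff] at hX
            linarith
    _ ≤ ENNReal.ofReal ((2 / c) ^ d) * V := by
        refine setLIntegral_envelope_le hd hc hS hq0 hR fun x hx y hy => ?_
        rw [mem_closedBall_zero_iff] at hx ⊢
        have h1 : (1 + c) / q ≤ 1 + c := div_le_self (by positivity) hq
        have h2 := norm_sub_norm_le y x
        linarith
    _ = ENNReal.ofReal ((2 / c) ^ d * V.toReal) := by
        rw [ENNReal.ofReal_mul (by positivity), ENNReal.ofReal_toReal hVt]
    _ ≤ _ := ENNReal.ofReal_le_ofReal (by linarith)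

/-- With `δ = c₁ / √t`, disjoint balls of volume about `δ ^ d` lie in a shell of volume `O(δ)`, so
there are `O(δ ^ (1 - d))` of them. -/
lemma exists_card_isMaximalSeparated_le (hd : 0 < d) {c₁ t₀ : ℝ} (hc₁ : 0 < c₁) (ht₀ : 0 < t₀) :
    ∃ M : ℝ, 0 < M ∧ ∀ t : ℝ, t₀ ≤ t → ∀ P : Finset (Euc d), IsMaximalSeparated (c₁ / √t) P →
      (P.card : ℝ) ≤ M * √t ^ (d - 1) := by
  obtain ⟨C, hC, hshell⟩ := exists_volume_shell_le hd (c₁ / √t₀)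
  obtain ⟨V, hV0, hV⟩ : ∃ V : ℝ, 0 < V ∧
      volume (Metric.ball (0 : Euc d) 1) = ENNReal.ofReal V :=
    ⟨_, ENNReal.toReal_pos volume_unitBall_ne_zero volume_unitBall_ne_top,
      (ENNReal.ofReal_toReal volume_unitBall_ne_top).symm⟩
  have hst₀ : 0 < √t₀ := Real.sqrt_pos.2 ht₀
  refine ⟨2 * C / V * (2 / c₁) ^ (d - 1), by positivity, fun t ht P hP => ?_⟩
  have hr : 0 < √t := Real.sqrt_pos.2 (ht₀.trans_le ht)
  set δ := c₁ / √t with hδ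
  have hδ0 : 0 < δ := by positivity
  have hδ1 : δ ≤ c₁ / √t₀ := by
    rw [hδ]
    gcongr
  have h1 := card_mul_volume_ball_le hd hδ0.le (x := id) hP.separated
    (E := {x : Euc d | 1 - δ ≤ ‖x‖ ∧ ‖x‖ ≤ 1 + δ}) (by
      intro w hw x hx
      rw [Metric.mem_ball, dist_eq_norm, id] at hx
      have hw1 := hP.on_sphere w hw
      have h2 := norm_sub_norm_le x w
      have h3 := norm_sub_norm_le w x
      rw [norm_sub_rev] at h3
      constructor <;> linarith)
  have h2 := h1.trans (hshell δ hδ0 hδ1)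
  rw [hV, ← ENNReal.ofReal_mul (by positivity), ← ENNReal.ofReal_natCast,
    ← ENNReal.ofReal_mul (by positivity), ENNReal.ofReal_le_ofReal_iff (by positivity)] at h2
  obtain ⟨k, rfl⟩ := Nat.exists_eq_succ_of_ne_zero hd.ne'
  have hu : 2 / c₁ * √t = (δ / 2)⁻¹ := by
    rw [hδ]
    field_simp
  rw [Nat.succ_sub_one, mul_assoc, ← mul_pow, hu]
  have h3 : (P.card : ℝ) ≤ C * δ / ((δ / 2) ^ k.succ * V) := (le_div_iff₀ (by positivity)).2 h2
  refine h3.trans (le_of_eq ?_)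
  rw [Nat.succ_eq_add_one, pow_succ, inv_pow]
  have hk : (δ / 2) ^ k ≠ 0 := by positivity
  generalize (δ / 2) ^ k = x at hk
  field_simp

end Mass

/-! ### Replacing tiles by strips. -/

section Strip

variable {d : ℕ} {t L : ℝ} {b : OrthonormalBasis (Fin d) ℝ (Euc d)} {w : Euc d}

/-- The union of the tiles which differ from a given one by a translation in the first direction. -/
def strip (t L : ℝ) (b : OrthonormalBasis (Fin d) ℝ (Euc d)) (j : Fin d → ℤ) : Set (Euc d) :=
  {X | ∀ i : Fin d, i.val ≠ 0 → -(L / 2) ≤ scaledCoord t b X i - L * j i ∧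
    scaledCoord t b X i - L * j i < L / 2}

lemma measurableSet_strip (j : Fin d → ℤ) : MeasurableSet (strip t L b j) := by
  have h : ∀ i, Measurable fun X => scaledCoord t b X i - L * j i := fun i =>
    (((EuclideanSpace.proj (𝕜 := ℝ) i).continuous.comp continuous_scaledCoord).sub
      continuous_const).measurable
  simp only [strip, Set.ofPred_forall]
  refine MeasurableSet.iInter fun i => MeasurableSet.iInter fun _ => ?_
  exact (measurableSet_le measurable_const (h i)).inter (measurableSet_lt (h i) measurable_const)

lemma add_smul_mem_strip (hd : 0 < d) (hbw : ∀ i : Fin d, i.val = 0 → b i = w) (j : Fin d → ℤ)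
    (X : Euc d) (s : ℝ) : X + s • w ∈ strip t L b j ↔ X ∈ strip t L b j := by
  refine forall_congr' fun i => forall_congr' fun hi => ?_
  have horth : inner ℝ (b i) w = 0 := by
    rw [← hbw ⟨0, hd⟩ rfl]
    exact b.orthonormal.inner_eq_zero fun h => hi (by rw [h])
  have e1 : scaledCoord t b (X + s • w) i = scaledCoord t b X i := by
    rw [scaledCoord_apply, scaledCoord_apply, inner_add_right, inner_smul_right, horth, mul_zero,
      add_zero]
  rw [e1]

/-- The two faces orthogonal to `w` are at distance `L / 2 ≥ 2` from the origin, outside the ball of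
radius `3 / 2`. The sharp tile can therefore be exchanged for a set invariant along `w`. -/
lemma mem_tile_iff_mem_strip (hL : 4 ≤ L) {j : Fin d → ℤ} (hj : j ∈ tileIndices d t) {X : Euc d}
    (hX : ‖X‖ ≤ 3 / 2) : X ∈ tile t L b j ↔ X ∈ strip t L b j := by
  rw [mem_tile]
  refine ⟨fun h i _ => h i, fun h i => ?_⟩
  by_cases hi : i.val = 0
  · have h1 := abs_real_inner_le_norm (b i) X
    rw [b.norm_eq_one, one_mul] at h1
    have h2 := abs_le.1 (h1.trans hX)
    rw [scaledCoord_apply, if_pos hi, one_mul, eq_zero_of_mem_tileIndices hj hi, Int.cast_zero,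
      mul_zero, sub_zero]
    constructor <;> linarith [h2.1, h2.2]
  · exact h i hi

end Strip

/-! ### Bounds for the local coefficients and for the direction sum. -/

section DirectionSum

variable {d : ℕ} {φ : Euc d → ℝ} {c C p : ℝ}

/-- A localised Fourier coefficient, as an integral over a strip. -/
lemma localFourier_thickMeasure (hd : 0 < d) (hφ : IsThickener φ) (hc : 0 < c) {A : Set (Euc d)}
    (hA : WellDistributed c C A) {q : ℝ} (hq : 2 ≤ q) (hp : 1 ≤ p) {t L : ℝ} (hL : 4 ≤ L)
    (b : OrthonormalBasis (Fin d) ℝ (Euc d)) (w : Euc d) {j : Fin d → ℤ}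
    (hj : j ∈ tileIndices d t) (Ψ : Euc d → ℂ) :
    localFourier (thickMeasure φ p A q) t L w b j Ψ
      = ∫ X in strip t L b j,
        (thickDensity φ p A q X • Ψ (scaledCoord t b X - tileCentre L j)) *
          Complex.exp (-(2 * Real.pi * (t * inner ℝ w X) : ℝ) * Complex.I) := by
  have hae : ∀ᵐ X ∂thickMeasure φ p A q, X ∈ Metric.closedBall (0 : Euc d) (3 / 2) :=
    thickMeasure_compl_ball hd hφ hc hA hq hp
  have hset : tile t L b j =ᵐ[thickMeasure φ p A q] strip t L b j := by
    filter_upwards [hae] with X hX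
    exact propext (mem_tile_iff_mem_strip hL hj (mem_closedBall_zero_iff.1 hX))
  rw [localFourier, setIntegral_congr_set hset, ← integral_indicator (measurableSet_strip j),
    integral_thickMeasure hd hφ hc hA (by linarith), ← integral_indicator (measurableSet_strip j)]
  refine integral_congr_ae (Filter.Eventually.of_forall fun X => ?_)
  by_cases hX : X ∈ strip t L b j
  · simp only [Set.indicator_of_mem hX, Complex.real_smul]
    ring
  · simp only [Set.indicator_of_notMem hX, mul_zero]

lemma localFourier_thickMeasure_eq_zero (hd : 0 < d) (hφ : IsThickener φ) (hc : 0 < c)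
    {A : Set (Euc d)} (hA : WellDistributed c C A) {q : ℝ} (hq : 2 ≤ q) (hp : 1 ≤ p) {t L : ℝ}
    (hL : 4 ≤ L) (b : OrthonormalBasis (Fin d) ℝ (Euc d)) (w : Euc d) {j : Fin d → ℤ}
    (hj : j ∉ tileIndices d t) (Ψ : Euc d → ℂ) :
    localFourier (thickMeasure φ p A q) t L w b j Ψ = 0 := by
  refine setIntegral_measure_zero _ (measure_mono_null (fun X hX => ?_)
    (thickMeasure_compl_ball hd hφ hc hA hq hp))
  rw [Set.mem_compl_iff, mem_closedBall_zero_iff]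
  exact fun h => hj (mem_tileIndices hL h hX)

/-- Integrating by parts `n` times on the strip gains `t ^ (-n)` and costs `(1 + √t + q ^ p) ^ n`.
The envelope vanishes outside the ball of radius `3 / 2`, which allows the return from the strip to
the tile. -/
lemma exists_enorm_localFourier_thickMeasure_le (hd : 0 < d) (hφ : IsThickener φ) (hc : 0 < c)
    (hC : 0 < C) (hp : 1 ≤ p) (K : ℕ → ℝ) {L : ℝ} (hL : 4 ≤ L) (n : ℕ) : ∃ B : ℝ, 0 ≤ B ∧
      ∀ A : Set (Euc d), WellDistributed c C A → ∀ q : ℝ, qMin d C ≤ q → ∀ t : ℝ, 0 < t →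
      ∀ (b : OrthonormalBasis (Fin d) ℝ (Euc d)) (w : Euc d), ‖w‖ = 1 →
        (∀ i : Fin d, i.val = 0 → b i = w) → ∀ (j : Fin d → ℤ) (Ψ : Euc d → ℂ),
        IsAmplitude K L Ψ →
        ‖localFourier (thickMeasure φ p A q) t L w b j Ψ‖ₑ
          ≤ ENNReal.ofReal (B * ((1 + √t + q ^ p) / t) ^ n) *
            ∫⁻ X in tile t L b j, envelope (truncFinset A q) q (q ^ p) X := by
  obtain ⟨B, hB0, hB⟩ := exists_enorm_iteratedFDeriv_localDensity_le hd hφ hc hC p K L n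
  refine ⟨B, hB0, fun A hA q hq t ht b w hw hbw j Ψ hΨ => ?_⟩
  have hq2 := two_le_of_qMin_le hq
  have hq0 : 0 < q := by linarith
  have hR0 : 0 < q ^ p := by positivity
  have hRq : q ≤ q ^ p := le_rpow_self_of_one_le (by linarith) hp
  by_cases hj : j ∈ tileIndices d t
  · rw [localFourier_thickMeasure hd hφ hc hA hq2 hp hL b w hj Ψ]
    have hcd : ContDiff ℝ ∞ fun X => Ψ (scaledCoord t b X - tileCentre L j) :=
      hΨ.smooth.comp ((scaledCoordCLM t b).contDiff.sub contDiff_const)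
    have hsupp : HasCompactSupport (thickDensity φ p A q) := by
      refine HasCompactSupport.intro (isCompact_closedBall (0 : Euc d) (1 + (q ^ p)⁻¹))
        fun X hX => thickDensity_eq_zero hd hφ hc hA hq0 ?_
      simpa using hX
    refine (enorm_setIntegral_mul_exp_le hw (measurableSet_strip j) (add_smul_mem_strip hd hbw j)
      ((contDiff_thickDensity hd hφ hc hA hq0).smul hcd) hsupp.smul_right ht n).trans ?_
    calc _ ≤ ENNReal.ofReal ((t ^ n)⁻¹) * ∫⁻ X in strip t L b j,
            ENNReal.ofReal (B * (1 + √t + q ^ p) ^ n) *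
              envelope (truncFinset A q) q (q ^ p) X := by
          gcongr with X
          exact hB A hA q hq Ψ hΨ t b (tileCentre L j) X
      _ = ENNReal.ofReal (B * ((1 + √t + q ^ p) / t) ^ n) *
            ∫⁻ X in strip t L b j, envelope (truncFinset A q) q (q ^ p) X := by
          rw [lintegral_const_mul' _ _ ENNReal.ofReal_ne_top, ← mul_assoc,
            ← ENNReal.ofReal_mul (by positivity), div_pow]
          congr 2
          ring
      _ ≤ _ := by
          refine mul_le_mul_right ?_ _
          rw [← lintegral_indicator (measurableSet_strip j),
            ← lintegral_indicator (measurableSet_tile j)]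
          refine lintegral_mono fun X => ?_
          by_cases hX : ‖X‖ ≤ 3 / 2
          · by_cases hXj : X ∈ strip t L b j
            · rw [Set.indicator_of_mem hXj,
                Set.indicator_of_mem ((mem_tile_iff_mem_strip hL hj hX).2 hXj)]
            · rw [Set.indicator_of_notMem hXj]
              exact zero_le
          · have h0 : envelope (truncFinset A q) q (q ^ p) X = 0 := by
              refine envelope_eq_zero hq0
                (fun a ha => ((mem_truncFinset hd hc hA).1 ha).2) ?_
              have : (q ^ p)⁻¹ ≤ 2⁻¹ := inv_anti₀ (by norm_num) (hq2.trans hRq)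
              push Not at hX
              linarith
            exact ((Set.indicator_le_self _ _ X).trans h0.le).trans zero_le
  · rw [localFourier_thickMeasure_eq_zero hd hφ hc hA hq2 hp hL b w hj Ψ, enorm_zero]
    exact zero_le

lemma inv_tileVolume {t L : ℝ} (hd : 0 < d) (ht : 0 < t) :
    (tileVolume d t L)⁻¹ = (L ^ d)⁻¹ * √t ^ (d - 1) := by
  obtain ⟨k, rfl⟩ := Nat.exists_eq_succ_of_ne_zero hd.ne'
  rw [tileVolume, mul_inv, ← Real.rpow_neg ht.le, Nat.succ_sub_one, Real.sqrt_eq_rpow,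
    ← Real.rpow_natCast (t ^ (1 / 2 : ℝ)), ← Real.rpow_mul ht.le]
  congr 2
  push_cast
  ring

/-- The bound for the sum over the directions and the tiles obtained by integrating by parts `n`
times. -/
lemma exists_directionSum_thickMeasure_le (hd : 0 < d) (hφ : IsThickener φ) (hc : 0 < c)
    (hC : 0 < C) (hp : 1 ≤ p) (K : ℕ → ℝ) {L c₁ t₀ : ℝ} (hL : 4 ≤ L) (hc₁ : 0 < c₁) (ht₀ : 0 < t₀)
    (n : ℕ) : ∃ M : ℝ, 0 ≤ M ∧
      ∀ A : Set (Euc d), WellDistributed c C A → ∀ q : ℝ, qMin d C ≤ q → ∀ t : ℝ, t₀ ≤ t →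
      ∀ (P : Finset (Euc d)) (b : Euc d → OrthonormalBasis (Fin d) ℝ (Euc d)),
        IsMaximalSeparated (c₁ / √t) P → (∀ w ∈ P, ∀ i : Fin d, i.val = 0 → b w i = w) →
        directionSum (thickMeasure φ p A q) K t L P b ≤ ENNReal.ofReal (M * √t ^ (d - 1) *
          (1 + √t / q) ^ (d - 1) * ((1 + √t + q ^ p) / t) ^ (2 * n)) := by
  obtain ⟨B, hB0, hB⟩ := exists_enorm_localFourier_thickMeasure_le hd hφ hc hC hp K hL n
  obtain ⟨M₁, hM₁, htile⟩ := exists_setLIntegral_tile_envelope_le hd hc (by linarith : 0 < L)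
  obtain ⟨M₂, hM₂, htot⟩ := exists_lintegral_envelope_le hd hc
  obtain ⟨M₃, hM₃, hcard⟩ := exists_card_isMaximalSeparated_le hd hc₁ ht₀
  have hL0 : 0 < L := by linarith
  refine ⟨M₃ * (L ^ d)⁻¹ * B ^ 2 * M₁ * M₂, by positivity, fun A hA q hq t ht P b hP hb => ?_⟩
  have ht0 : 0 < t := ht₀.trans_le ht
  have hr : 0 < √t := Real.sqrt_pos.2 ht0
  have hq2 := two_le_of_qMin_le hq
  have hq0 : 0 < q := by linarith
  have hR0 : 0 < q ^ p := by positivity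
  have hRq : q ≤ q ^ p := le_rpow_self_of_one_le (by linarith) hp
  have hsep := truncFinset_separated hd hc hA q
  set D := B * ((1 + √t + q ^ p) / t) ^ n with hD
  set T := M₁ * (1 / √t + 1 / q) ^ (d - 1) with hT
  have hw : ∀ w ∈ P, ∑' j : Fin d → ℤ, ⨆ Ψ : {Ψ : Euc d → ℂ // IsAmplitude K L Ψ},
      ‖localFourier (thickMeasure φ p A q) t L w (b w) j Ψ.1‖ₑ ^ 2
        ≤ ENNReal.ofReal (D ^ 2 * T * M₂) := by
    intro w hwP
    set E : (Fin d → ℤ) → ℝ≥0∞ := fun j =>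
      ∫⁻ X in tile t L (b w) j, envelope (truncFinset A q) q (q ^ p) X with hE
    calc _ ≤ ∑' j : Fin d → ℤ, ENNReal.ofReal (D ^ 2 * T) * E j := by
          refine ENNReal.tsum_le_tsum fun j => iSup_le fun Ψ => ?_
          have h1 := hB A hA q hq t ht0 (b w) w (hP.on_sphere w hwP) (hb w hwP) j Ψ.1 Ψ.2
          have h2 : E j ≤ ENNReal.ofReal T :=
            htile _ hsep q (q ^ p) t (by linarith) hRq ht0 (b w) j
          calc _ ≤ (ENNReal.ofReal D * E j) ^ 2 := by gcongr
            _ = ENNReal.ofReal (D ^ 2) * (E j * E j) := by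
                rw [mul_pow, ← ENNReal.ofReal_pow (by positivity), sq (E j)]
            -- One factor is bounded by the largest tile mass; the other is kept, so that summing
            -- over the disjoint tiles gives at most the total mass.
            _ ≤ ENNReal.ofReal (D ^ 2) * (ENNReal.ofReal T * E j) := by gcongr
            _ = _ := by rw [← mul_assoc, ← ENNReal.ofReal_mul (by positivity)]
      _ = ENNReal.ofReal (D ^ 2 * T) * ∫⁻ X in ⋃ j, tile t L (b w) j,
            envelope (truncFinset A q) q (q ^ p) X := by
          rw [ENNReal.tsum_mul_left, lintegral_iUnion (fun j => measurableSet_tile j)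
            (pairwise_disjoint_tile hL0)]
      _ ≤ ENNReal.ofReal (D ^ 2 * T) * ENNReal.ofReal M₂ := by
          gcongr
          exact (setLIntegral_le_lintegral _ _).trans (htot _ hsep q (q ^ p) (by linarith) hRq
            fun a ha => ((mem_truncFinset hd hc hA).1 ha).2)
      _ = _ := by rw [← ENNReal.ofReal_mul (by positivity)]
  calc directionSum (thickMeasure φ p A q) K t L P b
      ≤ ∑ w ∈ P, ENNReal.ofReal (tileVolume d t L)⁻¹ * ENNReal.ofReal (D ^ 2 * T * M₂) :=
        Finset.sum_le_sum fun w hwP => mul_le_mul_right (hw w hwP) _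
    _ = ENNReal.ofReal (P.card * ((L ^ d)⁻¹ * √t ^ (d - 1) * (D ^ 2 * T * M₂))) := by
        rw [Finset.sum_const, nsmul_eq_mul, inv_tileVolume hd ht0,
          ← ENNReal.ofReal_mul (by positivity), ENNReal.ofReal_mul (Nat.cast_nonneg _),
          ENNReal.ofReal_natCast]
    _ ≤ _ := by
        apply ENNReal.ofReal_le_ofReal
        calc _ ≤ M₃ * √t ^ (d - 1) * ((L ^ d)⁻¹ * √t ^ (d - 1) * (D ^ 2 * T * M₂)) := by
              gcongr
              exact hcard t ht P hP
          _ = _ := by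
              -- The number of directions and the inverse tile volume each contribute `√t ^ (d -
              -- 1)`; one of the two is combined here with the tile mass.
              have e1 : 1 + √t / q = √t * (1 / √t + 1 / q) := by field_simp
              rw [e1, mul_pow √t, hD, hT, pow_mul' _ 2 n]
              ring

end DirectionSum

/-! ### Rapid decay and the assembly of the theorem. -/

section Conclusion

variable {d : ℕ} {φ : Euc d → ℝ} {c C : ℝ}

/-- With `s = √t / q ≥ 1`, each integration by parts gains `3 / s`, and two of them gain `9 / τ`
with `τ = s²`. The growth `(1 + s) ^ k ≤ (2 τ) ^ k` is paid for by `k` of the `N + k` pairs, and `N`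
pairs remain for the decay. -/
lemma integrated_decay_le {q t : ℝ} (hq : 1 ≤ q) (ht : 0 < t) (N k : ℕ)
    (hτ : 1 ≤ t / q ^ 2) :
    (1 + √t / q) ^ k * ((1 + √t + q ^ 2) / t) ^ (2 * (N + k))
      ≤ 2 ^ k * 9 ^ (N + k) * 2 ^ N * (1 + t / q ^ 2) ^ (-(N : ℝ)) := by
  have hq0 : 0 < q := by linarith
  set τ := t / q ^ 2 with hτdef
  set s := √τ with hs
  have hτ0 : 0 < τ := by positivity
  have hs2 : s ^ 2 = τ := Real.sq_sqrt hτ0.le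
  have hs1 : 1 ≤ s := Real.one_le_sqrt.2 hτ
  have hst : √t / q = s := by rw [hs, hτdef, Real.sqrt_div' _ (by positivity), Real.sqrt_sq hq0.le]
  have hrt : √t = q * s := by rw [← hst]; field_simp
  have htq : t = q ^ 2 * s ^ 2 := by rw [hs2, hτdef]; field_simp
  have h1 : (1 + √t + q ^ 2) / t ≤ 3 / s := by
    rw [hrt, htq, div_le_div_iff₀ (by positivity) (by positivity)]
    have e1 : 0 ≤ q ^ 2 * s - q := by nlinarith
    have e2 : 0 ≤ q ^ 2 * s - 1 := by nlinarith
    nlinarith [mul_nonneg (mul_nonneg (sq_nonneg q) (by linarith : 0 ≤ s)) (by linarith : 0 ≤ s - 1)]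
  rw [hst]
  calc (1 + s) ^ k * ((1 + √t + q ^ 2) / t) ^ (2 * (N + k))
      ≤ (2 * τ) ^ k * (3 / s) ^ (2 * (N + k)) := by
        have := Real.sqrt_nonneg t
        gcongr
        nlinarith
    _ = 2 ^ k * 9 ^ (N + k) * (τ ^ N)⁻¹ := by
        rw [pow_mul, div_pow 3 s, hs2, mul_pow 2 τ, div_pow _ τ, pow_add τ]
        norm_num
        field_simp
    _ ≤ 2 ^ k * 9 ^ (N + k) * (2 ^ N * (1 + τ) ^ (-(N : ℝ))) := by
        gcongr
        rw [Real.rpow_neg (by positivity), Real.rpow_natCast, ← div_eq_mul_inv,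
          le_div_iff₀ (by positivity), inv_mul_le_iff₀ (by positivity), ← mul_pow]
        gcongr
        linarith
    _ = _ := by ring

/-- The sum over the directions and the tiles decays rapidly in `t / q²`. -/
lemma exists_directionSum_decay (hd : 0 < d) (hφ : IsThickener φ) (hc : 0 < c) (hC : 0 < C)
    (K : ℕ → ℝ) {L c₁ c₀ : ℝ} (hL : 4 ≤ L) (hc₁ : 0 < c₁) (hc₀ : 0 < c₀) (N : ℕ) :
    ∃ M : ℝ, 0 ≤ M ∧
      ∀ A : Set (Euc d), WellDistributed c C A → ∀ q : ℝ, qMin d C ≤ q → ∀ t : ℝ, c₀ * q ≤ t →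
      ∀ (P : Finset (Euc d)) (b : Euc d → OrthonormalBasis (Fin d) ℝ (Euc d)),
        IsMaximalSeparated (c₁ / √t) P → (∀ w ∈ P, ∀ i : Fin d, i.val = 0 → b w i = w) →
        directionSum (thickMeasure φ 2 A q) K t L P b ≤ ENNReal.ofReal
          (M * t ^ (((d : ℝ) - 1) / 2) * (1 + t / q ^ 2) ^ (-(N : ℝ))) := by
  -- No integration by parts for `t ≤ q²`, where the claimed decay factor is bounded below; `N + (d
  -- - 1)` of them for `t ≥ q²`, the extra `d - 1` compensating `(1 + √t / q) ^ (d - 1)`.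
  obtain ⟨M₀, hM₀, h₀⟩ := exists_directionSum_thickMeasure_le hd hφ hc hC one_le_two K hL hc₁ hc₀ 0
  obtain ⟨M₁, hM₁, h₁⟩ := exists_directionSum_thickMeasure_le hd hφ hc hC one_le_two K hL hc₁ hc₀
    (N + (d - 1))
  refine ⟨M₀ * 2 ^ (d - 1) * 2 ^ N + M₁ * (2 ^ (d - 1) * 9 ^ (N + (d - 1)) * 2 ^ N),
    by positivity, fun A hA q hq t ht P b hP hb => ?_⟩
  have hq2 := two_le_of_qMin_le hq
  have hq0 : 0 < q := by linarith
  have ht₀ : c₀ ≤ t := by nlinarith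
  have ht0 : 0 < t := by linarith
  have hpow : t ^ (((d : ℝ) - 1) / 2) = √t ^ (d - 1) := by
    rw [Real.sqrt_eq_rpow, ← Real.rpow_natCast, ← Real.rpow_mul ht0.le, Nat.cast_sub hd]
    congr 1
    push_cast
    ring
  have hR : q ^ (2 : ℝ) = q ^ 2 := by norm_cast
  rw [hpow]
  have hr := Real.sqrt_nonneg t
  set τ := t / q ^ 2 with hτdef
  have hτ0 : 0 < τ := by positivity
  rcases le_total τ 1 with hτ | hτ
  · refine (h₀ A hA q hq t ht₀ P b hP hb).trans (ENNReal.ofReal_le_ofReal ?_)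
    have hst : √t / q ≤ 1 := by
      rw [div_le_one hq0, Real.sqrt_le_left hq0.le]
      rwa [hτdef, div_le_one (by positivity)] at hτ
    have hdec : 1 ≤ 2 ^ N * (1 + τ) ^ (-(N : ℝ)) := by
      rw [Real.rpow_neg (by positivity), Real.rpow_natCast, ← div_eq_mul_inv,
        one_le_div (by positivity)]
      gcongr
      linarith
    calc _ ≤ M₀ * √t ^ (d - 1) * (1 + 1) ^ (d - 1) * 1 := by
          rw [mul_zero, pow_zero]
          gcongr
      _ ≤ M₀ * √t ^ (d - 1) * (1 + 1) ^ (d - 1) * (2 ^ N * (1 + τ) ^ (-(N : ℝ))) := by gcongr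
      _ = M₀ * 2 ^ (d - 1) * 2 ^ N * √t ^ (d - 1) * (1 + τ) ^ (-(N : ℝ)) := by
          norm_num
          ring
      _ ≤ _ := by
          gcongr
          exact le_add_of_nonneg_right (by positivity)
  · refine (h₁ A hA q hq t ht₀ P b hP hb).trans (ENNReal.ofReal_le_ofReal ?_)
    rw [hR]
    calc _ = M₁ * √t ^ (d - 1) * ((1 + √t / q) ^ (d - 1) *
            ((1 + √t + q ^ 2) / t) ^ (2 * (N + (d - 1)))) := by ring
      _ ≤ M₁ * √t ^ (d - 1) *
            (2 ^ (d - 1) * 9 ^ (N + (d - 1)) * 2 ^ N * (1 + τ) ^ (-(N : ℝ))) := by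
          exact mul_le_mul_of_nonneg_left
            (integrated_decay_le (by linarith : 1 ≤ q) ht0 N (d - 1) hτ) (by positivity)
      _ = M₁ * (2 ^ (d - 1) * 9 ^ (N + (d - 1)) * 2 ^ N) * √t ^ (d - 1) * (1 + τ) ^ (-(N : ℝ)) := by
          ring
      _ ≤ _ := by
          gcongr
          exact le_add_of_nonneg_left (by positivity)

/-- A sequence of polynomial bounds as a single rapidly decaying function. -/
noncomputable def decayProfile (M : ℕ → ℝ) (τ : ℝ) : ℝ := ⨅ n : ℕ, M n * (1 + |τ|) ^ (-(n : ℝ))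

lemma rapidlyDecaying_decayProfile {M : ℕ → ℝ} (hM : ∀ n, 0 ≤ M n) :
    RapidlyDecaying (decayProfile M) := by
  have h : ∀ τ : ℝ, ∀ n : ℕ, 0 ≤ M n * (1 + |τ|) ^ (-(n : ℝ)) := fun τ n =>
    mul_nonneg (hM n) (by positivity)
  exact ⟨fun τ => Real.iInf_nonneg (h τ), fun n => ⟨M n, fun τ =>
    ciInf_le ⟨0, by rintro _ ⟨k, rfl⟩; exact h τ k⟩ n⟩⟩

lemma le_decayProfile {M : ℕ → ℝ} {x τ : ℝ} (hτ : 0 ≤ τ)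
    (h : ∀ n : ℕ, x ≤ M n * (1 + τ) ^ (-(n : ℝ))) : x ≤ decayProfile M τ :=
  le_ciInf fun n => by rw [abs_of_nonneg hτ]; exact h n

end Conclusion

theorem theorem1p1 (d : ℕ) (hd : 2 ≤ d) (φ : Euc d → ℝ) (hφ : IsThickener φ)
    (p : ℝ) (hp₁ : 1 < p) (hp₂ : p ≤ 2) (cA CA : ℝ) (hcA : 0 < cA) (hCA : 0 < CA) :
    ∃ q₀ : ℝ, 1 ≤ q₀ ∧
      (∃ C : ℝ, 0 < C ∧ ∀ A : Set (Euc d), WellDistributed cA CA A → ∀ q : ℝ, q₀ ≤ q →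
        IsFrostman ((d : ℝ) / p) C (thickMeasure φ p A q)) ∧
      ∀ c₀ : ℝ, 0 < c₀ → ∀ c₁ : ℝ, 0 < c₁ → ∀ C₂ : ℝ, 4 ≤ C₂ →
        ∃ (η : ℝ → ℝ) (K : ℕ → ℝ) (C : ℝ), RapidlyDecaying η ∧ 0 < C ∧
          ∀ A : Set (Euc d), WellDistributed cA CA A → ∀ q : ℝ, q₀ ≤ q → ∀ t : ℝ, c₀ * q ≤ t →
            sphericalAverage (thickMeasure φ p A q) t
                ≤ C * q ^ (-(d : ℝ) + 1) * η (t / q ^ p) ∧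
            (p = 2 →
              ∀ (P : Finset (Euc d)) (b : Euc d → OrthonormalBasis (Fin d) ℝ (Euc d)),
                IsMaximalSeparated (c₁ / √t) P →
                (∀ w ∈ P, ∀ i : Fin d, i.val = 0 → b w i = w) →
                ENNReal.ofReal (sphericalAverage (thickMeasure φ p A q) t)
                    ≤ ENNReal.ofReal (C * t ^ (1 - (d : ℝ))) *
                      directionSum (thickMeasure φ p A q) K t C₂ P b ∧
                directionSum (thickMeasure φ p A q) K t C₂ P b
                    ≤ ENNReal.ofReal (C * t ^ (((d : ℝ) - 1) / 2) * η (t / q ^ 2))) := by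
  have hd0 : 0 < d := by omega
  refine ⟨qMin d CA, one_le_two.trans (two_le_of_qMin_le le_rfl),
    exists_isFrostman_thickMeasure hd0 hφ hp₁ hcA hCA, fun c₀ hc₀ c₁ hc₁ C₂ hC₂ => ?_⟩
  -- The comparison fixes `K`. The decay of the direction sum holds for any `K`, with constants
  -- depending on it, so it is applied to this one.
  obtain ⟨K, C, hC, hupper⟩ := exists_sphericalAverage_le_directionSum hd0 hC₂ hc₁ hc₀
  choose M hM hsph using fun n => exists_sphericalAverage_thickMeasure_le hd0 hφ hcA hCA p hc₀ n
  choose M' hM' hdir using fun n => exists_directionSum_decay hd0 hφ hcA hCA K hC₂ hc₁ hc₀ n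
  -- Adding the two sequences of constants lets a single `η` serve both estimates.
  set M'' : ℕ → ℝ := fun n => M n + M' n with hM''
  have hM0 : ∀ n, 0 ≤ M'' n := fun n => add_nonneg (hM n).le (hM' n)
  have hdecay := rapidlyDecaying_decayProfile hM0
  refine ⟨decayProfile M'', K, C + 1, hdecay, by positivity, fun A hA q hq t ht => ?_⟩
  have hq2 := two_le_of_qMin_le hq
  have hq0 : 0 < q := by linarith
  have ht₀ : c₀ ≤ t := by nlinarith
  have ht0 : 0 < t := by linarith
  refine ⟨?_, ?_⟩
  · have hη := hdecay.1 (t / q ^ p)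
    have h1 : sphericalAverage (thickMeasure φ p A q) t / q ^ (-(d : ℝ) + 1)
        ≤ decayProfile M'' (t / q ^ p) := by
      refine le_decayProfile (by positivity) fun n => ?_
      rw [div_le_iff₀ (by positivity)]
      refine (hsph n A hA q hq t ht).trans ?_
      have h2 : M n ≤ M'' n := le_add_of_nonneg_right (hM' n)
      calc _ ≤ M'' n * q ^ (-(d : ℝ) + 1) * (1 + t / q ^ p) ^ (-(n : ℝ)) := by gcongr
        _ = _ := by ring
    rw [div_le_iff₀ (by positivity)] at h1
    refine h1.trans ?_
    have h3 : 0 ≤ q ^ (-(d : ℝ) + 1) * decayProfile M'' (t / q ^ p) :=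
      mul_nonneg (by positivity) hη
    nlinarith
  · rintro rfl P b hP hb
    have : IsProbabilityMeasure (thickMeasure φ 2 A q) :=
      isProbabilityMeasure_thickMeasure hd0 hφ hcA hA hq0
        (by exact_mod_cast (card_truncFinset_pos hd0 hcA hCA hA hq).ne')
    refine ⟨?_, ?_⟩
    · refine (hupper (thickMeasure φ 2 A q) (thickMeasure_compl_ball hd0 hφ hcA hA hq2 hp₁.le) t ht₀
        P b hP hb).trans ?_
      gcongr
      linarith
    · have hη := hdecay.1 (t / q ^ 2)
      set S := directionSum (thickMeasure φ 2 A q) K t C₂ P b with hS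
      -- The case `n = 0` already gives finiteness, so `toReal` loses nothing and the infimum over
      -- `n` can be taken among real numbers.
      have hStop : S ≠ ⊤ := ((hdir 0 A hA q hq t ht P b hP hb).trans_lt ENNReal.ofReal_lt_top).ne
      have h1 : S.toReal / t ^ (((d : ℝ) - 1) / 2) ≤ decayProfile M'' (t / q ^ 2) := by
        refine le_decayProfile (by positivity) fun n => ?_
        rw [div_le_iff₀ (by positivity)]
        have h0 := hM' n
        refine (ENNReal.toReal_le_of_le_ofReal (by positivity)
          (hdir n A hA q hq t ht P b hP hb)).trans ?_
        have h2 : M' n ≤ M'' n := le_add_of_nonneg_left (hM n).le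
        calc _ ≤ M'' n * t ^ (((d : ℝ) - 1) / 2) * (1 + t / q ^ 2) ^ (-(n : ℝ)) := by gcongr
          _ = _ := by ring
      rw [div_le_iff₀ (by positivity)] at h1
      rw [← ENNReal.ofReal_toReal hStop]
      refine ENNReal.ofReal_le_ofReal (h1.trans ?_)
      have h3 : 0 ≤ t ^ (((d : ℝ) - 1) / 2) * decayProfile M'' (t / q ^ 2) :=
        mul_nonneg (by positivity) hη
      nlinarith
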